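/- Let $(M,c)$ be a conformal manifold of dimension $n\ge 3$ and arbitrary signature: $M$ is a smooth $n$-manifold and $c$ is an equivalence class of smooth pseudo-Riemannian metrics under $g\sim\Omega^2g$, $0<\Omega\in C^\infty(M)$. For $g\in c$ let $\nabla$ be its Levi-Civita connection, $P_{ab}$ its Schouten tensor ($\mathrm{Ric}_{ab}=(n-2)P_{ab}+Jg_{ab}$, $J=g^{ab}P_{ab}$), and $\Delta=\nabla^a\nabla_a$. Let $\mathcal E[w]$ be the bundle of conformal densities of weight $w$ (sections are smooth functions $f$ on the bundle of metrics in $c$ with $f(s^2g_x)=s^wf(g_x)$ for $s>0$), let $\mathcal E_a[w]=T^*M\otimes\mathcal E[w]$, and let $\boldsymbol g\in\Gamma(S^2T^*M\otimes\mathcal E[2])$ be the conformal metric, which is used to raise indices and to form traces. The standard tractor bundle $\mathcal T=\mathcal E_A$ is the quotient of the disjoint union over $g\in c$ of the bundles $[\mathcal T]_g=\mathcal E[1]\oplus\mathcal E_a[1]\oplus\mathcal E[-1]$ by $$(\sigma,\mu_b,\rho)_g\sim(\sigma,\ \mu_b+\Upsilon_b\sigma,\ \rho-\Upsilon^b\mu_b-\tfrac12\sigma\Upsilon^b\Upsilon_b)_{\Omega^2g},\qquad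 \Upsilon=\Omega^{-1}d\Omega .$$ The map $X:\mathcal T\to\mathcal E[1]$, $I_A\mapsto X^AI_A$, is the projection to the first slot, and in a scale $g\in c$ the tractor connection and the operator $D:\mathcal E[1]\to\mathcal T$ are $$\nabla_a(\sigma,\mu_b,\rho)=(\nabla_a\sigma-\mu_a,\ \nabla_a\mu_b+\boldsymbol g_{ab}\rho+P_{ab}\sigma,\ \nabla_a\rho-P_{ab}\mu^b),\qquad D\sigma=(n\sigma,\ n\nabla_b\sigma,\ -(\Delta\sigma+J\sigma)).$$ Theorem. (i) For smooth sections $\sigma$ of $\mathcal E[1]$ and $I$ of $\mathcal T$, the almost Einstein equation $$\nabla_{(a}\nabla_{b)_0}\sigma+P_{(ab)_0}\sigma=0,\qquad(\mathrm{AE})$$ the tractor field $D\sigma$, and the condition that $I$ be parallel do not depend on the metric $g\in c$ in which they are computed. (ii) The map $\sigma\mapsto\frac1nD\sigma$ is a bijection from the smooth sections $\sigma$ of $\mathcal E[1]$ that satisfy (AE) onto the smooth parallel standard tractor fields $I$; its inverse is $I_A\mapsto X^AI_A$. (iii) If $I$ is a parallel standard tractor field whose $\sigma=X^AI_A$ vanishes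 nowhere, then $\sigma^{-2}\boldsymbol g$ is an Einstein metric in $c$ (that is, $\mathrm{Ric}=\lambda g$ for some function $\lambda$). Conversely, every Einstein metric in $c$ is $\sigma^{-2}\boldsymbol g$ with $\sigma=X^AI_A$ for exactly one parallel standard tractor field $I$ with $\sigma>0$ everywhere. -/

import Mathlib

open scoped Manifold ContDiff

noncomputable section

namespace ConformalTractor

/-- The model space `ℝⁿ`; manifolds carry charts into it. -/
abbrev Model (n : ℕ) : Type := EuclideanSpace ℝ (Fin n)

/-- Cotangent space of `M` at `x`. -/
abbrev Cotangent (n : ℕ) {M : Type*} [TopologicalSpace M] [ChartedSpace (Model n) M]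
    (x : M) : Type :=
  TangentSpace (𝓡 n) x →L[ℝ] ℝ

/-- Bilinear forms on the tangent space of `M` at `x`. -/
abbrev Form (n : ℕ) {M : Type*} [TopologicalSpace M] [ChartedSpace (Model n) M]
    (x : M) : Type :=
  TangentSpace (𝓡 n) x →L[ℝ] TangentSpace (𝓡 n) x →L[ℝ] ℝ

/-! ### Pseudo-Riemannian metrics and conformal structures -/

section Metric

variable (n : ℕ) (M : Type*) [TopologicalSpace M] [ChartedSpace (Model n) M]
  [IsManifold (𝓡 n) ∞ M]

/-- A smooth pseudo-Riemannian metric (of any signature). -/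
@[ext]
structure PMetric where
  form : ∀ x : M, Form n x
  symm : ∀ x v w, form x v w = form x w v
  nondegenerate : ∀ x v, (∀ w, form x v w = 0) → v = 0
  smooth : ContMDiff (𝓡 n) ((𝓡 n).prod 𝓘(ℝ, Model n →L[ℝ] Model n →L[ℝ] ℝ)) ∞
    (fun x => Bundle.TotalSpace.mk' (Model n →L[ℝ] Model n →L[ℝ] ℝ) x (form x))

variable {n M}

/-- `Ω` is a smooth positive function with `g' = Ω² g`. -/
def IsRescaling (Ω : M → ℝ) (g g' : PMetric n M) : Prop :=
  ContMDiff (𝓡 n) 𝓘(ℝ) ∞ Ω ∧ (∀ x, 0 < Ω x) ∧ ∀ x, g'.form x = (Ω x) ^ 2 • g.form x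

variable (n M)

/-- Conformal equivalence of metrics. -/
instance conformalSetoid : Setoid (PMetric n M) where
  r g g' := ∃ Ω : M → ℝ, IsRescaling Ω g g'
  iseqv := by
    refine ⟨fun g => ⟨fun _ => 1, contMDiff_const, fun _ => one_pos, fun x => by simp⟩, ?_, ?_⟩
    · rintro g g' ⟨Ω, h1, h2, h3⟩
      refine ⟨fun x => (Ω x)⁻¹, h1.inv₀ (fun x => (h2 x).ne'), fun x => inv_pos.2 (h2 x),
        fun x => ?_⟩
      rw [h3 x, smul_smul, ← mul_pow, inv_mul_cancel₀ (h2 x).ne', one_pow, one_smul]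
    · rintro g g' g'' ⟨Ω, h1, h2, h3⟩ ⟨Ω', h1', h2', h3'⟩
      refine ⟨fun x => Ω' x * Ω x, h1'.mul h1, fun x => mul_pos (h2' x) (h2 x), fun x => ?_⟩
      rw [h3' x, h3 x, smul_smul, mul_pow]

/-- A conformal structure on `M`: a conformal equivalence class of metrics. -/
abbrev ConformalStructure : Type _ := Quotient (conformalSetoid n M)

variable {n M}

/-- The metrics belonging to the conformal class `c`. -/
abbrev Scale (c : ConformalStructure n M) : Type _ :=
  {g : PMetric n M // Quotient.mk (conformalSetoid n M) g = c}

end Metric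

/-! ### Local Ricci calculus of a metric

All components refer to a chart `e` and are functions of the coordinates `y ∈ e.target`. -/

section Local

variable {n : ℕ} {M : Type*} [TopologicalSpace M] [ChartedSpace (Model n) M]

/-- The coordinate vector field `∂ᵢ` of the chart `e`, at the point with coordinates `y`. -/
def coordVec (e : OpenPartialHomeomorph M (Model n)) (i : Fin n) (y : Model n) :
    TangentSpace (𝓡 n) (e.symm y) :=
  mfderiv (𝓡 n) (𝓡 n) e.symm y (EuclideanSpace.single i (1 : ℝ) : Model n)

/-- The partial derivative `∂ᵢ F` of a function of the coordinates. -/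
def pd (i : Fin n) (F : Model n → ℝ) (y : Model n) : ℝ :=
  fderiv ℝ F y (EuclideanSpace.single i (1 : ℝ))

/-- Components `θᵢ` of a `1`-form. -/
def formCoord (θ : ∀ x : M, Cotangent n x) (e : OpenPartialHomeomorph M (Model n))
    (i : Fin n) (y : Model n) : ℝ :=
  θ (e.symm y) (coordVec e i y)

variable [IsManifold (𝓡 n) ∞ M] (g : PMetric n M) (e : OpenPartialHomeomorph M (Model n))

/-- The matrix `gᵢⱼ`. -/
def gCoord (y : Model n) : Matrix (Fin n) (Fin n) ℝ :=
  fun i j => g.form (e.symm y) (coordVec e i y) (coordVec e j y)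

/-- The inverse matrix `gⁱʲ`. -/
def gInv (y : Model n) : Matrix (Fin n) (Fin n) ℝ := (gCoord g e y)⁻¹

/-- Christoffel symbols `Γᵏᵢⱼ = ½ gᵏˡ (∂ᵢ gₗⱼ + ∂ⱼ gₗᵢ - ∂ₗ gᵢⱼ)` of the Levi-Civita
connection. -/
def christoffel (k i j : Fin n) (y : Model n) : ℝ :=
  (1 / 2) * ∑ l, gInv g e y k l *
    (pd i (fun z => gCoord g e z l j) y + pd j (fun z => gCoord g e z l i) y
      - pd l (fun z => gCoord g e z i j) y)

/-- Riemannian curvature `Rᵢⱼᵏₗ`, with `R(∂ᵢ, ∂ⱼ) ∂ₗ = Rᵢⱼᵏₗ ∂ₖ` and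
`R(u, v) = [∇ᵤ, ∇ᵥ] - ∇_[u,v]`. -/
def riemann (i j k l : Fin n) (y : Model n) : ℝ :=
  pd i (christoffel g e k j l) y - pd j (christoffel g e k i l) y
    + ∑ m, (christoffel g e k i m y * christoffel g e m j l y
      - christoffel g e k j m y * christoffel g e m i l y)

/-- Ricci curvature `Ricᵢⱼ = Rₖᵢᵏⱼ`. -/
def ricci (i j : Fin n) (y : Model n) : ℝ := ∑ k, riemann g e k i k j y

/-- The trace `gⁱʲ Tᵢⱼ` of a covariant `2`-tensor. -/
def gTrace (T : Fin n → Fin n → ℝ) (y : Model n) : ℝ := ∑ i, ∑ j, gInv g e y i j * T i j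

/-- The symmetric trace-free part `T₍ᵢⱼ₎₀` of a covariant `2`-tensor. -/
def symTraceFree (T : Fin n → Fin n → ℝ) (y : Model n) (i j : Fin n) : ℝ :=
  (T i j + T j i) / 2 - gTrace g e T y / n * gCoord g e y i j

/-- `J = Sc / (2(n-1))`, the trace of the Schouten tensor. -/
def schoutenTrace (y : Model n) : ℝ :=
  gTrace g e (fun i j => ricci g e i j y) y / (2 * ((n : ℝ) - 1))

/-- Schouten tensor `Pᵢⱼ`, determined by `Ric = (n-2) P + J g`. -/
def schouten (i j : Fin n) (y : Model n) : ℝ :=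
  (ricci g e i j y - schoutenTrace g e y * gCoord g e y i j) / ((n : ℝ) - 2)

/-- Levi-Civita derivative `∇ᵢ θⱼ = ∂ᵢ θⱼ - Γᵏᵢⱼ θₖ` of a `1`-form. -/
def covForm (θ : ∀ x : M, Cotangent n x) (i j : Fin n) (y : Model n) : ℝ :=
  pd i (formCoord θ e j) y - ∑ k, christoffel g e k i j y * formCoord θ e k y

/-- Second covariant derivative `∇ᵢ∇ⱼ f` of a function. -/
def hess (f : M → ℝ) (i j : Fin n) (y : Model n) : ℝ :=
  covForm g e (mvfderiv (𝓡 n) f) i j y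

/-- The function `Δ f + J f` on `M`, where `Δ = gⁱʲ ∇ᵢ∇ⱼ`; it is computed at `x` in the
preferred chart at `x` (its value does not depend on the chart). -/
def laplacePlusJ (f : M → ℝ) (x : M) : ℝ :=
  let e := chartAt (Model n) x
  gTrace g e (fun i j => hess g e f i j (e x)) (e x) + schoutenTrace g e (e x) * f x

/-- `g` is Einstein: `Ric = μ g` for some function `μ`. -/
def IsEinstein : Prop :=
  ∃ μ : M → ℝ, ∀ e ∈ IsManifold.maximalAtlas (𝓡 n) ∞ M, ∀ y ∈ e.target, ∀ i j,
    ricci g e i j y = μ (e.symm y) * gCoord g e y i j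

end Local

/-! ### Conformally weighted bundles -/

section Weighted

variable {n : ℕ} {M : Type*} [TopologicalSpace M] [ChartedSpace (Model n) M]
  [IsManifold (𝓡 n) ∞ M]

/-- The fibre at `x` of the ray bundle of `c`: the values at `x` of all metrics in `c`. -/
def Ray (c : ConformalStructure n M) (x : M) : Type _ :=
  {h : Form n x // ∃ g : Scale c, h = g.1.form x}

/-- The value at `x` of a metric of the class, as a point of the ray bundle. -/
def Scale.ray {c : ConformalStructure n M} (g : Scale c) (x : M) : Ray c x :=
  ⟨g.1.form x, g, rfl⟩

/-- The fibre at `x` of the bundle `V[w] = V ⊗ E[w]`, where `V` is the fibre at `x` of an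
unweighted bundle: `V`-valued functions on the ray over `x`, homogeneous of degree `w`
with respect to the action `s ↦ s² h` of the positive reals. -/
@[ext]
structure Weighted (c : ConformalStructure n M) (x : M) (V : Type*) [AddCommGroup V]
    [Module ℝ V] (w : ℝ) where
  val : Ray c x → V
  homog : ∀ (s : ℝ) (h h' : Ray c x), 0 < s → h'.1 = s ^ 2 • h.1 → val h' = s ^ w • val h

instance (c : ConformalStructure n M) (x : M) (V : Type*) [AddCommGroup V] [Module ℝ V]
    (w : ℝ) : SMul ℝ (Weighted c x V w) where
  smul a τ :=
    { val := fun h => a • τ.val h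
      homog := fun s h h' hs hh => by rw [τ.homog s h h' hs hh, smul_comm] }

/-- The fibre at `x` of the density bundle `E[w]`. -/
abbrev Density (c : ConformalStructure n M) (w : ℝ) (x : M) : Type _ := Weighted c x ℝ w

/-- The fibre at `x` of `E_a[w]`. -/
abbrev WeightedCovector (c : ConformalStructure n M) (w : ℝ) (x : M) : Type _ :=
  Weighted c x (Cotangent n x) w

variable {c : ConformalStructure n M}

theorem exists_ratio (g : Scale c) {x : M} (h : Ray c x) :
    ∃ s : ℝ, 0 < s ∧ h.1 = s ^ 2 • g.1.form x := by
  obtain ⟨h, g', rfl⟩ := h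
  obtain ⟨Ω, -, h2, h3⟩ := Quotient.exact (g.2.trans g'.2.symm)
  exact ⟨Ω x, h2 x, h3 x⟩

/-- The positive number `s` with `h = s² gₓ`. -/
def ratio (g : Scale c) {x : M} (h : Ray c x) : ℝ := (exists_ratio g h).choose

theorem ratio_pos (g : Scale c) {x : M} (h : Ray c x) : 0 < ratio g h :=
  (exists_ratio g h).choose_spec.1

theorem ratio_spec (g : Scale c) {x : M} (h : Ray c x) :
    h.1 = ratio g h ^ 2 • g.1.form x := (exists_ratio g h).choose_spec.2

theorem form_ne_zero [NeZero n] (g : PMetric n M) (x : M) : g.form x ≠ 0 := by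
  intro h0
  have h1 : (EuclideanSpace.single (0 : Fin n) (1 : ℝ) : Model n) = 0 :=
    g.nondegenerate x (EuclideanSpace.single (0 : Fin n) (1 : ℝ) : Model n)
      (fun w => by rw [h0]; rfl)
  simp at h1

theorem ratio_smul [NeZero n] (g : Scale c) {x : M} (s : ℝ) (h h' : Ray c x) (hs : 0 < s)
    (hh : h'.1 = s ^ 2 • h.1) : ratio g h' = s * ratio g h := by
  rw [ratio_spec g h, ratio_spec g h', smul_smul, ← mul_pow] at hh
  have : ratio g h' ^ 2 = (s * ratio g h) ^ 2 := by
    by_contra hne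
    refine form_ne_zero g.1 x ?_
    ext v w
    have h1 : ratio g h' ^ 2 * g.1.form x v w = (s * ratio g h) ^ 2 * g.1.form x v w :=
      congrArg (fun A : Form n x => A v w) hh
    by_contra h0
    exact hne (mul_right_cancel₀ h0 h1)
  exact (pow_left_inj₀ (ratio_pos g h').le (mul_pos hs (ratio_pos g h)).le two_ne_zero).1 this

/-- The element of `V[w]` which equals `v` when trivialised by the metric `g`. -/
def ofScale [NeZero n] (g : Scale c) {x : M} {V : Type*} [AddCommGroup V] [Module ℝ V]
    (w : ℝ) (v : V) : Weighted c x V w where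
  val h := ratio g h ^ w • v
  homog s h h' hs hh := by
    rw [ratio_smul g s h h' hs hh, Real.mul_rpow hs.le (ratio_pos g h).le, mul_smul]

/-- A section of a density bundle, trivialised by the metric `g`. -/
def densAt {w : ℝ} (g : Scale c) (τ : ∀ x, Density c w x) (x : M) : ℝ := (τ x).val (g.ray x)

/-- A section of a weighted cotangent bundle, trivialised by the metric `g`. -/
def covAt {w : ℝ} (g : Scale c) (θ : ∀ x, WeightedCovector c w x) (x : M) : Cotangent n x :=
  (θ x).val (g.ray x)

/-- Smooth sections of `E[w]`. -/
def SmoothDensity {w : ℝ} (τ : ∀ x, Density c w x) : Prop :=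
  ∀ g : Scale c, ContMDiff (𝓡 n) 𝓘(ℝ) ∞ (densAt g τ)

/-- Smooth sections of `E_a[w]`. -/
def SmoothCovector {w : ℝ} (θ : ∀ x, WeightedCovector c w x) : Prop :=
  ∀ g : Scale c, ContMDiff (𝓡 n) ((𝓡 n).prod 𝓘(ℝ, Model n →L[ℝ] ℝ)) ∞
    (fun x => Bundle.TotalSpace.mk' (Model n →L[ℝ] ℝ)
      (E := fun x : M => TangentSpace (𝓡 n) x →L[ℝ] Bundle.Trivial M ℝ x) x (covAt g θ x))

/-- The almost Einstein equation `∇₍ₐ∇_b₎₀ σ + P₍ₐb₎₀ σ = 0` for `σ ∈ E[1]`, written out in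
the scale `g`: the Levi-Civita derivative of a density is the ordinary derivative in the
trivialisation given by `g`. -/
def AlmostEinstein (g : Scale c) (σ : ∀ x, Density c 1 x) : Prop :=
  ∀ e ∈ IsManifold.maximalAtlas (𝓡 n) ∞ M, ∀ y ∈ e.target, ∀ i j,
    symTraceFree g.1 e (fun k l => hess g.1 e (densAt g σ) k l y
      + schouten g.1 e k l y * densAt g σ (e.symm y)) y i j = 0

/-- The metric `g` equals `σ⁻² 𝐠`, where `𝐠` is the conformal metric, the tautological
section `h ↦ h` of `S²T*M[2]`. -/
def IsMetricOf (σ : ∀ x, Density c 1 x) (g : Scale c) : Prop :=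
  ∀ (x : M) (h : Ray c x), g.1.form x = (((σ x).val h) ^ 2)⁻¹ • h.1

end Weighted

/-! ### The standard tractor bundle -/

section Tractor

variable {n : ℕ} {M : Type*} [TopologicalSpace M] [ChartedSpace (Model n) M]
  [IsManifold (𝓡 n) ∞ M]

/-- The fibre at `x` of `E[1] ⊕ E_a[1] ⊕ E[-1]`. -/
@[ext]
structure Triple (c : ConformalStructure n M) (x : M) where
  top : Density c 1 x
  mid : WeightedCovector c 1 x
  bot : Density c (-1) x

variable {c : ConformalStructure n M}

/-- The bilinear form `h⁻¹` on the cotangent space induced by a nondegenerate form `h`. -/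
def dualForm {x : M} (h : Form n x) (α β : Cotangent n x) : ℝ :=
  α (ContinuousLinearMap.inverse h β)

/-- The pairs (a metric in `c`, a triple) that represent the same standard tractor at `x`.
If `g' = Ω² g` and `Υ = Ω⁻¹ dΩ`, then `(g, (σ, μ, ρ))` is identified with
`(g', (σ, μ + Υ σ, ρ - Υᵇ μ_b - ½ σ Υᵇ Υ_b))`, indices being raised with the conformal
metric. -/
def TractorRel (c : ConformalStructure n M) (x : M) (p q : Scale c × Triple c x) : Prop :=
  ∃ Ω : M → ℝ, IsRescaling Ω p.1.1 q.1.1 ∧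
    let Υ : Cotangent n x := (Ω x)⁻¹ • mvfderiv (𝓡 n) Ω x
    ∀ h : Ray c x,
      q.2.top.val h = p.2.top.val h ∧
      q.2.mid.val h = p.2.mid.val h + p.2.top.val h • Υ ∧
      q.2.bot.val h = p.2.bot.val h - dualForm h.1 Υ (p.2.mid.val h)
        - (1 / 2) * p.2.top.val h * dualForm h.1 Υ Υ

/-- The fibre at `x` of the conformal standard tractor bundle. -/
def Tractor (c : ConformalStructure n M) (x : M) : Type _ := Quot (TractorRel c x)

/-- The tractor at `x` given in the scale `g` by the triple `t`. -/
def Tractor.mk {x : M} (g : Scale c) (t : Triple c x) : Tractor c x := Quot.mk _ (g, t)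

instance (x : M) : SMul ℝ (Triple c x) where
  smul a t := ⟨a • t.top, a • t.mid, a • t.bot⟩

instance (x : M) : SMul ℝ (Tractor c x) where
  smul a := Quot.map (fun p => (p.1, a • p.2)) (by
    rintro p q ⟨Ω, hΩ, H⟩
    refine ⟨Ω, hΩ, fun h => ?_⟩
    obtain ⟨h1, h2, h3⟩ := H h
    refine ⟨?_, ?_, ?_⟩
    · change a • q.2.top.val h = a • p.2.top.val h
      rw [h1]
    · change a • q.2.mid.val h = a • p.2.mid.val h + (a • p.2.top.val h) • _
      rw [h2, smul_add, smul_assoc]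
    · change a • q.2.bot.val h = a • p.2.bot.val h - dualForm h.1 _ (a • p.2.mid.val h)
        - (1 / 2) * (a • p.2.top.val h) * _
      rw [h3]
      simp only [dualForm, map_smul, smul_eq_mul]
      ring)

/-- The canonical projection `X : 𝒯 → E[1]`, `I_A ↦ X^A I_A`. -/
def canonicalX {x : M} : Tractor c x → Density c 1 x :=
  Quot.lift (fun p => p.2.top) (by
    rintro p q ⟨Ω, -, H⟩
    ext h
    exact (H h).1.symm)

/-- Smooth sections of `E[1] ⊕ E_a[1] ⊕ E[-1]`. -/
def SmoothTriple (t : ∀ x, Triple c x) : Prop :=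
  SmoothDensity (fun x => (t x).top) ∧ SmoothCovector (fun x => (t x).mid) ∧
    SmoothDensity (fun x => (t x).bot)

/-- Smooth standard tractor fields: in each scale they are given by a smooth triple. -/
def SmoothTractor (I : ∀ x, Tractor c x) : Prop :=
  ∀ g : Scale c, ∃ t : ∀ x, Triple c x, SmoothTriple t ∧ ∀ x, I x = Tractor.mk g (t x)

/-- The tractor connection in the scale `g`, in direction `∂ᵢ` of a chart `e` and in the
trivialisation of densities given by `g`:
`∇ᵢ(σ, μⱼ, ρ) = (∇ᵢ σ - μᵢ, ∇ᵢ μⱼ + gᵢⱼ ρ + Pᵢⱼ σ, ∇ᵢ ρ - Pᵢⱼ μʲ)`. -/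
def tractorConnection (g : Scale c) (t : ∀ x, Triple c x)
    (e : OpenPartialHomeomorph M (Model n)) (i : Fin n) (y : Model n) :
    ℝ × (Fin n → ℝ) × ℝ :=
  let σ : M → ℝ := densAt g (fun x => (t x).top)
  let μ : ∀ x : M, Cotangent n x := covAt g (fun x => (t x).mid)
  let ρ : M → ℝ := densAt g (fun x => (t x).bot)
  (formCoord (mvfderiv (𝓡 n) σ) e i y - formCoord μ e i y,
    fun j => covForm g.1 e μ i j y + gCoord g.1 e y i j * ρ (e.symm y)
      + schouten g.1 e i j y * σ (e.symm y),
    formCoord (mvfderiv (𝓡 n) ρ) e i y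
      - ∑ j, ∑ k, schouten g.1 e i j y * gInv g.1 e y j k * formCoord μ e k y)

/-- The tractor field `I` is parallel for the tractor connection, computed in the scale `g`. -/
def Parallel (g : Scale c) (I : ∀ x, Tractor c x) : Prop :=
  ∃ t : ∀ x, Triple c x, SmoothTriple t ∧ (∀ x, I x = Tractor.mk g (t x)) ∧
    ∀ e ∈ IsManifold.maximalAtlas (𝓡 n) ∞ M, ∀ y ∈ e.target, ∀ i,
      tractorConnection g t e i y = 0

/-- The operator `D : E[1] → 𝒯`, computed in the scale `g`:
`D σ = (n σ, n ∇_b σ, -(Δ σ + J σ))`. -/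
def tractorD [NeZero n] (g : Scale c) (σ : ∀ x, Density c 1 x) (x : M) : Tractor c x :=
  Tractor.mk g
    { top := (n : ℝ) • σ x
      mid := ofScale g 1 ((n : ℝ) • mvfderiv (𝓡 n) (densAt g σ) x)
      bot := ofScale g (-1) (-laplacePlusJ g.1 (densAt g σ) x) }

/-- The scale tractor `(1/n) D σ`, computed in the scale `g`. -/
def scaleTractor [NeZero n] (g : Scale c) (σ : ∀ x, Density c 1 x) : ∀ x, Tractor c x :=
  fun x => (1 / (n : ℝ)) • tractorD g σ x

/-- The map `I_A ↦ X^A I_A` on sections. -/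
def projX (I : ∀ x, Tractor c x) : ∀ x, Density c 1 x := fun x => canonicalX (I x)

end Tractor

end ConformalTractor

end

open ConformalTractor

noncomputable section

set_option linter.unusedSectionVars false
set_option maxSynthPendingDepth 3

namespace ConformalTractor

open scoped Topology

/-! ### Local calculus of metrics and connections on an open subset of a vector space -/

section Trace

variable {E : Type*} [NormedAddCommGroup E] [NormedSpace ℝ E] [FiniteDimensional ℝ E]

/-- The trace of an endomorphism, as a continuous linear functional. -/
def tr : (E →L[ℝ] E) →L[ℝ] ℝ :=
  LinearMap.toContinuousLinearMap ((LinearMap.trace ℝ E).comp (ContinuousLinearMap.coeLM ℝ))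

theorem tr_apply (A : E →L[ℝ] E) : tr A = LinearMap.trace ℝ E (A : E →ₗ[ℝ] E) := rfl

theorem tr_comp_comm (A B : E →L[ℝ] E) : tr (A ∘L B) = tr (B ∘L A) := by
  simp only [tr_apply]
  exact LinearMap.trace_comp_comm' _ _

theorem tr_id : tr (ContinuousLinearMap.id ℝ E) = Module.finrank ℝ E := by
  simp [tr_apply]

theorem tr_smulRight (α : E →L[ℝ] ℝ) (v : E) : tr (α.smulRight v) = α v := by
  rw [tr_apply]
  exact LinearMap.trace_smulRight _ _

theorem tr_eq_of_intertwine {B A A' : E →L[ℝ] E} (hB : Function.Bijective B)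
    (h : B ∘L A = A' ∘L B) : tr A = tr A' := by
  let e : E ≃ₗ[ℝ] E := LinearEquiv.ofBijective (B : E →ₗ[ℝ] E) hB
  have : (A' : E →ₗ[ℝ] E) = e.conj (A : E →ₗ[ℝ] E) := by
    ext v
    obtain ⟨u, rfl⟩ := hB.2 v
    have h1 : e.symm (B u) = u := e.symm_apply_apply u
    have h2 := congrArg (fun T : E →L[ℝ] E => T u) h
    simp only [ContinuousLinearMap.comp_apply] at h2
    simp only [LinearEquiv.conj_apply, LinearMap.comp_apply, LinearEquiv.coe_coe, h1,
      ContinuousLinearMap.coe_coe, ← h2]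
    rfl
  rw [tr_apply, tr_apply, this, LinearMap.trace_conj']

theorem tr_eq_sum {ι : Type*} [Fintype ι] (b : Module.Basis ι ℝ E) (A : E →L[ℝ] E) :
    tr A = ∑ i, b.repr (A (b i)) i := by
  classical
  rw [tr_apply, LinearMap.trace_eq_matrix_trace ℝ b, Matrix.trace]
  simp [LinearMap.toMatrix_apply]

end Trace

section Algebra

variable {E : Type*} [NormedAddCommGroup E] [NormedSpace ℝ E] [FiniteDimensional ℝ E]

/-- Symmetric and nondegenerate bilinear forms. -/
structure IsInner (G : E →L[ℝ] E →L[ℝ] ℝ) : Prop where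
  symm : ∀ u v, G u v = G v u
  nondeg : ∀ u, (∀ v, G u v = 0) → u = 0

variable {G : E →L[ℝ] E →L[ℝ] ℝ}

theorem IsInner.isInvertible (hG : IsInner G) : G.IsInvertible := by
  have hinj : Function.Injective (G : E →ₗ[ℝ] (E →L[ℝ] ℝ)) := by
    rw [← LinearMap.ker_eq_bot, LinearMap.ker_eq_bot']
    intro u hu
    exact hG.nondeg u fun v => congrArg (fun T : E →L[ℝ] ℝ => T v) hu
  have hdim : Module.finrank ℝ E = Module.finrank ℝ (E →L[ℝ] ℝ) := by
    rw [← LinearEquiv.finrank_eq (LinearMap.toContinuousLinearMap (𝕜 := ℝ) (E := E) (F' := ℝ))]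
    exact (Subspace.dual_finrank_eq).symm
  refine ⟨(LinearEquiv.ofInjectiveOfFinrankEq (G : E →ₗ[ℝ] (E →L[ℝ] ℝ)) hinj
    hdim).toContinuousLinearEquiv, ?_⟩
  ext u v
  rfl

theorem IsInner.apply_inverse (hG : IsInner G) (α : E →L[ℝ] ℝ) : G (G.inverse α) = α :=
  hG.isInvertible.self_apply_inverse α

theorem IsInner.ext (hG : IsInner G) {u u' : E} (h : ∀ v, G u v = G u' v) : u = u' := by
  rw [← sub_eq_zero]
  exact hG.nondeg _ fun v => by simp [h v]

theorem IsInner.inverse_apply (hG : IsInner G) (u : E) : G.inverse (G u) = u :=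
  hG.isInvertible.inverse_apply_self u

/-- The endomorphism obtained by raising the second index of a bilinear form. -/
def raise (G T : E →L[ℝ] E →L[ℝ] ℝ) : E →L[ℝ] E := G.inverse ∘L T

/-- The trace of a bilinear form with respect to `G`. -/
def trG (G T : E →L[ℝ] E →L[ℝ] ℝ) : ℝ := tr (raise G T)

theorem IsInner.apply_raise (hG : IsInner G) (T : E →L[ℝ] E →L[ℝ] ℝ) (u v : E) :
    G (raise G T u) v = T u v := by
  rw [raise, ContinuousLinearMap.comp_apply, hG.apply_inverse]

theorem IsInner.raise_eq (hG : IsInner G) {T : E →L[ℝ] E →L[ℝ] ℝ} {A : E →L[ℝ] E}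
    (h : ∀ u v, G (A u) v = T u v) : raise G T = A := by
  ext u
  exact hG.ext fun v => by rw [hG.apply_raise, h]

theorem raise_add (T T' : E →L[ℝ] E →L[ℝ] ℝ) : raise G (T + T') = raise G T + raise G T' := by
  ext; simp [raise]

theorem raise_smul (a : ℝ) (T : E →L[ℝ] E →L[ℝ] ℝ) : raise G (a • T) = a • raise G T := by
  ext; simp [raise]

theorem trG_add (T T' : E →L[ℝ] E →L[ℝ] ℝ) : trG G (T + T') = trG G T + trG G T' := by
  simp [trG, raise_add]

theorem trG_smul (a : ℝ) (T : E →L[ℝ] E →L[ℝ] ℝ) : trG G (a • T) = a * trG G T := by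
  simp [trG, raise_smul]

theorem IsInner.trG_self (hG : IsInner G) : trG G G = Module.finrank ℝ E := by
  rw [trG, hG.raise_eq (A := ContinuousLinearMap.id ℝ E) (fun _ _ => rfl), tr_id]

theorem IsInner.trG_smulRight (hG : IsInner G) (α β : E →L[ℝ] ℝ) :
    trG G (α.smulRight β) = α (G.inverse β) := by
  rw [trG, hG.raise_eq (A := α.smulRight (G.inverse β)), tr_smulRight]
  intro u v
  simp [hG.apply_inverse]

theorem trG_pullback {G' T T' : E →L[ℝ] E →L[ℝ] ℝ} (hG : IsInner G) (hG' : IsInner G')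
    {B : E →L[ℝ] E} (hB : Function.Bijective B) (h : ∀ u v, G u v = G' (B u) (B v))
    (hT : ∀ u v, T u v = T' (B u) (B v)) : trG G T = trG G' T' := by
  refine tr_eq_of_intertwine hB ?_
  ext u
  refine hG'.ext fun w => ?_
  obtain ⟨v, rfl⟩ := hB.2 w
  simp only [ContinuousLinearMap.comp_apply]
  rw [← h, hG.apply_raise, hG'.apply_raise, hT]

/-- The basis dual to `b` with respect to `G`. -/
def dualVec {ι : Type*} (G : E →L[ℝ] E →L[ℝ] ℝ) (b : Module.Basis ι ℝ E) (i : ι) : E :=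
  G.inverse (LinearMap.toContinuousLinearMap (b.coord i))

theorem IsInner.dualVec_apply {ι : Type*} (hG : IsInner G) (b : Module.Basis ι ℝ E) (i : ι)
    (v : E) : G (dualVec G b i) v = b.repr v i := by
  rw [dualVec, hG.apply_inverse]
  rfl

theorem IsInner.tr_eq {ι : Type*} [Fintype ι] (hG : IsInner G) (b : Module.Basis ι ℝ E)
    (A : E →L[ℝ] E) : tr A = ∑ i, G (A (b i)) (dualVec G b i) := by
  rw [tr_eq_sum b]
  exact Finset.sum_congr rfl fun i _ => by rw [hG.symm, hG.dualVec_apply]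

theorem IsInner.trG_eq {ι : Type*} [Fintype ι] (hG : IsInner G) (b : Module.Basis ι ℝ E)
    (T : E →L[ℝ] E →L[ℝ] ℝ) : trG G T = ∑ i, T (b i) (dualVec G b i) := by
  rw [trG, hG.tr_eq b]
  exact Finset.sum_congr rfl fun i _ => hG.apply_raise _ _ _

theorem IsInner.sum_dualVec {ι : Type*} [Fintype ι] (hG : IsInner G) (b : Module.Basis ι ℝ E)
    (v : E) : ∑ i, G v (b i) • dualVec G b i = v := by
  refine hG.ext fun w => ?_
  conv_rhs => rw [← b.sum_repr w, map_sum]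
  simp [hG.dualVec_apply, mul_comm]

theorem IsInner.sum_apply_dualVec {ι : Type*} [Fintype ι] (hG : IsInner G)
    (b : Module.Basis ι ℝ E) (v : E) : ∑ i, G v (dualVec G b i) • b i = v := by
  conv_rhs => rw [← b.sum_repr v]
  exact Finset.sum_congr rfl fun i _ => by rw [hG.symm, hG.dualVec_apply]

theorem IsInner.trG_flip (hG : IsInner G) (T : E →L[ℝ] E →L[ℝ] ℝ) :
    trG G T.flip = trG G T := by
  let b := Module.finBasis ℝ E
  have h : ∀ S : E →L[ℝ] E →L[ℝ] ℝ, trG G S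
      = ∑ i, ∑ j, G (dualVec G b i) (dualVec G b j) * S (b i) (b j) := by
    intro S
    rw [hG.trG_eq b]
    refine Finset.sum_congr rfl fun i _ => ?_
    conv_lhs => rw [← hG.sum_apply_dualVec b (dualVec G b i)]
    simp
  rw [h, h, Finset.sum_comm]
  refine Finset.sum_congr rfl fun i _ => Finset.sum_congr rfl fun j _ => ?_
  rw [hG.symm, ContinuousLinearMap.flip_apply]

end Algebra

section Deriv

variable {E F₁ F₂ F₃ H : Type*} [NormedAddCommGroup E] [NormedSpace ℝ E]
  [NormedAddCommGroup F₁] [NormedSpace ℝ F₁] [NormedAddCommGroup F₂] [NormedSpace ℝ F₂]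
  [NormedAddCommGroup F₃] [NormedSpace ℝ F₃] [NormedAddCommGroup H] [NormedSpace ℝ H]

theorem fderiv_apply₁ {T : E → F₁ →L[ℝ] H} {y : E} (hT : DifferentiableAt ℝ T y) (a : F₁)
    (w : E) : fderiv ℝ (fun z => T z a) y w = fderiv ℝ T y w a := by
  rw [(hT.hasFDerivAt.clm_apply (hasFDerivAt_const a y)).fderiv]
  simp

theorem fderiv_apply_fun {T : E → F₁ →L[ℝ] H} {a : E → F₁} {y : E}
    (hT : DifferentiableAt ℝ T y) (ha : DifferentiableAt ℝ a y) (w : E) :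
    fderiv ℝ (fun z => T z (a z)) y w = fderiv ℝ T y w (a y) + T y (fderiv ℝ a y w) := by
  rw [(hT.hasFDerivAt.clm_apply ha.hasFDerivAt).fderiv]
  simp [add_comm]

theorem fderiv_apply₂_fun {T : E → F₁ →L[ℝ] F₂ →L[ℝ] H} {a : E → F₁} {b : E → F₂} {y : E}
    (hT : DifferentiableAt ℝ T y) (ha : DifferentiableAt ℝ a y) (hb : DifferentiableAt ℝ b y)
    (w : E) : fderiv ℝ (fun z => T z (a z) (b z)) y w
      = fderiv ℝ T y w (a y) (b y) + T y (fderiv ℝ a y w) (b y)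
        + T y (a y) (fderiv ℝ b y w) := by
  rw [fderiv_apply_fun (hT.clm_apply ha) hb, fderiv_apply_fun hT ha]
  simp

theorem fderiv_apply₂ {T : E → F₁ →L[ℝ] F₂ →L[ℝ] H} {y : E}
    (hT : DifferentiableAt ℝ T y) (a : F₁) (b : F₂) (w : E) :
    fderiv ℝ (fun z => T z a b) y w = fderiv ℝ T y w a b := by
  rw [fderiv_apply₁ (hT.clm_apply (differentiableAt_const a)), fderiv_apply₁ hT]

theorem fderiv_apply₃ {T : E → F₁ →L[ℝ] F₂ →L[ℝ] F₃ →L[ℝ] H} {y : E}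
    (hT : DifferentiableAt ℝ T y) (a : F₁) (b : F₂) (c : F₃) (w : E) :
    fderiv ℝ (fun z => T z a b c) y w = fderiv ℝ T y w a b c := by
  have h : DifferentiableAt ℝ (fun z => T z a) y :=
    hT.clm_apply (differentiableAt_const a)
  rw [fderiv_apply₂ h, fderiv_apply₁ hT]

theorem fderiv_clm_left (L : H →L[ℝ] F₁) {a : E → H} {y : E} (ha : DifferentiableAt ℝ a y)
    (w : E) : fderiv ℝ (fun z => L (a z)) y w = L (fderiv ℝ a y w) := by
  have h : HasFDerivAt (fun z => L (a z)) (L ∘L fderiv ℝ a y) y :=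
    L.hasFDerivAt.comp y ha.hasFDerivAt
  rw [h.fderiv]
  rfl

end Deriv

section Curvature

variable {E : Type*} [NormedAddCommGroup E] [NormedSpace ℝ E] [FiniteDimensional ℝ E]

/-- The map `(u, v) ↦ Γ u ∘ Γ v`. -/
def connSq (Γ : E →L[ℝ] E →L[ℝ] E) : E →L[ℝ] E →L[ℝ] E →L[ℝ] E :=
  ((ContinuousLinearMap.compL ℝ E (E →L[ℝ] E) (E →L[ℝ] E)).flip Γ).comp
    ((ContinuousLinearMap.compL ℝ E E E).comp Γ)

@[simp]
theorem connSq_apply (Γ : E →L[ℝ] E →L[ℝ] E) (u v w : E) : connSq Γ u v w = Γ u (Γ v w) := rfl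

/-- The curvature `R(u, v) w` of a connection given by its Christoffel map. -/
def curv (Γ : E → E →L[ℝ] E →L[ℝ] E) (y : E) : E →L[ℝ] E →L[ℝ] E →L[ℝ] E :=
  fderiv ℝ Γ y - (fderiv ℝ Γ y).flip + (connSq (Γ y) - (connSq (Γ y)).flip)

theorem curv_apply (Γ : E → E →L[ℝ] E →L[ℝ] E) (y u v w : E) :
    curv Γ y u v w = fderiv ℝ Γ y u v w - fderiv ℝ Γ y v u w
      + (Γ y u (Γ y v w) - Γ y v (Γ y u w)) := by
  simp [curv]

theorem curv_antisymm (Γ : E → E →L[ℝ] E →L[ℝ] E) (y u v w : E) :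
    curv Γ y u v w = -curv Γ y v u w := by
  simp only [curv_apply]; abel

/-- The flip of a bilinear map, as a continuous linear map. -/
def flipCLM (H : Type*) [NormedAddCommGroup H] [NormedSpace ℝ H] :
    (E →L[ℝ] E →L[ℝ] H) →L[ℝ] (E →L[ℝ] E →L[ℝ] H) :=
  ((ContinuousLinearMap.flipₗᵢ ℝ E E H).toContinuousLinearEquiv :
    (E →L[ℝ] E →L[ℝ] H) →L[ℝ] (E →L[ℝ] E →L[ℝ] H))

@[simp]
theorem flipCLM_apply {H : Type*} [NormedAddCommGroup H] [NormedSpace ℝ H]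
    (T : E →L[ℝ] E →L[ℝ] H) : flipCLM H T = T.flip := rfl

/-- The Ricci contraction `(v, w) ↦ tr (u ↦ R(u, v) w)`. -/
def ricciContr : (E →L[ℝ] E →L[ℝ] E →L[ℝ] E) →L[ℝ] (E →L[ℝ] E →L[ℝ] ℝ) :=
  (ContinuousLinearMap.compL ℝ E (E →L[ℝ] E →L[ℝ] E) (E →L[ℝ] ℝ)
    ((ContinuousLinearMap.compL ℝ E (E →L[ℝ] E) ℝ tr).comp (flipCLM E))).comp
      (flipCLM (E →L[ℝ] E))

theorem ricciContr_apply (R : E →L[ℝ] E →L[ℝ] E →L[ℝ] E) (v w : E) :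
    ricciContr R v w = tr ((R.flip v).flip w) := rfl

/-- The Ricci tensor of a connection. -/
def ric (Γ : E → E →L[ℝ] E →L[ℝ] E) (y : E) : E →L[ℝ] E →L[ℝ] ℝ := ricciContr (curv Γ y)

/-- The covariant derivative of a bilinear form. -/
def covBilin (Γ : E → E →L[ℝ] E →L[ℝ] E) (T : E → E →L[ℝ] E →L[ℝ] ℝ) (y w : E) :
    E →L[ℝ] E →L[ℝ] ℝ :=
  fderiv ℝ T y w - (T y).comp (Γ y w)
    - ((ContinuousLinearMap.compL ℝ E E ℝ).flip (Γ y w)).comp (T y)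

theorem covBilin_apply (Γ : E → E →L[ℝ] E →L[ℝ] E) (T : E → E →L[ℝ] E →L[ℝ] ℝ)
    (y w u v : E) : covBilin Γ T y w u v
      = fderiv ℝ T y w u v - T y (Γ y w u) v - T y u (Γ y w v) := rfl

/-- The covariant derivative of the curvature. -/
def covCurv (Γ : E → E →L[ℝ] E →L[ℝ] E) (y x : E) : E →L[ℝ] E →L[ℝ] E →L[ℝ] E :=
  fderiv ℝ (curv Γ) y x - (curv Γ y).comp (Γ y x)
    - ((ContinuousLinearMap.compL ℝ E E (E →L[ℝ] E)).flip (Γ y x)).comp (curv Γ y)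
    - (flipCLM (E →L[ℝ] E) ((ContinuousLinearMap.compL ℝ E (E →L[ℝ] E) (E →L[ℝ] E)
        ((ContinuousLinearMap.compL ℝ E E E).flip (Γ y x))).comp
          (flipCLM (E →L[ℝ] E) (curv Γ y)) ))
    + ((ContinuousLinearMap.compL ℝ E (E →L[ℝ] E) (E →L[ℝ] E)
        (ContinuousLinearMap.compL ℝ E E E (Γ y x))).comp (curv Γ y))

theorem covCurv_apply (Γ : E → E →L[ℝ] E →L[ℝ] E) (y x u v w : E) :
    covCurv Γ y x u v w = fderiv ℝ (curv Γ) y x u v w - curv Γ y (Γ y x u) v w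
      - curv Γ y u (Γ y x v) w - curv Γ y u v (Γ y x w) + Γ y x (curv Γ y u v w) := by
  simp [covCurv]

theorem contDiffOn_curv {U : Set E} (hU : IsOpen U) {Γ : E → E →L[ℝ] E →L[ℝ] E}
    (hΓ : ContDiffOn ℝ ∞ Γ U) : ContDiffOn ℝ ∞ (curv Γ) U := by
  have h1 : ContDiffOn ℝ ∞ (fderiv ℝ Γ) U := hΓ.fderiv_of_isOpen hU (by norm_num)
  have h2 : ContDiffOn ℝ ∞ (fun y => connSq (Γ y)) U :=
    (((ContinuousLinearMap.compL ℝ E (E →L[ℝ] E) (E →L[ℝ] E)).flip).contDiff.comp_contDiffOn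
      hΓ).clm_comp (contDiffOn_const.clm_comp hΓ)
  exact (h1.sub ((flipCLM (E →L[ℝ] E)).contDiff.comp_contDiffOn h1)).add
    (h2.sub ((flipCLM (E →L[ℝ] E)).contDiff.comp_contDiffOn h2))

theorem contDiffOn_ric {U : Set E} (hU : IsOpen U) {Γ : E → E →L[ℝ] E →L[ℝ] E}
    (hΓ : ContDiffOn ℝ ∞ Γ U) : ContDiffOn ℝ ∞ (ric Γ) U :=
  (ricciContr (E := E)).contDiff.comp_contDiffOn (contDiffOn_curv hU hΓ)

theorem _root_.ContDiffOn.differentiableAt_of_isOpen {F : Type*} [NormedAddCommGroup F]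
    [NormedSpace ℝ F] {U : Set E} {f : E → F} (hf : ContDiffOn ℝ ∞ f U) (hU : IsOpen U) {y : E}
    (hy : y ∈ U) : DifferentiableAt ℝ f y :=
  (hf.contDiffAt (hU.mem_nhds hy)).differentiableAt (by simp)

theorem _root_.ContDiffOn.second_symm {F : Type*} [NormedAddCommGroup F]
    [NormedSpace ℝ F] {U : Set E} {f : E → F} (hf : ContDiffOn ℝ ∞ f U) (hU : IsOpen U) {y : E}
    (hy : y ∈ U) (u v : E) : fderiv ℝ (fderiv ℝ f) y u v = fderiv ℝ (fderiv ℝ f) y v u :=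
  (hf.contDiffAt (hU.mem_nhds hy)).isSymmSndFDerivAt
    (by rw [minSmoothness_of_isRCLikeNormedField]; exact ENat.LEInfty.out) u v

theorem _root_.ContDiffOn.fderiv' {F : Type*} [NormedAddCommGroup F]
    [NormedSpace ℝ F] {U : Set E} {f : E → F} (hf : ContDiffOn ℝ ∞ f U) (hU : IsOpen U) :
    ContDiffOn ℝ ∞ (fderiv ℝ f) U := hf.fderiv_of_isOpen hU (by norm_num)

theorem fderiv_curv {U : Set E} (hU : IsOpen U) {Γ : E → E →L[ℝ] E →L[ℝ] E}
    (hΓ : ContDiffOn ℝ ∞ Γ U) {y : E} (hy : y ∈ U) (x u v w : E) :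
    fderiv ℝ (curv Γ) y x u v w = fderiv ℝ (fderiv ℝ Γ) y x u v w
      - fderiv ℝ (fderiv ℝ Γ) y x v u w
      + (fderiv ℝ Γ y x u (Γ y v w) + Γ y u (fderiv ℝ Γ y x v w)
        - (fderiv ℝ Γ y x v (Γ y u w) + Γ y v (fderiv ℝ Γ y x u w))) := by
  have hd := hΓ.differentiableAt_of_isOpen hU hy
  have hd' := (hΓ.fderiv' hU).differentiableAt_of_isOpen hU hy
  have h2 : ∀ a b : E, HasFDerivAt (fun z => Γ z a b) (fderiv ℝ (fun z => Γ z a b) y) y :=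
    fun a b => ((hd.clm_apply (differentiableAt_const a)).clm_apply
      (differentiableAt_const b)).hasFDerivAt
  have h3 : ∀ a b c : E, HasFDerivAt (fun z => fderiv ℝ Γ z a b c)
      (fderiv ℝ (fun z => fderiv ℝ Γ z a b c) y) y := fun a b c =>
    (((hd'.clm_apply (differentiableAt_const a)).clm_apply
      (differentiableAt_const b)).clm_apply (differentiableAt_const c)).hasFDerivAt
  have h4 : ∀ a b c : E, HasFDerivAt (fun z => Γ z a (Γ z b c))
      (fderiv ℝ (fun z => Γ z a (Γ z b c)) y) y := fun a b c =>
    ((hd.clm_apply (differentiableAt_const a)).clm_apply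
      (h2 b c).differentiableAt).hasFDerivAt
  have e4 : ∀ a b c : E, fderiv ℝ (fun z => Γ z a (Γ z b c)) y x
      = fderiv ℝ Γ y x a (Γ y b c) + Γ y a (fderiv ℝ Γ y x b c) := by
    intro a b c
    rw [fderiv_apply₂_fun hd (differentiableAt_const a) (h2 b c).differentiableAt,
      fderiv_apply₂ hd]
    simp
  rw [← fderiv_apply₃ ((contDiffOn_curv hU hΓ).differentiableAt_of_isOpen hU hy)]
  simp only [curv_apply]
  rw [(((h3 u v w).fun_sub (h3 v u w)).fun_add
    ((h4 u v w).fun_sub (h4 v u w))).fderiv]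
  simp only [add_apply, sub_apply, e4, fderiv_apply₃ hd']

/-- The second Bianchi identity. -/
theorem second_bianchi {U : Set E} (hU : IsOpen U) {Γ : E → E →L[ℝ] E →L[ℝ] E}
    (hΓ : ContDiffOn ℝ ∞ Γ U) (htor : ∀ y ∈ U, ∀ u v, Γ y u v = Γ y v u) {y : E} (hy : y ∈ U)
    (x u v w : E) :
    covCurv Γ y x u v w + covCurv Γ y u v x w + covCurv Γ y v x u w = 0 := by
  simp only [covCurv_apply, fderiv_curv hU hΓ hy]
  rw [hΓ.second_symm hU hy u x, hΓ.second_symm hU hy v x, hΓ.second_symm hU hy v u]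
  rw [htor y hy u x, htor y hy v x, htor y hy v u]
  rw [curv_antisymm Γ y v (Γ y x u), curv_antisymm Γ y x (Γ y u v),
    curv_antisymm Γ y u (Γ y x v)]
  simp only [curv_apply, map_add, map_sub]
  abel

/-- Smooth nondegenerate metrics on an open set together with their Levi-Civita connection. -/
structure LeviCivitaOn (U : Set E) (G : E → E →L[ℝ] E →L[ℝ] ℝ)
    (Γ : E → E →L[ℝ] E →L[ℝ] E) : Prop where
  isOpen : IsOpen U
  contDiffOn_metric : ContDiffOn ℝ ∞ G U
  contDiffOn_conn : ContDiffOn ℝ ∞ Γ U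
  isInner : ∀ y ∈ U, IsInner (G y)
  torsion : ∀ y ∈ U, ∀ u v, Γ y u v = Γ y v u
  compat : ∀ y ∈ U, ∀ w u v, fderiv ℝ G y w u v = G y (Γ y w u) v + G y u (Γ y w v)

namespace LeviCivitaOn

variable {U : Set E} {G : E → E →L[ℝ] E →L[ℝ] ℝ} {Γ : E → E →L[ℝ] E →L[ℝ] E}

theorem first_bianchi (h : LeviCivitaOn U G Γ) {y : E} (hy : y ∈ U) (u v w : E) :
    curv Γ y u v w + curv Γ y v w u + curv Γ y w u v = 0 := by
  have hs : ∀ a b c : E, fderiv ℝ Γ y a b c = fderiv ℝ Γ y a c b := by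
    intro a b c
    have hd := h.contDiffOn_conn.differentiableAt_of_isOpen h.isOpen hy
    rw [← fderiv_apply₂ hd, ← fderiv_apply₂ hd]
    have : (fun z => Γ z b c) =ᶠ[𝓝 y] fun z => Γ z c b :=
      Filter.eventually_of_mem (h.isOpen.mem_nhds hy) fun z hz => h.torsion z hz b c
    rw [this.fderiv_eq]
  simp only [curv_apply]
  rw [hs v w u, hs w v u, hs u w v, h.torsion y hy w u, h.torsion y hy v u, h.torsion y hy w v]
  abel

theorem curv_skew (h : LeviCivitaOn U G Γ) {y : E} (hy : y ∈ U) (u v a b : E) :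
    G y (curv Γ y u v a) b = -G y a (curv Γ y u v b) := by
  have hG := h.contDiffOn_metric.differentiableAt_of_isOpen h.isOpen hy
  have hG' := (h.contDiffOn_metric.fderiv' h.isOpen).differentiableAt_of_isOpen h.isOpen hy
  have hd := h.contDiffOn_conn.differentiableAt_of_isOpen h.isOpen hy
  have h2 : ∀ a b : E, DifferentiableAt ℝ (fun z => Γ z a b) y :=
    fun a b => (hd.clm_apply (differentiableAt_const a)).clm_apply (differentiableAt_const b)
  have key : ∀ u v : E, fderiv ℝ (fderiv ℝ G) y u v a b
      = fderiv ℝ G y u (Γ y v a) b + G y (fderiv ℝ Γ y u v a) b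
        + (fderiv ℝ G y u a (Γ y v b) + G y a (fderiv ℝ Γ y u v b)) := by
    intro u v
    rw [← fderiv_apply₃ hG']
    have : (fun z => fderiv ℝ G z v a b) =ᶠ[𝓝 y]
        fun z => G z (Γ z v a) b + G z a (Γ z v b) :=
      Filter.eventually_of_mem (h.isOpen.mem_nhds hy) fun z hz => h.compat z hz v a b
    have d1 : DifferentiableAt ℝ (fun z => G z (Γ z v a) b) y :=
      (hG.clm_apply (h2 v a)).clm_apply (differentiableAt_const b)
    have d2 : DifferentiableAt ℝ (fun z => G z a (Γ z v b)) y :=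
      (hG.clm_apply (differentiableAt_const a)).clm_apply (h2 v b)
    rw [this.fderiv_eq, fderiv_fun_add d1 d2, add_apply,
      fderiv_apply₂_fun hG (h2 v a) (differentiableAt_const b),
      fderiv_apply₂_fun hG (differentiableAt_const a) (h2 v b),
      fderiv_apply₂ hd, fderiv_apply₂ hd]
    simp
  have hs := congrArg (fun T : E →L[ℝ] E →L[ℝ] ℝ => T a b)
    (h.contDiffOn_metric.second_symm h.isOpen hy u v)
  simp only [key, h.compat y hy] at hs
  simp only [curv_apply, map_add, map_sub, add_apply, sub_apply]
  linarith

theorem tr_curv (h : LeviCivitaOn U G Γ) {y : E} (hy : y ∈ U) (u v : E) :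
    tr (curv Γ y u v) = 0 := by
  have hG := h.isInner y hy
  have h1 := hG.trG_flip ((G y).comp (curv Γ y u v))
  rw [trG, trG, hG.raise_eq (T := (G y).comp (curv Γ y u v)) (A := curv Γ y u v)
    (fun _ _ => rfl), hG.raise_eq (A := -curv Γ y u v)] at h1
  · rw [map_neg] at h1
    linarith
  · intro a c
    rw [ContinuousLinearMap.flip_apply, ContinuousLinearMap.comp_apply, h.curv_skew hy,
      neg_apply, map_neg, neg_apply, hG.symm]

end LeviCivitaOn

end Curvature

section Ricci

variable {E : Type*} [NormedAddCommGroup E] [NormedSpace ℝ E] [FiniteDimensional ℝ E]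

theorem covCurv_antisymm {U : Set E} (hU : IsOpen U) {Γ : E → E →L[ℝ] E →L[ℝ] E}
    (hΓ : ContDiffOn ℝ ∞ Γ U) {y : E} (hy : y ∈ U) (x u v w : E) :
    covCurv Γ y x u v w = -covCurv Γ y x v u w := by
  have h : fderiv ℝ (curv Γ) y x u v w = -fderiv ℝ (curv Γ) y x v u w := by
    simp only [fderiv_curv hU hΓ hy]; abel
  simp only [covCurv_apply]
  rw [h, curv_antisymm Γ y u v, curv_antisymm Γ y (Γ y x u), curv_antisymm Γ y u (Γ y x v),
    curv_antisymm Γ y u v, map_neg]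
  abel

theorem covBilin_ric {U : Set E} (hU : IsOpen U) {Γ : E → E →L[ℝ] E →L[ℝ] E}
    (hΓ : ContDiffOn ℝ ∞ Γ U) {y : E} (hy : y ∈ U) (x v w : E) :
    covBilin Γ (ric Γ) y x v w = ricciContr (covCurv Γ y x) v w := by
  have h1 : fderiv ℝ (ric Γ) y x = ricciContr (fderiv ℝ (curv Γ) y x) :=
    fderiv_clm_left _ ((contDiffOn_curv hU hΓ).differentiableAt_of_isOpen hU hy) x
  have h2 : ((covCurv Γ y x).flip v).flip w = (((fderiv ℝ (curv Γ) y x).flip v).flip w)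
      - (((curv Γ y).flip (Γ y x v)).flip w) - (((curv Γ y).flip v).flip (Γ y x w))
      - ((((curv Γ y).flip v).flip w) ∘L Γ y x) + (Γ y x ∘L (((curv Γ y).flip v).flip w)) := by
    ext u
    simp only [add_apply, sub_apply, ContinuousLinearMap.flip_apply,
      ContinuousLinearMap.comp_apply, covCurv_apply]
    abel
  rw [covBilin_apply, h1, ricciContr_apply, ricciContr_apply, h2, ric, ricciContr_apply,
    ricciContr_apply, map_add, map_sub, map_sub, map_sub, tr_comp_comm (Γ y x)]
  ring

namespace LeviCivitaOn

variable {U : Set E} {G : E → E →L[ℝ] E →L[ℝ] ℝ} {Γ : E → E →L[ℝ] E →L[ℝ] E}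

theorem ric_symm (h : LeviCivitaOn U G Γ) {y : E} (hy : y ∈ U) (v w : E) :
    ric Γ y v w = ric Γ y w v := by
  have h1 : ((curv Γ y).flip v).flip w = ((curv Γ y).flip w).flip v - curv Γ y v w := by
    ext u
    have := h.first_bianchi hy u v w
    rw [curv_antisymm Γ y w u] at this
    simp only [sub_apply, ContinuousLinearMap.flip_apply]
    rw [← sub_eq_zero, ← this]
    abel
  rw [ric, ricciContr_apply, ricciContr_apply, h1, map_sub, h.tr_curv hy, sub_zero]

theorem contDiffOn_raise (h : LeviCivitaOn U G Γ) {T : E → E →L[ℝ] E →L[ℝ] ℝ}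
    (hT : ContDiffOn ℝ ∞ T U) : ContDiffOn ℝ ∞ (fun z => raise (G z) (T z)) U := by
  refine ContDiffOn.clm_comp (fun z hz => ?_) hT
  exact ((h.isInner z hz).isInvertible.contDiffAt_map_inverse).comp_contDiffWithinAt z
    (h.contDiffOn_metric z hz)

theorem contDiffOn_trG (h : LeviCivitaOn U G Γ) {T : E → E →L[ℝ] E →L[ℝ] ℝ}
    (hT : ContDiffOn ℝ ∞ T U) : ContDiffOn ℝ ∞ (fun z => trG (G z) (T z)) U :=
  (tr (E := E)).contDiff.comp_contDiffOn (h.contDiffOn_raise hT)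

theorem fderiv_trG (h : LeviCivitaOn U G Γ) {T : E → E →L[ℝ] E →L[ℝ] ℝ}
    (hT : ContDiffOn ℝ ∞ T U) {y : E} (hy : y ∈ U) (w : E) :
    fderiv ℝ (fun z => trG (G z) (T z)) y w = trG (G y) (covBilin Γ T y w) := by
  have hG := h.isInner y hy
  set A : E → E →L[ℝ] E := fun z => raise (G z) (T z) with hA
  have dA := (h.contDiffOn_raise hT).differentiableAt_of_isOpen h.isOpen hy
  have dG := h.contDiffOn_metric.differentiableAt_of_isOpen h.isOpen hy
  have dT := hT.differentiableAt_of_isOpen h.isOpen hy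
  have key : raise (G y) (covBilin Γ T y w)
      = fderiv ℝ A y w + Γ y w ∘L A y - A y ∘L Γ y w := by
    refine hG.raise_eq fun u v => ?_
    have hev : (fun z => G z (A z u) v) =ᶠ[𝓝 y] fun z => T z u v :=
      Filter.eventually_of_mem (h.isOpen.mem_nhds hy) fun z hz =>
        (h.isInner z hz).apply_raise _ _ _
    have dAu : DifferentiableAt ℝ (fun z => A z u) y :=
      dA.clm_apply (differentiableAt_const u)
    have h1 := congrArg (fun L : E →L[ℝ] ℝ => L w) hev.fderiv_eq
    simp only [fderiv_apply₂ dT, fderiv_apply₂_fun dG dAu (differentiableAt_const v),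
      fderiv_apply₁ (T := A) dA, h.compat y hy] at h1
    have h2 : ∀ a b, G y (A y a) b = T y a b := hG.apply_raise _
    rw [covBilin_apply, ← h1]
    simp [h2]
    ring
  rw [trG, key, map_sub, map_add, tr_comp_comm (Γ y w)]
  rw [show (fun z => trG (G z) (T z)) = fun z => tr (A z) from rfl, fderiv_clm_left tr dA]
  ring

theorem covCurv_skew (h : LeviCivitaOn U G Γ) {y : E} (hy : y ∈ U) (x u v a b : E) :
    G y (covCurv Γ y x u v a) b = -G y a (covCurv Γ y x u v b) := by
  have dG := h.contDiffOn_metric.differentiableAt_of_isOpen h.isOpen hy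
  have dR := (contDiffOn_curv h.isOpen h.contDiffOn_conn).differentiableAt_of_isOpen h.isOpen hy
  have dR3 : ∀ c, DifferentiableAt ℝ (fun z => curv Γ z u v c) y := fun c =>
    ((dR.clm_apply (differentiableAt_const u)).clm_apply
      (differentiableAt_const v)).clm_apply (differentiableAt_const c)
  have hev : (fun z => G z (curv Γ z u v a) b) =ᶠ[𝓝 y] fun z => -G z a (curv Γ z u v b) :=
    Filter.eventually_of_mem (h.isOpen.mem_nhds hy) fun z hz => h.curv_skew hz u v a b
  have h1 := congrArg (fun L : E →L[ℝ] ℝ => L x) hev.fderiv_eq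
  simp only [fderiv_fun_neg, neg_apply,
    fderiv_apply₂_fun dG (dR3 a) (differentiableAt_const b),
    fderiv_apply₂_fun dG (differentiableAt_const a) (dR3 b), fderiv_apply₃ dR,
    h.compat y hy, fderiv_fun_const, Pi.zero_apply, zero_apply, map_zero] at h1
  have s := h.curv_skew hy
  simp only [covCurv_apply, map_add, map_sub, add_apply, sub_apply]
  rw [s (Γ y x u) v a b, s u (Γ y x v) a b, s u v (Γ y x a) b]
  have s2 := s u v a (Γ y x b)
  linarith

/-- The divergence of a symmetric bilinear form. -/
def _root_.ConformalTractor.divBilin (G : E → E →L[ℝ] E →L[ℝ] ℝ) (Γ : E → E →L[ℝ] E →L[ℝ] E)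
    (T : E → E →L[ℝ] E →L[ℝ] ℝ) (y w : E) : ℝ :=
  ∑ i, covBilin Γ T y (Module.finBasis ℝ E i) w (dualVec (G y) (Module.finBasis ℝ E) i)

/-- The contracted second Bianchi identity. -/
theorem contracted_bianchi (h : LeviCivitaOn U G Γ) {y : E} (hy : y ∈ U) (x : E) :
    fderiv ℝ (fun z => trG (G z) (ric Γ z)) y x = 2 * divBilin G Γ (ric Γ) y x := by
  have hG := h.isInner y hy
  set b := Module.finBasis ℝ E with hb
  set f := dualVec (G y) b with hf
  have hcov := covBilin_ric h.isOpen h.contDiffOn_conn hy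
  have htr : ∀ a c d, covBilin Γ (ric Γ) y a c d = ∑ i, G y (covCurv Γ y a (b i) c d) (f i) := by
    intro a c d
    rw [hcov, ricciContr_apply, hG.tr_eq b]
    rfl
  have h2 : ∀ i j, G y (covCurv Γ y x (b i) (b j) (f j)) (f i)
      = G y (covCurv Γ y (b i) (b j) x (f i)) (f j)
        + G y (covCurv Γ y (b j) (b i) x (f j)) (f i) := by
    intro i j
    have hB := congrArg (fun e => G y e (f i)) (second_bianchi h.isOpen h.contDiffOn_conn
      h.torsion hy x (b i) (b j) (f j))
    rw [covCurv_antisymm h.isOpen h.contDiffOn_conn hy (b j) x (b i)] at hB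
    simp only [map_add, map_neg, add_apply, neg_apply, map_zero, zero_apply] at hB
    have hs := h.covCurv_skew hy (b i) (b j) x (f j) (f i)
    rw [hG.symm (f j)] at hs
    linarith
  rw [h.fderiv_trG (contDiffOn_ric h.isOpen h.contDiffOn_conn) hy, hG.trG_eq b, divBilin,
    ← hb, ← hf]
  simp only [htr]
  rw [Finset.sum_comm]
  simp only [h2, Finset.sum_add_distrib]
  rw [two_mul]
  congr 1
  exact Finset.sum_comm

end LeviCivitaOn

end Ricci

section Schouten

variable {E : Type*} [NormedAddCommGroup E] [NormedSpace ℝ E] [FiniteDimensional ℝ E]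

/-- The trace of the Schouten tensor. -/
def schJ (G : E → E →L[ℝ] E →L[ℝ] ℝ) (Γ : E → E →L[ℝ] E →L[ℝ] E) (y : E) : ℝ :=
  trG (G y) (ric Γ y) / (2 * ((Module.finrank ℝ E : ℝ) - 1))

/-- The Schouten tensor. -/
def schP (G : E → E →L[ℝ] E →L[ℝ] ℝ) (Γ : E → E →L[ℝ] E →L[ℝ] E) (y : E) :
    E →L[ℝ] E →L[ℝ] ℝ :=
  ((Module.finrank ℝ E : ℝ) - 2)⁻¹ • (ric Γ y - schJ G Γ y • G y)

/-- The Hessian of a function. -/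
def hessForm (Γ : E → E →L[ℝ] E →L[ℝ] E) (f : E → ℝ) (y : E) : E →L[ℝ] E →L[ℝ] ℝ :=
  fderiv ℝ (fderiv ℝ f) y - (ContinuousLinearMap.compL ℝ E E ℝ (fderiv ℝ f y)).comp (Γ y)

theorem hessForm_apply (Γ : E → E →L[ℝ] E →L[ℝ] E) (f : E → ℝ) (y u v : E) :
    hessForm Γ f y u v = fderiv ℝ (fderiv ℝ f) y u v - fderiv ℝ f y (Γ y u v) := rfl

namespace LeviCivitaOn

variable {U : Set E} {G : E → E →L[ℝ] E →L[ℝ] ℝ} {Γ : E → E →L[ℝ] E →L[ℝ] E}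

theorem contDiffOn_schJ (h : LeviCivitaOn U G Γ) : ContDiffOn ℝ ∞ (schJ G Γ) U :=
  (h.contDiffOn_trG (contDiffOn_ric h.isOpen h.contDiffOn_conn)).div_const _

theorem contDiffOn_schP (h : LeviCivitaOn U G Γ) : ContDiffOn ℝ ∞ (schP G Γ) U :=
  ((contDiffOn_ric h.isOpen h.contDiffOn_conn).sub
    (h.contDiffOn_schJ.smul h.contDiffOn_metric)).const_smul _

theorem schP_symm (h : LeviCivitaOn U G Γ) {y : E} (hy : y ∈ U) (u v : E) :
    schP G Γ y u v = schP G Γ y v u := by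
  simp [schP, h.ric_symm hy u v, (h.isInner y hy).symm u v]

theorem ric_eq (hN : 3 ≤ Module.finrank ℝ E) (y u v : E) :
    ric Γ y u v = ((Module.finrank ℝ E : ℝ) - 2) * schP G Γ y u v + schJ G Γ y * G y u v := by
  have h3 : (3 : ℝ) ≤ Module.finrank ℝ E := by exact_mod_cast hN
  have h2 : ((Module.finrank ℝ E : ℝ) - 2) ≠ 0 := by linarith
  simp [schP]
  field_simp
  ring

theorem scal_eq (hN : 3 ≤ Module.finrank ℝ E) (y : E) :
    trG (G y) (ric Γ y) = 2 * ((Module.finrank ℝ E : ℝ) - 1) * schJ G Γ y := by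
  have h3 : (3 : ℝ) ≤ Module.finrank ℝ E := by exact_mod_cast hN
  have h2 : ((Module.finrank ℝ E : ℝ) - 1) ≠ 0 := by linarith
  rw [schJ]
  field_simp

theorem trG_schP (hN : 3 ≤ Module.finrank ℝ E) (h : LeviCivitaOn U G Γ) {y : E} (hy : y ∈ U) :
    trG (G y) (schP G Γ y) = schJ G Γ y := by
  have h3 : (3 : ℝ) ≤ Module.finrank ℝ E := by exact_mod_cast hN
  have h2 : ((Module.finrank ℝ E : ℝ) - 2) ≠ 0 := by linarith
  rw [schP, trG_smul, sub_eq_add_neg (ric Γ y), ← neg_smul, trG_add, trG_smul, scal_eq hN,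
    (h.isInner y hy).trG_self]
  field_simp
  ring

theorem _root_.ConformalTractor.fderiv_smul_bilin {f : E → ℝ} {T : E → E →L[ℝ] E →L[ℝ] ℝ}
    {y : E} (hf : DifferentiableAt ℝ f y) (hT : DifferentiableAt ℝ T y) (w u v : E) :
    fderiv ℝ (fun z => f z • T z) y w u v
      = fderiv ℝ f y w * T y u v + f y * fderiv ℝ T y w u v := by
  rw [fderiv_fun_smul hf hT]
  simp [add_comm]

theorem covBilin_schP (hN : 3 ≤ Module.finrank ℝ E) (h : LeviCivitaOn U G Γ) {y : E}
    (hy : y ∈ U) (w u v : E) : ((Module.finrank ℝ E : ℝ) - 2) * covBilin Γ (schP G Γ) y w u v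
      = covBilin Γ (ric Γ) y w u v - fderiv ℝ (schJ G Γ) y w * G y u v := by
  have h3 : (3 : ℝ) ≤ Module.finrank ℝ E := by exact_mod_cast hN
  have h2 : ((Module.finrank ℝ E : ℝ) - 2) ≠ 0 := by linarith
  have dR := (contDiffOn_ric h.isOpen h.contDiffOn_conn).differentiableAt_of_isOpen h.isOpen hy
  have dJ := h.contDiffOn_schJ.differentiableAt_of_isOpen h.isOpen hy
  have dG := h.contDiffOn_metric.differentiableAt_of_isOpen h.isOpen hy
  have e : fderiv ℝ (schP G Γ) y w u v = ((Module.finrank ℝ E : ℝ) - 2)⁻¹ *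
      (fderiv ℝ (ric Γ) y w u v
        - (fderiv ℝ (schJ G Γ) y w * G y u v + schJ G Γ y * fderiv ℝ G y w u v)) := by
    rw [← fderiv_smul_bilin dJ dG]
    have := fderiv_fun_const_smul (R := ℝ) (dR.fun_sub (dJ.fun_smul dG))
      (((Module.finrank ℝ E : ℝ) - 2)⁻¹)
    rw [show schP G Γ = fun z => ((Module.finrank ℝ E : ℝ) - 2)⁻¹ •
      (ric Γ z - schJ G Γ z • G z) from rfl, this, fderiv_fun_sub dR (dJ.fun_smul dG)]
    simp
  simp only [covBilin_apply, e, h.compat y hy]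
  simp [schP]
  field_simp
  ring

theorem div_schP (hN : 3 ≤ Module.finrank ℝ E) (h : LeviCivitaOn U G Γ) {y : E}
    (hy : y ∈ U) (w : E) : divBilin G Γ (schP G Γ) y w = fderiv ℝ (schJ G Γ) y w := by
  have h3 : (3 : ℝ) ≤ Module.finrank ℝ E := by exact_mod_cast hN
  have h2 : ((Module.finrank ℝ E : ℝ) - 2) ≠ 0 := by linarith
  have hG := h.isInner y hy
  have h1 := h.contracted_bianchi hy w
  rw [show (fun z => trG (G z) (ric Γ z))
    = fun z => (2 * ((Module.finrank ℝ E : ℝ) - 1)) • schJ G Γ z from funext (scal_eq hN),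
    fderiv_fun_const_smul (h.contDiffOn_schJ.differentiableAt_of_isOpen h.isOpen hy)] at h1
  have h4 : ((Module.finrank ℝ E : ℝ) - 2) * divBilin G Γ (schP G Γ) y w
      = divBilin G Γ (ric Γ) y w - fderiv ℝ (schJ G Γ) y w := by
    rw [divBilin, Finset.mul_sum, divBilin]
    simp only [covBilin_schP hN h hy, Finset.sum_sub_distrib]
    congr 1
    conv_rhs => rw [← hG.sum_apply_dualVec (Module.finBasis ℝ E) w]
    simp [mul_comm]
  simp only [smul_apply, smul_eq_mul] at h1
  refine mul_left_cancel₀ h2 ?_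
  rw [h4]
  linarith

theorem _root_.ConformalTractor.contDiffOn_hessForm {f : E → ℝ} (hU : IsOpen U)
    (hΓ : ContDiffOn ℝ ∞ Γ U) (hf : ContDiffOn ℝ ∞ f U) : ContDiffOn ℝ ∞ (hessForm Γ f) U :=
  ((hf.fderiv' hU).fderiv' hU).sub
    (((ContinuousLinearMap.compL ℝ E E ℝ).contDiff.comp_contDiffOn (hf.fderiv' hU)).clm_comp hΓ)

/-- The Ricci identity for the third covariant derivative of a function. -/
theorem ricci_identity (h : LeviCivitaOn U G Γ) {f : E → ℝ} (hf : ContDiffOn ℝ ∞ f U) {y : E}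
    (hy : y ∈ U) (w u v : E) : covBilin Γ (hessForm Γ f) y w u v
      - covBilin Γ (hessForm Γ f) y u w v = -fderiv ℝ f y (curv Γ y w u v) := by
  have hf1 := hf.fderiv' h.isOpen
  have hf2 := hf1.fderiv' h.isOpen
  have d1 := hf1.differentiableAt_of_isOpen h.isOpen hy
  have d2 := hf2.differentiableAt_of_isOpen h.isOpen hy
  have dΓ := h.contDiffOn_conn.differentiableAt_of_isOpen h.isOpen hy
  have dH := (contDiffOn_hessForm h.isOpen h.contDiffOn_conn hf).differentiableAt_of_isOpen
    h.isOpen hy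
  have e : ∀ w u v, fderiv ℝ (hessForm Γ f) y w u v
      = fderiv ℝ (fderiv ℝ (fderiv ℝ f)) y w u v
        - (fderiv ℝ (fderiv ℝ f) y w (Γ y u v) + fderiv ℝ f y (fderiv ℝ Γ y w u v)) := by
    intro w u v
    have dΓ2 : DifferentiableAt ℝ (fun z => Γ z u v) y :=
      (dΓ.clm_apply (differentiableAt_const u)).clm_apply (differentiableAt_const v)
    have d22 : DifferentiableAt ℝ (fun z => fderiv ℝ (fderiv ℝ f) z u v) y :=
      (d2.clm_apply (differentiableAt_const u)).clm_apply (differentiableAt_const v)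
    rw [← fderiv_apply₂ dH]
    simp only [hessForm_apply]
    rw [fderiv_fun_sub d22 (d1.clm_apply dΓ2), sub_apply, fderiv_apply₂ d2,
      fderiv_apply_fun d1 dΓ2, fderiv_apply₂ dΓ]
  have s3 : ∀ v, fderiv ℝ (fderiv ℝ (fderiv ℝ f)) y w u v
      = fderiv ℝ (fderiv ℝ (fderiv ℝ f)) y u w v := fun v => by
    rw [hf1.second_symm h.isOpen hy]
  simp only [covBilin_apply, e, s3, hessForm_apply, h.torsion y hy w u, curv_apply, map_add,
    map_sub]
  ring

/-- The derivative of the trace part of a solution of the almost Einstein equation. -/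
theorem prolongation (hN : 3 ≤ Module.finrank ℝ E) (h : LeviCivitaOn U G Γ) {f l : E → ℝ}
    (hf : ContDiffOn ℝ ∞ f U) (hl : ContDiffOn ℝ ∞ l U)
    (heq : ∀ y ∈ U, hessForm Γ f y + f y • schP G Γ y = l y • G y) {y : E} (hy : y ∈ U)
    (w : E) : fderiv ℝ l y w = -schP G Γ y w ((G y).inverse (fderiv ℝ f y)) := by
  have h3 : (3 : ℝ) ≤ Module.finrank ℝ E := by exact_mod_cast hN
  have hG := h.isInner y hy
  set N : ℝ := (Module.finrank ℝ E : ℝ) with hNdef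
  set b := Module.finBasis ℝ E with hb
  set d := dualVec (G y) b with hd
  set Θ := (G y).inverse (fderiv ℝ f y) with hΘ
  have hΘa : ∀ v, G y Θ v = fderiv ℝ f y v := fun v => by rw [hΘ, hG.apply_inverse]
  have df := hf.differentiableAt_of_isOpen h.isOpen hy
  have dl := hl.differentiableAt_of_isOpen h.isOpen hy
  have dP := h.contDiffOn_schP.differentiableAt_of_isOpen h.isOpen hy
  have dG := h.contDiffOn_metric.differentiableAt_of_isOpen h.isOpen hy
  have hcov : ∀ w u v, covBilin Γ (hessForm Γ f) y w u v = fderiv ℝ l y w * G y u v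
      - fderiv ℝ f y w * schP G Γ y u v - f y * covBilin Γ (schP G Γ) y w u v := by
    intro w u v
    have hev : hessForm Γ f =ᶠ[𝓝 y] fun z => l z • G z - f z • schP G Γ z :=
      Filter.eventually_of_mem (h.isOpen.mem_nhds hy) fun z hz => by
        beta_reduce
        rw [← heq z hz, add_sub_cancel_right]
    rw [covBilin_apply, hev.fderiv_eq, fderiv_fun_sub (dl.fun_smul dG) (df.fun_smul dP),
      sub_apply, sub_apply, sub_apply, fderiv_smul_bilin dl dG, fderiv_smul_bilin df dP,
      hev.eq_of_nhds, h.compat y hy]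
    simp [covBilin_apply]
    ring
  have hR : ∀ i, -fderiv ℝ f y (curv Γ y w (b i) (d i)) = -G y (curv Γ y (b i) w Θ) (d i) := by
    intro i
    rw [← hΘa, curv_antisymm Γ y (b i) w, map_neg, neg_apply, h.curv_skew hy]
    ring
  have hsum : ∑ i, (fderiv ℝ l y w * G y (b i) (d i) - fderiv ℝ f y w * schP G Γ y (b i) (d i)
      - f y * covBilin Γ (schP G Γ) y w (b i) (d i)
      - (fderiv ℝ l y (b i) * G y w (d i) - fderiv ℝ f y (b i) * schP G Γ y w (d i)
        - f y * covBilin Γ (schP G Γ) y (b i) w (d i)))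
      = ∑ i, -G y (curv Γ y (b i) w Θ) (d i) := by
    refine Finset.sum_congr rfl fun i _ => ?_
    rw [← hcov, ← hcov, h.ricci_identity hf hy, hR]
  simp only [Finset.sum_sub_distrib, Finset.sum_neg_distrib, ← Finset.mul_sum] at hsum
  have t1 : ∑ i, G y (b i) (d i) = N := by rw [← hG.trG_eq b, hG.trG_self]
  have t2 : ∑ i, schP G Γ y (b i) (d i) = schJ G Γ y := by
    rw [← hG.trG_eq b, trG_schP hN h hy]
  have t3 : ∑ i, covBilin Γ (schP G Γ) y w (b i) (d i) = fderiv ℝ (schJ G Γ) y w := by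
    rw [← hG.trG_eq b, ← h.fderiv_trG h.contDiffOn_schP hy]
    have hev : (fun z => trG (G z) (schP G Γ z)) =ᶠ[𝓝 y] schJ G Γ :=
      Filter.eventually_of_mem (h.isOpen.mem_nhds hy) fun z hz => trG_schP hN h hz
    rw [hev.fderiv_eq]
  have t4 : ∑ i, fderiv ℝ l y (b i) * G y w (d i) = fderiv ℝ l y w := by
    conv_rhs => rw [← hG.sum_apply_dualVec b w]
    simp [mul_comm, hd]
  have t5 : ∑ i, fderiv ℝ f y (b i) * schP G Γ y w (d i) = schP G Γ y w Θ := by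
    conv_rhs => rw [← hG.sum_dualVec b Θ]
    simp [hΘa, hd]
  have t6 : ∑ i, covBilin Γ (schP G Γ) y (b i) w (d i) = fderiv ℝ (schJ G Γ) y w :=
    div_schP hN h hy w
  have t7 : ∑ i, G y (curv Γ y (b i) w Θ) (d i) = ric Γ y w Θ := by
    rw [ric, ricciContr_apply, hG.tr_eq b]
    rfl
  rw [t1, t2, t3, t4, t5, t6, t7, ric_eq (G := G) hN, hG.symm w, hΘa] at hsum
  have : (N - 1) * (fderiv ℝ l y w + schP G Γ y w Θ) = 0 := by
    rw [← hNdef] at hsum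
    linarith
  rcases mul_eq_zero.1 this with h0 | h0 <;> linarith

end LeviCivitaOn

end Schouten

section ConformalChange

variable {E : Type*} [NormedAddCommGroup E] [NormedSpace ℝ E] [FiniteDimensional ℝ E]

/-- `h'` is the metric `exp (2 τ)` times the metric `h`. -/
structure ConformalOn (U : Set E) (G G' : E → E →L[ℝ] E →L[ℝ] ℝ)
    (Γ Γ' : E → E →L[ℝ] E →L[ℝ] E) (τ : E → ℝ) : Prop where
  left : LeviCivitaOn U G Γ
  right : LeviCivitaOn U G' Γ'
  contDiffOn : ContDiffOn ℝ ∞ τ U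
  eq : ∀ y ∈ U, G' y = Real.exp (2 * τ y) • G y

namespace LeviCivitaOn

variable {U : Set E} {G : E → E →L[ℝ] E →L[ℝ] ℝ} {Γ : E → E →L[ℝ] E →L[ℝ] E}

/-- The Koszul formula. -/
theorem koszul (h : LeviCivitaOn U G Γ) {y : E} (hy : y ∈ U) (u v w : E) :
    2 * G y (Γ y u v) w
      = fderiv ℝ G y u v w + fderiv ℝ G y v u w - fderiv ℝ G y w u v := by
  have hs := (h.isInner y hy).symm
  rw [h.compat y hy, h.compat y hy, h.compat y hy, h.torsion y hy v u, h.torsion y hy w u,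
    h.torsion y hy w v, hs u (Γ y v w), hs v (Γ y u w)]
  ring

end LeviCivitaOn

namespace ConformalOn

variable {U : Set E} {G G' : E → E →L[ℝ] E →L[ℝ] ℝ} {Γ Γ' : E → E →L[ℝ] E →L[ℝ] E} {τ : E → ℝ}

/-- The gradient of the conformal factor. -/
def _root_.ConformalTractor.gradVec (G : E → E →L[ℝ] E →L[ℝ] ℝ) (τ : E → ℝ) (y : E) : E :=
  (G y).inverse (fderiv ℝ τ y)

theorem _root_.ConformalTractor.LeviCivitaOn.apply_gradVec (h : LeviCivitaOn U G Γ) {y : E}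
    (hy : y ∈ U) (v : E) : G y (gradVec G τ y) v = fderiv ℝ τ y v := by
  rw [gradVec, (h.isInner y hy).apply_inverse]

theorem conn_eq (h : ConformalOn U G G' Γ Γ' τ) {y : E} (hy : y ∈ U) (u v : E) :
    Γ' y u v = Γ y u v + fderiv ℝ τ y u • v + fderiv ℝ τ y v • u
      - G y u v • gradVec G τ y := by
  have hG' := h.right.isInner y hy
  have dτ := h.contDiffOn.differentiableAt_of_isOpen h.left.isOpen hy
  have dG := h.left.contDiffOn_metric.differentiableAt_of_isOpen h.left.isOpen hy
  have hd : ∀ a b c, fderiv ℝ G' y a b c = Real.exp (2 * τ y)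
      * (2 * fderiv ℝ τ y a * G y b c + fderiv ℝ G y a b c) := by
    intro a b c
    have hev : G' =ᶠ[𝓝 y] fun z => Real.exp (2 * τ z) • G z :=
      Filter.eventually_of_mem (h.left.isOpen.mem_nhds hy) h.eq
    have de : HasFDerivAt (fun z => Real.exp (2 * τ z))
        (Real.exp (2 * τ y) • ((2 : ℝ) • fderiv ℝ τ y)) y := (dτ.hasFDerivAt.const_mul 2).exp
    rw [hev.fderiv_eq, fderiv_smul_bilin de.differentiableAt dG, de.fderiv]
    simp
    ring
  refine hG'.ext fun w => ?_
  have h1 := h.right.koszul hy u v w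
  have h2 := h.left.koszul hy u v w
  have hs := (h.left.isInner y hy).symm
  simp only [hd] at h1
  rw [h.eq y hy] at h1 ⊢
  simp only [smul_apply, smul_eq_mul, map_add, map_sub, map_smul, add_apply, sub_apply,
    h.left.apply_gradVec hy] at h1 ⊢
  linear_combination (1 / 2 : ℝ) * h1 - (Real.exp (2 * τ y) / 2) * h2

theorem contDiffOn_gradVec (h : LeviCivitaOn U G Γ) (hτ : ContDiffOn ℝ ∞ τ U) :
    ContDiffOn ℝ ∞ (gradVec G τ) U := by
  refine ContDiffOn.clm_apply (fun z hz => ?_) (hτ.fderiv' h.isOpen)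
  exact ((h.isInner z hz).isInvertible.contDiffAt_map_inverse).comp_contDiffWithinAt z
    (h.contDiffOn_metric z hz)

theorem fderiv_gradVec (h : LeviCivitaOn U G Γ) (hτ : ContDiffOn ℝ ∞ τ U) {y : E}
    (hy : y ∈ U) (u : E) : fderiv ℝ (gradVec G τ) y u
      = raise (G y) (hessForm Γ τ y) u - Γ y u (gradVec G τ y) := by
  have hG := h.isInner y hy
  have hτ' := hτ.fderiv' h.isOpen
  have dG := h.contDiffOn_metric.differentiableAt_of_isOpen h.isOpen hy
  have dY := (contDiffOn_gradVec h hτ).differentiableAt_of_isOpen h.isOpen hy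
  refine hG.ext fun v => ?_
  have hev : (fun z => G z (gradVec G τ z) v) =ᶠ[𝓝 y] fun z => fderiv ℝ τ z v :=
    Filter.eventually_of_mem (h.isOpen.mem_nhds hy) fun z hz => h.apply_gradVec hz v
  have h1 := congrArg (fun L : E →L[ℝ] ℝ => L u) hev.fderiv_eq
  simp only [fderiv_apply₁ (hτ'.differentiableAt_of_isOpen h.isOpen hy),
    fderiv_apply₂_fun dG dY (differentiableAt_const v), h.compat y hy, fderiv_fun_const,
    Pi.zero_apply, zero_apply, map_zero, h.apply_gradVec hy] at h1
  rw [map_sub, sub_apply, hG.apply_raise, hessForm_apply, ← h1]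
  ring

theorem fderiv_conn (h : ConformalOn U G G' Γ Γ' τ) {y : E} (hy : y ∈ U) (u v w : E) :
    fderiv ℝ Γ' y u v w = fderiv ℝ Γ y u v w + fderiv ℝ (fderiv ℝ τ) y u v • w
      + fderiv ℝ (fderiv ℝ τ) y u w • v - fderiv ℝ G y u v w • gradVec G τ y
      - G y v w • fderiv ℝ (gradVec G τ) y u := by
  have hU := h.left.isOpen
  have dY := ((contDiffOn_gradVec h.left h.contDiffOn).differentiableAt_of_isOpen hU
    hy).hasFDerivAt
  have dΓ := h.left.contDiffOn_conn.differentiableAt_of_isOpen hU hy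
  have dG := h.left.contDiffOn_metric.differentiableAt_of_isOpen hU hy
  have dθ := (h.contDiffOn.fderiv' hU).differentiableAt_of_isOpen hU hy
  have e1 : HasFDerivAt (fun z => Γ z v w) (fderiv ℝ (fun z => Γ z v w) y) y :=
    ((dΓ.clm_apply (differentiableAt_const v)).clm_apply (differentiableAt_const w)).hasFDerivAt
  have e2 : ∀ a, HasFDerivAt (fun z => fderiv ℝ τ z a) (fderiv ℝ (fun z => fderiv ℝ τ z a) y) y :=
    fun a => (dθ.clm_apply (differentiableAt_const a)).hasFDerivAt
  have e3 : HasFDerivAt (fun z => G z v w) (fderiv ℝ (fun z => G z v w) y) y :=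
    ((dG.clm_apply (differentiableAt_const v)).clm_apply (differentiableAt_const w)).hasFDerivAt
  have hev : (fun z => Γ' z v w) =ᶠ[𝓝 y] fun z => Γ z v w + fderiv ℝ τ z v • w
      + fderiv ℝ τ z w • v - G z v w • gradVec G τ z :=
    Filter.eventually_of_mem (hU.mem_nhds hy) fun z hz => h.conn_eq hz v w
  rw [← fderiv_apply₂ (h.right.contDiffOn_conn.differentiableAt_of_isOpen hU hy),
    hev.fderiv_eq, (((e1.fun_add ((e2 v).smul_const w)).fun_add ((e2 w).smul_const v)).fun_sub
      (e3.fun_smul dY)).fderiv]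
  simp only [add_apply, sub_apply, smul_apply, ContinuousLinearMap.smulRight_apply,
    fderiv_apply₂ dΓ, fderiv_apply₂ dG, fderiv_apply₁ dθ]
  module

theorem curv_eq (h : ConformalOn U G G' Γ Γ' τ) {y : E} (hy : y ∈ U) (u v w : E) :
    curv Γ' y u v w = curv Γ y u v w + hessForm Γ τ y u w • v - hessForm Γ τ y v w • u
      - G y v w • raise (G y) (hessForm Γ τ y) u + G y u w • raise (G y) (hessForm Γ τ y) v
      + (fderiv ℝ τ y v * fderiv ℝ τ y w) • u - (fderiv ℝ τ y u * fderiv ℝ τ y w) • v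
      - (fderiv ℝ τ y v * G y u w) • gradVec G τ y
      + (fderiv ℝ τ y u * G y v w) • gradVec G τ y
      - fderiv ℝ τ y (gradVec G τ y) • (G y v w • u - G y u w • v) := by
  have hs := (h.left.isInner y hy).symm
  have ht := h.left.torsion y hy
  have h2 := h.contDiffOn.second_symm h.left.isOpen hy u v
  rw [curv_apply, curv_apply, h.fderiv_conn hy, h.fderiv_conn hy,
    fderiv_gradVec h.left h.contDiffOn hy, fderiv_gradVec h.left h.contDiffOn hy,
    h.left.compat y hy, h.left.compat y hy, h2]
  simp only [h.conn_eq hy, map_add, map_sub, map_smul, smul_add, smul_sub,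
    smul_eq_mul, hessForm_apply, ht v u, hs u v]
  have e1 : G y u (gradVec G τ y) = fderiv ℝ τ y u := by rw [hs, h.left.apply_gradVec hy]
  have e2 : G y v (gradVec G τ y) = fderiv ℝ τ y v := by rw [hs, h.left.apply_gradVec hy]
  simp only [e1, e2]
  module

theorem ric_eq (h : ConformalOn U G G' Γ Γ' τ) {y : E} (hy : y ∈ U) (v w : E) :
    ric Γ' y v w = ric Γ y v w - ((Module.finrank ℝ E : ℝ) - 2)
        * (hessForm Γ τ y v w - fderiv ℝ τ y v * fderiv ℝ τ y w)
      - (trG (G y) (hessForm Γ τ y)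
        + ((Module.finrank ℝ E : ℝ) - 2) * fderiv ℝ τ y (gradVec G τ y)) * G y v w := by
  have hG := h.left.isInner y hy
  set H := hessForm Γ τ y with hH
  set θ := fderiv ℝ τ y with hθ
  set Y := gradVec G τ y with hY
  have e : ((curv Γ' y).flip v).flip w = ((curv Γ y).flip v).flip w + (H.flip w).smulRight v
      - H v w • ContinuousLinearMap.id ℝ E - G y v w • raise (G y) H
      + ((G y).flip w).smulRight (raise (G y) H v)
      + (θ v * θ w) • ContinuousLinearMap.id ℝ E - θ w • θ.smulRight v
      - θ v • ((G y).flip w).smulRight Y + G y v w • θ.smulRight Y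
      - θ Y • (G y v w • ContinuousLinearMap.id ℝ E - ((G y).flip w).smulRight v) := by
    ext u
    simp only [ContinuousLinearMap.flip_apply, h.curv_eq hy, add_apply, sub_apply, smul_apply,
      ContinuousLinearMap.smulRight_apply, ContinuousLinearMap.id_apply, ← hH, ← hθ, ← hY]
    module
  rw [ric, ricciContr_apply, e]
  simp only [map_add, map_sub, map_smul, tr_id, tr_smulRight, ContinuousLinearMap.flip_apply,
    hG.apply_raise, smul_eq_mul]
  rw [ric, ricciContr_apply, trG, hY, h.left.apply_gradVec hy]
  ring

theorem trG_eq (h : ConformalOn U G G' Γ Γ' τ) {y : E} (hy : y ∈ U)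
    (T : E →L[ℝ] E →L[ℝ] ℝ) : trG (G' y) T = Real.exp (-(2 * τ y)) * trG (G y) T := by
  rw [← trG_smul, trG, trG, (h.right.isInner y hy).raise_eq]
  intro u v
  rw [h.eq y hy, smul_apply, smul_apply, (h.left.isInner y hy).apply_raise, smul_apply,
    smul_apply, smul_smul, ← Real.exp_add]
  simp

/-- The conformal transformation of the trace of the Schouten tensor. -/
theorem schJ_eq (h : ConformalOn U G G' Γ Γ' τ) (hN : 3 ≤ Module.finrank ℝ E) {y : E}
    (hy : y ∈ U) : schJ G' Γ' y = Real.exp (-(2 * τ y)) * (schJ G Γ y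
      - trG (G y) (hessForm Γ τ y)
      - ((Module.finrank ℝ E : ℝ) - 2) / 2 * fderiv ℝ τ y (gradVec G τ y)) := by
  have h3 : (3 : ℝ) ≤ Module.finrank ℝ E := by exact_mod_cast hN
  have h1 : ((Module.finrank ℝ E : ℝ) - 1) ≠ 0 := by linarith
  have e : ric Γ' y = ric Γ y + (-((Module.finrank ℝ E : ℝ) - 2)) • hessForm Γ τ y
      + ((Module.finrank ℝ E : ℝ) - 2) • (fderiv ℝ τ y).smulRight (fderiv ℝ τ y)
      + (-(trG (G y) (hessForm Γ τ y)
        + ((Module.finrank ℝ E : ℝ) - 2) * fderiv ℝ τ y (gradVec G τ y))) • G y := by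
    ext v w
    rw [h.ric_eq hy]
    simp
    ring
  rw [schJ, schJ, h.trG_eq hy, e, trG_add, trG_add, trG_add, trG_smul, trG_smul, trG_smul,
    (h.left.isInner y hy).trG_smulRight, (h.left.isInner y hy).trG_self, ← gradVec]
  field_simp
  ring

/-- The conformal transformation of the Schouten tensor. -/
theorem schP_eq (h : ConformalOn U G G' Γ Γ' τ) (hN : 3 ≤ Module.finrank ℝ E) {y : E}
    (hy : y ∈ U) (u v : E) : schP G' Γ' y u v = schP G Γ y u v - hessForm Γ τ y u v
      + fderiv ℝ τ y u * fderiv ℝ τ y v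
      - 1 / 2 * fderiv ℝ τ y (gradVec G τ y) * G y u v := by
  have h3 : (3 : ℝ) ≤ Module.finrank ℝ E := by exact_mod_cast hN
  have h2 : ((Module.finrank ℝ E : ℝ) - 2) ≠ 0 := by linarith
  have he : Real.exp (-(2 * τ y)) * Real.exp (2 * τ y) = 1 := by
    rw [← Real.exp_add]; simp
  have e : schJ G' Γ' y * G' y u v = (schJ G Γ y - trG (G y) (hessForm Γ τ y)
      - ((Module.finrank ℝ E : ℝ) - 2) / 2 * fderiv ℝ τ y (gradVec G τ y)) * G y u v := by
    rw [h.schJ_eq hN hy, h.eq y hy, smul_apply, smul_apply, smul_eq_mul]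
    linear_combination ((schJ G Γ y - trG (G y) (hessForm Γ τ y)
      - ((Module.finrank ℝ E : ℝ) - 2) / 2 * fderiv ℝ τ y (gradVec G τ y)) * G y u v) * he
  simp only [schP, smul_apply, sub_apply, smul_eq_mul, e, h.ric_eq hy]
  field_simp
  ring

theorem fderiv_exp_mul (h : ConformalOn U G G' Γ Γ' τ) {f : E → ℝ} (hf : ContDiffOn ℝ ∞ f U)
    {y : E} (hy : y ∈ U) : fderiv ℝ (fun z => Real.exp (τ z) * f z) y
      = (Real.exp (τ y) * f y) • fderiv ℝ τ y + Real.exp (τ y) • fderiv ℝ f y := by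
  have dτ := h.contDiffOn.differentiableAt_of_isOpen h.left.isOpen hy
  have df := hf.differentiableAt_of_isOpen h.left.isOpen hy
  have de : HasFDerivAt (fun z => Real.exp (τ z)) (Real.exp (τ y) • fderiv ℝ τ y) y :=
    dτ.hasFDerivAt.exp
  rw [(de.fun_mul df.hasFDerivAt).fderiv, smul_smul, add_comm, mul_comm]

theorem hess_exp_mul (h : ConformalOn U G G' Γ Γ' τ) {f : E → ℝ} (hf : ContDiffOn ℝ ∞ f U)
    {y : E} (hy : y ∈ U) (u v : E) :
    hessForm Γ' (fun z => Real.exp (τ z) * f z) y u v = Real.exp (τ y) *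
      (hessForm Γ f y u v + f y * hessForm Γ τ y u v - f y * fderiv ℝ τ y u * fderiv ℝ τ y v
        + (f y * fderiv ℝ τ y (gradVec G τ y) + fderiv ℝ f y (gradVec G τ y)) * G y u v) := by
  have hU := h.left.isOpen
  have dτ := h.contDiffOn.differentiableAt_of_isOpen hU hy
  have df := hf.differentiableAt_of_isOpen hU hy
  have dτ' := (h.contDiffOn.fderiv' hU).differentiableAt_of_isOpen hU hy
  have df' := (hf.fderiv' hU).differentiableAt_of_isOpen hU hy
  have de : HasFDerivAt (fun z => Real.exp (τ z)) (Real.exp (τ y) • fderiv ℝ τ y) y :=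
    dτ.hasFDerivAt.exp
  have hev : fderiv ℝ (fun z => Real.exp (τ z) * f z) =ᶠ[𝓝 y]
      fun z => (Real.exp (τ z) * f z) • fderiv ℝ τ z + Real.exp (τ z) • fderiv ℝ f z :=
    Filter.eventually_of_mem (hU.mem_nhds hy) fun z hz => h.fderiv_exp_mul hf hz
  have h1 : HasFDerivAt (fun z => Real.exp (τ z) * f z) _ y := de.fun_mul df.hasFDerivAt
  rw [hessForm_apply, hev.fderiv_eq, ((h1.fun_smul dτ'.hasFDerivAt).fun_add
    (de.fun_smul df'.hasFDerivAt)).fderiv, h.fderiv_exp_mul hf hy, h.conn_eq hy]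
  simp [hessForm_apply]
  ring

/-- The conformal transformation of the operator in the almost Einstein equation. -/
theorem ae_operator_eq (h : ConformalOn U G G' Γ Γ' τ) (hN : 3 ≤ Module.finrank ℝ E)
    {f : E → ℝ} (hf : ContDiffOn ℝ ∞ f U) {y : E} (hy : y ∈ U) :
    hessForm Γ' (fun z => Real.exp (τ z) * f z) y + (Real.exp (τ y) * f y) • schP G' Γ' y
      = Real.exp (τ y) • (hessForm Γ f y + f y • schP G Γ y
        + (fderiv ℝ f y (gradVec G τ y) + 1 / 2 * f y * fderiv ℝ τ y (gradVec G τ y)) • G y) := by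
  ext u v
  simp only [add_apply, smul_apply, smul_eq_mul, h.hess_exp_mul hf hy, h.schP_eq hN hy]
  ring

end ConformalOn

end ConformalChange

section Pullback

variable {E : Type*} [NormedAddCommGroup E] [NormedSpace ℝ E] [FiniteDimensional ℝ E]

/-- The metric `G` is the pullback of `G'` by the local diffeomorphism `φ`. -/
structure PullbackOn (U U' : Set E) (G G' : E → E →L[ℝ] E →L[ℝ] ℝ)
    (Γ Γ' : E → E →L[ℝ] E →L[ℝ] E) (φ : E → E) : Prop where
  left : LeviCivitaOn U G Γ
  right : LeviCivitaOn U' G' Γ'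
  contDiffOn : ContDiffOn ℝ ∞ φ U
  mapsTo : Set.MapsTo φ U U'
  bijective : ∀ y ∈ U, Function.Bijective (fderiv ℝ φ y)
  eq : ∀ y ∈ U, ∀ u v, G y u v = G' (φ y) (fderiv ℝ φ y u) (fderiv ℝ φ y v)

namespace PullbackOn

variable {U U' : Set E} {G G' : E → E →L[ℝ] E →L[ℝ] ℝ} {Γ Γ' : E → E →L[ℝ] E →L[ℝ] E}
  {φ : E → E}

theorem fderiv_comp_apply (h : PullbackOn U U' G G' Γ Γ' φ) {F : Type*} [NormedAddCommGroup F]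
    [NormedSpace ℝ F] {T : E → F} (hT : ContDiffOn ℝ ∞ T U') {y : E} (hy : y ∈ U) (w : E) :
    fderiv ℝ (fun z => T (φ z)) y w = fderiv ℝ T (φ y) (fderiv ℝ φ y w) := by
  have h1 : HasFDerivAt (fun z => T (φ z)) (fderiv ℝ T (φ y) ∘L fderiv ℝ φ y) y :=
    (hT.differentiableAt_of_isOpen h.right.isOpen (h.mapsTo hy)).hasFDerivAt.comp y
      (h.contDiffOn.differentiableAt_of_isOpen h.left.isOpen hy).hasFDerivAt
  rw [h1.fderiv]
  rfl

theorem conn_eq (h : PullbackOn U U' G G' Γ Γ' φ) {y : E} (hy : y ∈ U) (u v : E) :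
    fderiv ℝ φ y (Γ y u v) = Γ' (φ y) (fderiv ℝ φ y u) (fderiv ℝ φ y v)
      + fderiv ℝ (fderiv ℝ φ) y u v := by
  have hU := h.left.isOpen
  have hG' := h.right.isInner _ (h.mapsTo hy)
  have dG := h.left.contDiffOn_metric.differentiableAt_of_isOpen hU hy
  have dφ' := (h.contDiffOn.fderiv' hU).differentiableAt_of_isOpen hU hy
  have dG' : DifferentiableAt ℝ (fun z => G' (φ z)) y :=
    (h.right.contDiffOn_metric.comp h.contDiffOn h.mapsTo).differentiableAt_of_isOpen hU hy
  have hs := h.contDiffOn.second_symm hU hy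
  have hd : ∀ a b c, fderiv ℝ G y a b c
      = fderiv ℝ G' (φ y) (fderiv ℝ φ y a) (fderiv ℝ φ y b) (fderiv ℝ φ y c)
        + G' (φ y) (fderiv ℝ (fderiv ℝ φ) y a b) (fderiv ℝ φ y c)
        + G' (φ y) (fderiv ℝ φ y b) (fderiv ℝ (fderiv ℝ φ) y a c) := by
    intro a b c
    have e : ∀ a, DifferentiableAt ℝ (fun z => fderiv ℝ φ z a) y :=
      fun a => dφ'.clm_apply (differentiableAt_const a)
    have hev : (fun z => G z b c) =ᶠ[𝓝 y]
        fun z => G' (φ z) (fderiv ℝ φ z b) (fderiv ℝ φ z c) :=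
      Filter.eventually_of_mem (hU.mem_nhds hy) fun z hz => h.eq z hz b c
    rw [← fderiv_apply₂ dG, hev.fderiv_eq, fderiv_apply₂_fun dG' (e b) (e c),
      fderiv_apply₁ dφ', fderiv_apply₁ dφ', h.fderiv_comp_apply h.right.contDiffOn_metric hy]
  refine hG'.ext fun w' => ?_
  obtain ⟨w, rfl⟩ := (h.bijective y hy).2 w'
  have h1 := h.left.koszul hy u v w
  have h2 := h.right.koszul (h.mapsTo hy) (fderiv ℝ φ y u) (fderiv ℝ φ y v) (fderiv ℝ φ y w)
  rw [h.eq y hy, hd, hd, hd, hs v u, hs w u, hs w v, hG'.symm (fderiv ℝ φ y u),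
    hG'.symm (fderiv ℝ φ y v) (fderiv ℝ (fderiv ℝ φ) y u w)] at h1
  rw [map_add, add_apply]
  linarith

theorem curv_eq (h : PullbackOn U U' G G' Γ Γ' φ) {y : E} (hy : y ∈ U) (u v w : E) :
    fderiv ℝ φ y (curv Γ y u v w)
      = curv Γ' (φ y) (fderiv ℝ φ y u) (fderiv ℝ φ y v) (fderiv ℝ φ y w) := by
  have hU := h.left.isOpen
  have hφ1 := h.contDiffOn.fderiv' hU
  have hφ2 := hφ1.fderiv' hU
  have d1 := hφ1.differentiableAt_of_isOpen hU hy
  have d2 := hφ2.differentiableAt_of_isOpen hU hy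
  have dΓ := h.left.contDiffOn_conn.differentiableAt_of_isOpen hU hy
  have dΓ' : DifferentiableAt ℝ (fun z => Γ' (φ z)) y :=
    (h.right.contDiffOn_conn.comp h.contDiffOn h.mapsTo).differentiableAt_of_isOpen hU hy
  have key : ∀ u v w, fderiv ℝ (fderiv ℝ φ) y u (Γ y v w) + fderiv ℝ φ y (fderiv ℝ Γ y u v w)
      = fderiv ℝ Γ' (φ y) (fderiv ℝ φ y u) (fderiv ℝ φ y v) (fderiv ℝ φ y w)
        + Γ' (φ y) (fderiv ℝ (fderiv ℝ φ) y u v) (fderiv ℝ φ y w)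
        + Γ' (φ y) (fderiv ℝ φ y v) (fderiv ℝ (fderiv ℝ φ) y u w)
        + fderiv ℝ (fderiv ℝ (fderiv ℝ φ)) y u v w := by
    intro u v w
    have e1 : ∀ a, DifferentiableAt ℝ (fun z => fderiv ℝ φ z a) y :=
      fun a => d1.clm_apply (differentiableAt_const a)
    have e2 : DifferentiableAt ℝ (fun z => fderiv ℝ (fderiv ℝ φ) z v w) y :=
      (d2.clm_apply (differentiableAt_const v)).clm_apply (differentiableAt_const w)
    have e3 : DifferentiableAt ℝ (fun z => Γ z v w) y :=
      (dΓ.clm_apply (differentiableAt_const v)).clm_apply (differentiableAt_const w)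
    have e4 : DifferentiableAt ℝ (fun z => Γ' (φ z) (fderiv ℝ φ z v) (fderiv ℝ φ z w)) y :=
      (dΓ'.clm_apply (e1 v)).clm_apply (e1 w)
    have hev : (fun z => fderiv ℝ φ z (Γ z v w)) =ᶠ[𝓝 y]
        fun z => Γ' (φ z) (fderiv ℝ φ z v) (fderiv ℝ φ z w) + fderiv ℝ (fderiv ℝ φ) z v w :=
      Filter.eventually_of_mem (hU.mem_nhds hy) fun z hz => h.conn_eq hz v w
    have h1 := congrArg (fun L : E →L[ℝ] E => L u) hev.fderiv_eq
    simp only [fderiv_apply_fun d1 e3, fderiv_apply₂ dΓ] at h1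
    rw [h1, fderiv_fun_add e4 e2, add_apply, fderiv_apply₂ d2,
      fderiv_apply₂_fun dΓ' (e1 v) (e1 w), fderiv_apply₁ d1, fderiv_apply₁ d1,
      h.fderiv_comp_apply h.right.contDiffOn_conn hy]
  have k1 := eq_sub_of_add_eq' (key u v w)
  have k2 := eq_sub_of_add_eq' (key v u w)
  rw [curv_apply, curv_apply, map_add, map_sub, map_sub, k1, k2]
  simp only [h.conn_eq hy, map_add, hφ1.second_symm hU hy v u, h.contDiffOn.second_symm hU hy v u]
  abel

theorem ric_eq (h : PullbackOn U U' G G' Γ Γ' φ) {y : E} (hy : y ∈ U) (v w : E) :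
    ric Γ y v w = ric Γ' (φ y) (fderiv ℝ φ y v) (fderiv ℝ φ y w) := by
  rw [ric, ric, ricciContr_apply, ricciContr_apply]
  refine tr_eq_of_intertwine (h.bijective y hy) ?_
  ext u
  simp [h.curv_eq hy]

theorem schJ_eq (h : PullbackOn U U' G G' Γ Γ' φ) {y : E} (hy : y ∈ U) :
    schJ G Γ y = schJ G' Γ' (φ y) := by
  rw [schJ, schJ, trG_pullback (h.left.isInner y hy) (h.right.isInner _ (h.mapsTo hy))
    (h.bijective y hy) (h.eq y hy) (h.ric_eq hy)]

theorem hess_eq (h : PullbackOn U U' G G' Γ Γ' φ) {f f' : E → ℝ} (hf : ContDiffOn ℝ ∞ f' U')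
    (hff : ∀ z ∈ U, f z = f' (φ z)) {y : E} (hy : y ∈ U) (u v : E) :
    hessForm Γ f y u v = hessForm Γ' f' (φ y) (fderiv ℝ φ y u) (fderiv ℝ φ y v) := by
  have hU := h.left.isOpen
  have hd : ∀ z ∈ U, fderiv ℝ f z = fderiv ℝ f' (φ z) ∘L fderiv ℝ φ z := by
    intro z hz
    have hev : f =ᶠ[𝓝 z] fun x => f' (φ x) := Filter.eventually_of_mem (hU.mem_nhds hz) hff
    rw [hev.fderiv_eq]
    ext a
    exact h.fderiv_comp_apply hf hz a
  have hev : fderiv ℝ f =ᶠ[𝓝 y] fun z => fderiv ℝ f' (φ z) ∘L fderiv ℝ φ z :=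
    Filter.eventually_of_mem (hU.mem_nhds hy) hd
  have d1 := (h.contDiffOn.fderiv' hU).differentiableAt_of_isOpen hU hy
  have hf1 := hf.fderiv' h.right.isOpen
  have d2 : DifferentiableAt ℝ (fun z => fderiv ℝ f' (φ z)) y :=
    (hf1.comp h.contDiffOn h.mapsTo).differentiableAt_of_isOpen hU hy
  have e : fderiv ℝ (fderiv ℝ f) y u v
      = fderiv ℝ (fderiv ℝ f') (φ y) (fderiv ℝ φ y u) (fderiv ℝ φ y v)
        + fderiv ℝ f' (φ y) (fderiv ℝ (fderiv ℝ φ) y u v) := by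
    rw [hev.fderiv_eq, (d2.hasFDerivAt.clm_comp d1.hasFDerivAt).fderiv]
    simp [h.fderiv_comp_apply hf1 hy, add_comm]
  rw [hessForm_apply, hessForm_apply, e, hd y hy, ContinuousLinearMap.comp_apply, h.conn_eq hy,
    map_add]
  ring

theorem trG_hess_eq (h : PullbackOn U U' G G' Γ Γ' φ) {f f' : E → ℝ}
    (hf : ContDiffOn ℝ ∞ f' U') (hff : ∀ z ∈ U, f z = f' (φ z)) {y : E} (hy : y ∈ U) :
    trG (G y) (hessForm Γ f y) = trG (G' (φ y)) (hessForm Γ' f' (φ y)) :=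
  trG_pullback (h.left.isInner y hy) (h.right.isInner _ (h.mapsTo hy))
    (h.bijective y hy) (h.eq y hy) (h.hess_eq hf hff hy)

end PullbackOn

end Pullback

section Charts

variable {n : ℕ} {M : Type*} [TopologicalSpace M] [ChartedSpace (Model n) M]
  [IsManifold (𝓡 n) ∞ M] {e e' : OpenPartialHomeomorph M (Model n)}

/-- The derivative of the inverse of a chart. -/
def chartDeriv (e : OpenPartialHomeomorph M (Model n)) (y : Model n) :
    Model n →L[ℝ] TangentSpace (𝓡 n) (e.symm y) :=
  mfderiv (𝓡 n) (𝓡 n) e.symm y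

theorem mdifferentiable_of_mem_maximalAtlas (he : e ∈ IsManifold.maximalAtlas (𝓡 n) ∞ M) :
    e.MDifferentiable (𝓡 n) (𝓡 n) :=
  ⟨(contMDiffOn_of_mem_maximalAtlas he).mdifferentiableOn (by simp),
    (contMDiffOn_symm_of_mem_maximalAtlas he).mdifferentiableOn (by simp)⟩

theorem chartDeriv_bijective (he : e ∈ IsManifold.maximalAtlas (𝓡 n) ∞ M) {y : Model n}
    (hy : y ∈ e.target) : Function.Bijective (chartDeriv e y) :=
  (mdifferentiable_of_mem_maximalAtlas he).symm.mfderiv_bijective hy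

theorem contMDiffOn_coordVec (he : e ∈ IsManifold.maximalAtlas (𝓡 n) ∞ M) (i : Fin n) :
    ContMDiffOn (𝓡 n) ((𝓡 n).prod 𝓘(ℝ, Model n)) ∞
      (fun y => (Bundle.TotalSpace.mk' (Model n) (e.symm y) (coordVec e i y) :
        TangentBundle (𝓡 n) M)) e.target := by
  have h1 := (contMDiffOn_symm_of_mem_maximalAtlas he).contMDiffOn_tangentMapWithin
    (m := ∞) (by norm_num) e.open_target.uniqueMDiffOn
  have h2 : ContMDiff (𝓡 n) ((𝓡 n).prod 𝓘(ℝ, Model n)) ∞ (fun y : Model n =>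
      (Bundle.TotalSpace.mk' (Model n) y (EuclideanSpace.single i (1 : ℝ) : Model n) :
        TangentBundle (𝓡 n) (Model n))) :=
    contMDiff_vectorSpace_iff_contDiff.2 contDiff_const
  have h3 := h1.comp h2.contMDiffOn (s := e.target) (fun y hy => hy)
  refine h3.congr fun y hy => ?_
  simp only [Function.comp_apply, tangentMapWithin, Bundle.TotalSpace.mk']
  rw [mfderivWithin_of_isOpen e.open_target hy]
  rfl

theorem contDiffOn_gCoord (g : PMetric n M) (he : e ∈ IsManifold.maximalAtlas (𝓡 n) ∞ M)
    (i j : Fin n) : ContDiffOn ℝ ∞ (fun y => gCoord g e y i j) e.target := by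
  have h1 := g.smooth.comp_contMDiffOn (contMDiffOn_symm_of_mem_maximalAtlas he)
  have h2 := ContMDiffOn.clm_bundle_apply₂ (F₁ := Model n) (F₂ := Model n) (F₃ := ℝ)
    (E₁ := fun x : M => TangentSpace (𝓡 n) x) (E₂ := fun x : M => TangentSpace (𝓡 n) x)
    (E₃ := Bundle.Trivial M ℝ) (b := e.symm) (ψ := fun y => g.form (e.symm y)) h1
    (contMDiffOn_coordVec he i) (contMDiffOn_coordVec he j)
  rw [← contMDiffOn_iff_contDiffOn]
  intro y hy
  have h3 := (Bundle.contMDiffWithinAt_totalSpace.1 (h2 y hy)).2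
  exact h3

theorem contDiffOn_comp_symm {f : M → ℝ} (hf : ContMDiff (𝓡 n) 𝓘(ℝ) ∞ f)
    (he : e ∈ IsManifold.maximalAtlas (𝓡 n) ∞ M) :
    ContDiffOn ℝ ∞ (fun y => f (e.symm y)) e.target :=
  contMDiffOn_iff_contDiffOn.1 (hf.comp_contMDiffOn (contMDiffOn_symm_of_mem_maximalAtlas he))

theorem mvfderiv_chartDeriv {f : M → ℝ} (he : e ∈ IsManifold.maximalAtlas (𝓡 n) ∞ M)
    {y : Model n} (hy : y ∈ e.target) (hf : MDifferentiableAt (𝓡 n) 𝓘(ℝ) f (e.symm y))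
    (v : Model n) : mvfderiv (𝓡 n) f (e.symm y) (chartDeriv e y v)
      = fderiv ℝ (fun z => f (e.symm z)) y v := by
  have h1 := mfderiv_comp y hf ((mdifferentiable_of_mem_maximalAtlas he).symm.mdifferentiableAt hy)
  have h2 : mfderiv (𝓡 n) 𝓘(ℝ) (f ∘ e.symm) y = fderiv ℝ (fun z => f (e.symm z)) y :=
    mfderiv_eq_fderiv
  rw [← h2, h1]
  rfl

theorem formCoord_mvfderiv {f : M → ℝ} (he : e ∈ IsManifold.maximalAtlas (𝓡 n) ∞ M)
    {y : Model n} (hy : y ∈ e.target) (hf : MDifferentiableAt (𝓡 n) 𝓘(ℝ) f (e.symm y))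
    (i : Fin n) : formCoord (mvfderiv (𝓡 n) f) e i y = pd i (fun z => f (e.symm z)) y :=
  mvfderiv_chartDeriv he hy hf _

end Charts

section Coefficients

variable {n : ℕ}

/-- The standard basis of the model space. -/
def stdBasis (n : ℕ) : Module.Basis (Fin n) ℝ (Model n) :=
  (EuclideanSpace.basisFun (Fin n) ℝ).toBasis

/-- The standard basis vectors of the model space. -/
def unitVec (i : Fin n) : Model n := EuclideanSpace.single i (1 : ℝ)

@[simp]
theorem stdBasis_apply (i : Fin n) : stdBasis n i = unitVec i := by
  simp [stdBasis, unitVec]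

@[simp]
theorem stdBasis_repr (v : Model n) (i : Fin n) : (stdBasis n).repr v i = v i := by
  simp [stdBasis]

theorem unitVec_apply (i j : Fin n) : (unitVec i : Model n) j = if j = i then 1 else 0 := by
  simp [unitVec]

theorem finrank_model : Module.finrank ℝ (Model n) = n := by simp

theorem clm_ext_unitVec {F : Type*} [NormedAddCommGroup F] [NormedSpace ℝ F]
    {L L' : Model n →L[ℝ] F} (h : ∀ i, L (unitVec i) = L' (unitVec i)) : L = L' := by
  refine ContinuousLinearMap.coe_injective ((stdBasis n).ext fun i => ?_)
  simpa using h i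

/-- The bilinear form with given coefficients. -/
def coeffForm (c : Fin n → Fin n → ℝ) : Model n →L[ℝ] Model n →L[ℝ] ℝ :=
  ∑ i, ∑ j, c i j • (EuclideanSpace.proj i : Model n →L[ℝ] ℝ).smulRight
    (EuclideanSpace.proj j : Model n →L[ℝ] ℝ)

@[simp]
theorem coeffForm_unitVec (c : Fin n → Fin n → ℝ) (i j : Fin n) :
    coeffForm c (unitVec i) (unitVec j) = c i j := by
  simp [coeffForm, unitVec_apply]

/-- The vector valued bilinear map with given coefficients. -/
def coeffConn (c : Fin n → Fin n → Fin n → ℝ) : Model n →L[ℝ] Model n →L[ℝ] Model n :=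
  ∑ k, (ContinuousLinearMap.compL ℝ (Model n) ℝ (Model n)
    ((ContinuousLinearMap.id ℝ ℝ).smulRight (unitVec k))).comp (coeffForm (c k))

@[simp]
theorem coeffConn_unitVec (c : Fin n → Fin n → Fin n → ℝ) (i j k : Fin n) :
    coeffConn c (unitVec i) (unitVec j) k = c k i j := by
  simp [coeffConn, unitVec_apply]

theorem contDiffOn_coeffForm {U : Set (Model n)} {c : Model n → Fin n → Fin n → ℝ}
    (h : ∀ i j, ContDiffOn ℝ ∞ (fun y => c y i j) U) :
    ContDiffOn ℝ ∞ (fun y => coeffForm (c y)) U :=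
  ContDiffOn.sum fun i _ => ContDiffOn.sum fun j _ => (h i j).smul contDiffOn_const

theorem contDiffOn_coeffConn {U : Set (Model n)} {c : Model n → Fin n → Fin n → Fin n → ℝ}
    (h : ∀ k i j, ContDiffOn ℝ ∞ (fun y => c y k i j) U) :
    ContDiffOn ℝ ∞ (fun y => coeffConn (c y)) U :=
  ContDiffOn.sum fun k _ => contDiffOn_const.clm_comp (contDiffOn_coeffForm (h k))

theorem sum_smul_unitVec (v : Model n) : ∑ i, v i • unitVec i = v := by
  conv_rhs => rw [← (stdBasis n).sum_repr v]
  simp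

end Coefficients

section Bridge

variable {n : ℕ} {M : Type*} [TopologicalSpace M] [ChartedSpace (Model n) M]
  [IsManifold (𝓡 n) ∞ M]

/-- The metric in the chart `e`. -/
def metricForm (g : PMetric n M) (e : OpenPartialHomeomorph M (Model n)) (y : Model n) :
    Model n →L[ℝ] Model n →L[ℝ] ℝ :=
  coeffForm fun i j => gCoord g e y i j

/-- The Levi-Civita connection in the chart `e`. -/
def connForm (g : PMetric n M) (e : OpenPartialHomeomorph M (Model n)) (y : Model n) :
    Model n →L[ℝ] Model n →L[ℝ] Model n :=
  coeffConn fun k i j => christoffel g e k i j y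

variable (g : PMetric n M) {e : OpenPartialHomeomorph M (Model n)}

theorem metricForm_unitVec (y : Model n) (i j : Fin n) :
    metricForm g e y (unitVec i) (unitVec j) = gCoord g e y i j :=
  coeffForm_unitVec _ _ _

theorem metricForm_apply (y u v : Model n) :
    metricForm g e y u v = g.form (e.symm y) (chartDeriv e y u) (chartDeriv e y v) := by
  rw [← sum_smul_unitVec u, ← sum_smul_unitVec v]
  simp only [map_sum, map_smul, sum_apply, smul_apply]
  refine Finset.sum_congr rfl fun i _ => ?_
  congr 1
  refine Finset.sum_congr rfl fun j _ => ?_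
  congr 1
  exact coeffForm_unitVec _ _ _

theorem isInner_metricForm (he : e ∈ IsManifold.maximalAtlas (𝓡 n) ∞ M) {y : Model n}
    (hy : y ∈ e.target) : IsInner (metricForm g e y) := by
  have hb := chartDeriv_bijective he hy
  refine ⟨fun u v => ?_, fun u hu => ?_⟩
  · rw [metricForm_apply, metricForm_apply, g.symm]
  · refine hb.1 ?_
    rw [map_zero]
    refine g.nondegenerate _ _ fun w => ?_
    obtain ⟨v, rfl⟩ := hb.2 w
    rw [← metricForm_apply, hu]

theorem contDiffOn_metricForm (he : e ∈ IsManifold.maximalAtlas (𝓡 n) ∞ M) :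
    ContDiffOn ℝ ∞ (metricForm g e) e.target :=
  contDiffOn_coeffForm fun i j => contDiffOn_gCoord g he i j

theorem pd_gCoord (he : e ∈ IsManifold.maximalAtlas (𝓡 n) ∞ M) {y : Model n}
    (hy : y ∈ e.target) (l i j : Fin n) : pd l (fun z => gCoord g e z i j) y
      = fderiv ℝ (metricForm g e) y (unitVec l) (unitVec i) (unitVec j) := by
  rw [← fderiv_apply₂ ((contDiffOn_metricForm g he).differentiableAt_of_isOpen e.open_target hy)]
  simp only [metricForm_unitVec]
  rfl

theorem isUnit_det_gCoord (he : e ∈ IsManifold.maximalAtlas (𝓡 n) ∞ M) {y : Model n}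
    (hy : y ∈ e.target) : IsUnit (gCoord g e y).det := by
  rw [isUnit_iff_ne_zero]
  intro h0
  obtain ⟨v, hv, hv0⟩ := Matrix.exists_vecMul_eq_zero_iff.2 h0
  refine hv ?_
  have h1 : (WithLp.toLp 2 v : Model n) = 0 := by
    refine (isInner_metricForm g he hy).nondeg _ fun w => ?_
    have h2 : metricForm g e y (WithLp.toLp 2 v) = 0 := by
      refine clm_ext_unitVec fun j => ?_
      rw [← sum_smul_unitVec (WithLp.toLp 2 v)]
      simp only [map_sum, map_smul, sum_apply, smul_apply, metricForm_unitVec,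
        zero_apply]
      exact congrFun hv0 j
    rw [h2, zero_apply]
  ext i
  exact congrArg (fun u : Model n => u i) h1

theorem contDiffOn_gInv (he : e ∈ IsManifold.maximalAtlas (𝓡 n) ∞ M) (i j : Fin n) :
    ContDiffOn ℝ ∞ (fun y => gInv g e y i j) e.target := by
  have hdet : ∀ A : Model n → Matrix (Fin n) (Fin n) ℝ,
      (∀ i j, ContDiffOn ℝ ∞ (fun y => A y i j) e.target) →
      ContDiffOn ℝ ∞ (fun y => (A y).det) e.target := by
    intro A hA
    simp only [Matrix.det_apply]
    exact ContDiffOn.sum fun s _ => (contDiffOn_prod fun k _ => hA _ _).const_smul _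
  have h1 : ∀ y, gInv g e y i j = ((gCoord g e y).det)⁻¹
      * ((gCoord g e y).updateRow j (Pi.single i 1)).det := by
    intro y
    rw [gInv, Matrix.inv_def, Matrix.smul_apply, Matrix.adjugate_apply, Ring.inverse_eq_inv',
      smul_eq_mul]
  simp only [h1]
  refine ((hdet _ fun k l => contDiffOn_gCoord g he k l).inv fun y hy =>
    (isUnit_det_gCoord g he hy).ne_zero).mul (hdet _ fun k l => ?_)
  by_cases hk : k = j
  · subst hk
    simp only [Matrix.updateRow_self]
    exact contDiffOn_const
  · simp only [Matrix.updateRow_ne hk]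
    exact contDiffOn_gCoord g he k l

theorem contDiffOn_christoffel (he : e ∈ IsManifold.maximalAtlas (𝓡 n) ∞ M) (k i j : Fin n) :
    ContDiffOn ℝ ∞ (christoffel g e k i j) e.target := by
  have hpd : ∀ l i j, ContDiffOn ℝ ∞ (fun y => pd l (fun z => gCoord g e z i j) y) e.target :=
    fun l i j => ((contDiffOn_gCoord g he i j).fderiv' e.open_target).clm_apply contDiffOn_const
  exact contDiffOn_const.mul (ContDiffOn.sum fun l _ => (contDiffOn_gInv g he k l).mul
    (((hpd i l j).add (hpd j l i)).sub (hpd l i j)))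

theorem contDiffOn_connForm (he : e ∈ IsManifold.maximalAtlas (𝓡 n) ∞ M) :
    ContDiffOn ℝ ∞ (connForm g e) e.target :=
  contDiffOn_coeffConn fun k i j => contDiffOn_christoffel g he k i j

theorem fderiv_metricForm_symm (he : e ∈ IsManifold.maximalAtlas (𝓡 n) ∞ M) {y : Model n}
    (hy : y ∈ e.target) (w u v : Model n) :
    fderiv ℝ (metricForm g e) y w u v = fderiv ℝ (metricForm g e) y w v u := by
  have hd := (contDiffOn_metricForm g he).differentiableAt_of_isOpen e.open_target hy
  rw [← fderiv_apply₂ hd, ← fderiv_apply₂ hd]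
  have : (fun z => metricForm g e z u v) =ᶠ[𝓝 y] fun z => metricForm g e z v u :=
    Filter.eventually_of_mem (e.open_target.mem_nhds hy) fun z hz =>
      (isInner_metricForm g he hz).symm u v
  rw [this.fderiv_eq]

theorem metricForm_connForm (he : e ∈ IsManifold.maximalAtlas (𝓡 n) ∞ M) {y : Model n}
    (hy : y ∈ e.target) (i j m : Fin n) :
    metricForm g e y (connForm g e y (unitVec i) (unitVec j)) (unitVec m) = (1 / 2) *
      (fderiv ℝ (metricForm g e) y (unitVec i) (unitVec m) (unitVec j)
        + fderiv ℝ (metricForm g e) y (unitVec j) (unitVec m) (unitVec i)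
        - fderiv ℝ (metricForm g e) y (unitVec m) (unitVec i) (unitVec j)) := by
  set a : Fin n → ℝ := fun l => fderiv ℝ (metricForm g e) y (unitVec i) (unitVec l) (unitVec j)
    + fderiv ℝ (metricForm g e) y (unitVec j) (unitVec l) (unitVec i)
    - fderiv ℝ (metricForm g e) y (unitVec l) (unitVec i) (unitVec j) with ha
  have h1 : ∀ k, (connForm g e y (unitVec i) (unitVec j)) k
      = (1 / 2) * Matrix.mulVec (gInv g e y) a k := by
    intro k
    rw [connForm, coeffConn_unitVec, christoffel]
    simp only [pd_gCoord g he hy]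
    rfl
  rw [(isInner_metricForm g he hy).symm,
    ← sum_smul_unitVec (connForm g e y (unitVec i) (unitVec j)), map_sum]
  simp only [map_smul, h1, metricForm_unitVec, smul_eq_mul]
  have h2 : Matrix.mulVec (gCoord g e y) (Matrix.mulVec (gInv g e y) a) m = a m := by
    rw [Matrix.mulVec_mulVec, gInv, Matrix.mul_nonsing_inv _ (isUnit_det_gCoord g he hy),
      Matrix.one_mulVec]
  change _ = (1 / 2) * a m
  rw [← h2, Matrix.mulVec, dotProduct, Finset.mul_sum]
  exact Finset.sum_congr rfl fun k _ => by ring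

/-- In a chart, the metric and the Christoffel symbols form a Levi-Civita pair. -/
theorem leviCivitaOn (he : e ∈ IsManifold.maximalAtlas (𝓡 n) ∞ M) :
    LeviCivitaOn e.target (metricForm g e) (connForm g e) := by
  have hsymm : ∀ y ∈ e.target, ∀ i j, connForm g e y (unitVec i) (unitVec j)
      = connForm g e y (unitVec j) (unitVec i) := by
    intro y hy i j
    refine (isInner_metricForm g he hy).ext fun w => ?_
    rw [← sum_smul_unitVec w, map_sum, map_sum]
    refine Finset.sum_congr rfl fun m _ => ?_
    rw [map_smul, map_smul, metricForm_connForm g he hy, metricForm_connForm g he hy,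
      fderiv_metricForm_symm g he hy (unitVec m) (unitVec i)]
    congr 1
    ring
  refine ⟨e.open_target, contDiffOn_metricForm g he, contDiffOn_connForm g he,
    fun y hy => isInner_metricForm g he hy, fun y hy u v => ?_, fun y hy w u v => ?_⟩
  · have h : connForm g e y = (connForm g e y).flip :=
      clm_ext_unitVec fun i => clm_ext_unitVec fun j => hsymm y hy i j
    rw [h, ContinuousLinearMap.flip_apply, ← h]
  · set T : Model n →L[ℝ] Model n →L[ℝ] Model n →L[ℝ] ℝ :=
      (ContinuousLinearMap.compL ℝ (Model n) (Model n) (Model n →L[ℝ] ℝ)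
        (metricForm g e y)).comp (connForm g e y) with hT
    have hTa : ∀ a b c, T a b c = metricForm g e y (connForm g e y a b) c := fun _ _ _ => rfl
    have h : fderiv ℝ (metricForm g e) y = T + (flipCLM ℝ).comp T := by
      refine clm_ext_unitVec fun a => clm_ext_unitVec fun b => clm_ext_unitVec fun c => ?_
      simp only [add_apply, ContinuousLinearMap.comp_apply, flipCLM_apply,
        ContinuousLinearMap.flip_apply, hTa, metricForm_connForm g he hy]
      rw [fderiv_metricForm_symm g he hy (unitVec a) (unitVec c),
        fderiv_metricForm_symm g he hy (unitVec b) (unitVec c),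
        fderiv_metricForm_symm g he hy (unitVec c) (unitVec b)]
      ring
    rw [h]
    simp only [add_apply, ContinuousLinearMap.comp_apply, flipCLM_apply,
      ContinuousLinearMap.flip_apply, hTa]
    rw [(isInner_metricForm g he hy).symm u]

theorem pd_christoffel (he : e ∈ IsManifold.maximalAtlas (𝓡 n) ∞ M) {y : Model n}
    (hy : y ∈ e.target) (l k i j : Fin n) : pd l (christoffel g e k i j) y
      = fderiv ℝ (connForm g e) y (unitVec l) (unitVec i) (unitVec j) k := by
  have hd := (contDiffOn_connForm g he).differentiableAt_of_isOpen e.open_target hy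
  have hd2 : DifferentiableAt ℝ (fun z => connForm g e z (unitVec i) (unitVec j)) y :=
    (hd.clm_apply (differentiableAt_const _)).clm_apply (differentiableAt_const _)
  rw [← fderiv_apply₂ hd]
  change _ = (EuclideanSpace.proj k : Model n →L[ℝ] ℝ) _
  rw [← fderiv_clm_left (EuclideanSpace.proj k : Model n →L[ℝ] ℝ) hd2 (unitVec l)]
  have h : (fun z => (EuclideanSpace.proj k : Model n →L[ℝ] ℝ)
      (connForm g e z (unitVec i) (unitVec j))) = christoffel g e k i j :=
    funext fun z => coeffConn_unitVec _ _ _ _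
  rw [h]
  rfl

theorem riemann_eq (he : e ∈ IsManifold.maximalAtlas (𝓡 n) ∞ M) {y : Model n}
    (hy : y ∈ e.target) (i j k l : Fin n) : riemann g e i j k l y
      = curv (connForm g e) y (unitVec i) (unitVec j) (unitVec l) k := by
  have h : ∀ a b c, connForm g e y (unitVec a) (connForm g e y (unitVec b) (unitVec c)) k
      = ∑ m, christoffel g e k a m y * christoffel g e m b c y := by
    intro a b c
    conv_lhs => rw [← sum_smul_unitVec (connForm g e y (unitVec b) (unitVec c))]
    simp [connForm, mul_comm]
  rw [riemann, pd_christoffel g he hy, pd_christoffel g he hy, curv_apply,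
    Finset.sum_sub_distrib, ← h, ← h]
  rfl

theorem ricci_eq (he : e ∈ IsManifold.maximalAtlas (𝓡 n) ∞ M) {y : Model n}
    (hy : y ∈ e.target) (i j : Fin n) :
    ricci g e i j y = ric (connForm g e) y (unitVec i) (unitVec j) := by
  rw [ric, ricciContr_apply, tr_eq_sum (stdBasis n), ricci]
  refine Finset.sum_congr rfl fun k _ => ?_
  rw [riemann_eq g he hy, stdBasis_apply, stdBasis_repr]
  rfl

theorem gTrace_eq (he : e ∈ IsManifold.maximalAtlas (𝓡 n) ∞ M) {y : Model n}
    (hy : y ∈ e.target) (T : Model n →L[ℝ] Model n →L[ℝ] ℝ) :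
    gTrace g e (fun i j => T (unitVec i) (unitVec j)) y = trG (metricForm g e y) T := by
  have hG := isInner_metricForm g he hy
  have hd : ∀ i, dualVec (metricForm g e y) (stdBasis n) i = ∑ j, gInv g e y i j • unitVec j := by
    intro i
    refine hG.ext fun w => ?_
    rw [hG.dualVec_apply, stdBasis_repr]
    have h2 : metricForm g e y (∑ j, gInv g e y i j • unitVec j)
        = (EuclideanSpace.proj i : Model n →L[ℝ] ℝ) := by
      refine clm_ext_unitVec fun k => ?_
      have h3 := congrFun (congrFun (Matrix.nonsing_inv_mul _ (isUnit_det_gCoord g he hy)) i) k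
      rw [Matrix.mul_apply, Matrix.one_apply] at h3
      simp only [map_sum, map_smul, sum_apply, smul_apply, metricForm_unitVec,
        smul_eq_mul]
      refine h3.trans ?_
      rw [← unitVec_apply]
      rfl
    rw [h2]
    rfl
  rw [hG.trG_eq (stdBasis n), gTrace]
  refine Finset.sum_congr rfl fun i _ => ?_
  simp only [stdBasis_apply, hd, map_sum, map_smul, smul_eq_mul]

theorem schoutenTrace_eq (he : e ∈ IsManifold.maximalAtlas (𝓡 n) ∞ M) {y : Model n}
    (hy : y ∈ e.target) :
    schoutenTrace g e y = schJ (metricForm g e) (connForm g e) y := by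
  rw [schoutenTrace, schJ, finrank_model, ← gTrace_eq g he hy]
  simp only [ricci_eq g he hy]

theorem schouten_eq (he : e ∈ IsManifold.maximalAtlas (𝓡 n) ∞ M) {y : Model n}
    (hy : y ∈ e.target) (i j : Fin n) : schouten g e i j y
      = schP (metricForm g e) (connForm g e) y (unitVec i) (unitVec j) := by
  rw [schouten, ricci_eq g he hy, schoutenTrace_eq g he hy, schP, finrank_model]
  simp only [smul_apply, sub_apply, smul_eq_mul, metricForm_unitVec]
  ring

theorem covForm_eq (he : e ∈ IsManifold.maximalAtlas (𝓡 n) ∞ M) {f : M → ℝ}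
    (hf : ContMDiff (𝓡 n) 𝓘(ℝ) ∞ f) {y : Model n} (hy : y ∈ e.target) (i j : Fin n) :
    hess g e f i j y = hessForm (connForm g e) (fun z => f (e.symm z)) y
      (unitVec i) (unitVec j) := by
  have hc := contDiffOn_comp_symm hf he
  have hd : ∀ z, MDifferentiableAt (𝓡 n) 𝓘(ℝ) f z := fun z => (hf z).mdifferentiableAt (by simp)
  have hev : formCoord (mvfderiv (𝓡 n) f) e j
      =ᶠ[𝓝 y] fun z => fderiv ℝ (fun z => f (e.symm z)) z (unitVec j) :=
    Filter.eventually_of_mem (e.open_target.mem_nhds hy) fun z hz =>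
      formCoord_mvfderiv he hz (hd _) j
  rw [hess, covForm, pd, hev.fderiv_eq, hessForm_apply,
    fderiv_apply₁ ((hc.fderiv' e.open_target).differentiableAt_of_isOpen e.open_target hy)]
  congr 1
  conv_rhs => rw [← sum_smul_unitVec (connForm g e y (unitVec i) (unitVec j))]
  rw [map_sum]
  refine Finset.sum_congr rfl fun k _ => ?_
  rw [map_smul, formCoord_mvfderiv he hy (hd _), connForm, coeffConn_unitVec]
  rfl

end Bridge

theorem LeviCivitaOn.mono {E : Type*} [NormedAddCommGroup E] [NormedSpace ℝ E]
    [FiniteDimensional ℝ E] {U V : Set E} {G : E → E →L[ℝ] E →L[ℝ] ℝ}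
    {Γ : E → E →L[ℝ] E →L[ℝ] E} (h : LeviCivitaOn U G Γ) (hV : IsOpen V) (hVU : V ⊆ U) :
    LeviCivitaOn V G Γ :=
  ⟨hV, h.contDiffOn_metric.mono hVU, h.contDiffOn_conn.mono hVU, fun y hy => h.isInner y (hVU hy),
    fun y hy => h.torsion y (hVU hy), fun y hy => h.compat y (hVU hy)⟩

section ChartChange

variable {n : ℕ} {M : Type*} [TopologicalSpace M] [ChartedSpace (Model n) M]
  [IsManifold (𝓡 n) ∞ M] (g : PMetric n M) {e e' : OpenPartialHomeomorph M (Model n)}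

theorem form_congr {x x' : M} (h : x = x') (u v : Model n) :
    (g.form x : Model n →L[ℝ] Model n →L[ℝ] ℝ) u v
      = (g.form x' : Model n →L[ℝ] Model n →L[ℝ] ℝ) u v := by
  subst h; rfl

theorem contDiffOn_chartChange (he : e ∈ IsManifold.maximalAtlas (𝓡 n) ∞ M)
    (he' : e' ∈ IsManifold.maximalAtlas (𝓡 n) ∞ M) :
    ContDiffOn ℝ ∞ (fun y => e' (e.symm y)) (e.target ∩ e.symm ⁻¹' e'.source) := by
  rw [← contMDiffOn_iff_contDiffOn]
  exact (contMDiffOn_of_mem_maximalAtlas he').comp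
    ((contMDiffOn_symm_of_mem_maximalAtlas he).mono Set.inter_subset_left) fun y hy => hy.2

theorem chartDeriv_chartChange (he : e ∈ IsManifold.maximalAtlas (𝓡 n) ∞ M)
    (he' : e' ∈ IsManifold.maximalAtlas (𝓡 n) ∞ M) {y : Model n} (hy : y ∈ e.target)
    (hy' : e.symm y ∈ e'.source) (u : Model n) : (chartDeriv e y u : Model n)
      = (chartDeriv e' (e' (e.symm y)) (fderiv ℝ (fun z => e' (e.symm z)) y u) : Model n) := by
  have hU : IsOpen (e.target ∩ e.symm ⁻¹' e'.source) := e.isOpen_inter_preimage_symm e'.open_source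
  have hev : (e.symm : Model n → M) =ᶠ[𝓝 y] fun z => e'.symm (e' (e.symm z)) :=
    Filter.eventually_of_mem (hU.mem_nhds ⟨hy, hy'⟩) fun z hz => (e'.left_inv hz.2).symm
  have h1 : MDifferentiableAt (𝓡 n) (𝓡 n) (fun z => e' (e.symm z)) y :=
    ((contDiffOn_chartChange he he').differentiableAt_of_isOpen hU ⟨hy, hy'⟩).mdifferentiableAt
  have h2 := mfderiv_comp y
    ((mdifferentiable_of_mem_maximalAtlas he').symm.mdifferentiableAt (e'.map_source hy')) h1
  have h3 : mfderiv (𝓡 n) (𝓡 n) (fun z => e' (e.symm z)) y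
      = fderiv ℝ (fun z => e' (e.symm z)) y := mfderiv_eq_fderiv
  have h4 : (mfderiv (𝓡 n) (𝓡 n) e.symm y : Model n →L[ℝ] Model n)
      = mfderiv (𝓡 n) (𝓡 n) (e'.symm ∘ fun z => e' (e.symm z)) y := hev.mfderiv_eq
  have h5 := congrArg (fun L : Model n →L[ℝ] Model n => L u) (h4.trans h2)
  rw [← h3]
  exact h5

theorem pullbackOn (he : e ∈ IsManifold.maximalAtlas (𝓡 n) ∞ M)
    (he' : e' ∈ IsManifold.maximalAtlas (𝓡 n) ∞ M) :
    PullbackOn (e.target ∩ e.symm ⁻¹' e'.source) e'.target (metricForm g e) (metricForm g e')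
      (connForm g e) (connForm g e') (fun y => e' (e.symm y)) where
  left := (leviCivitaOn g he).mono (e.isOpen_inter_preimage_symm e'.open_source)
    Set.inter_subset_left
  right := leviCivitaOn g he'
  contDiffOn := contDiffOn_chartChange he he'
  mapsTo := fun y hy => e'.map_source hy.2
  bijective := fun y hy => by
    have h1 := chartDeriv_bijective he hy.1
    have h2 := chartDeriv_bijective he' (e'.map_source hy.2)
    have h3 : (chartDeriv e y : Model n → Model n)
        = (chartDeriv e' (e' (e.symm y)) : Model n → Model n)
          ∘ (fderiv ℝ (fun z => e' (e.symm z)) y) :=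
      funext fun u => chartDeriv_chartChange he he' hy.1 hy.2 u
    exact (Function.Bijective.of_comp_iff' (f := (chartDeriv e' (e' (e.symm y)) :
      Model n → Model n)) h2 _).1 (h3 ▸ h1)
  eq := fun y hy u v => by
    rw [metricForm_apply, metricForm_apply]
    refine Eq.trans ?_ (form_congr g (e'.left_inv hy.2).symm _ _)
    have hu := chartDeriv_chartChange he he' hy.1 hy.2 u
    have hv := chartDeriv_chartChange he he' hy.1 hy.2 v
    exact congrArg₂ (fun a b : Model n =>
      (g.form (e.symm y) : Model n →L[ℝ] Model n →L[ℝ] ℝ) a b) hu hv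

/-- The bilinear form `∇∇f + f P` in the chart `e`. -/
def aeForm (g : PMetric n M) (e : OpenPartialHomeomorph M (Model n)) (f : M → ℝ) (y : Model n) :
    Model n →L[ℝ] Model n →L[ℝ] ℝ :=
  hessForm (connForm g e) (fun z => f (e.symm z)) y
    + f (e.symm y) • schP (metricForm g e) (connForm g e) y

variable {f : M → ℝ}

theorem trG_aeForm (hn : 3 ≤ n) (he : e ∈ IsManifold.maximalAtlas (𝓡 n) ∞ M) {y : Model n}
    (hy : y ∈ e.target) : trG (metricForm g e y) (aeForm g e f y)
      = trG (metricForm g e y) (hessForm (connForm g e) (fun z => f (e.symm z)) y)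
        + f (e.symm y) * schJ (metricForm g e) (connForm g e) y := by
  rw [aeForm, trG_add, trG_smul,
    LeviCivitaOn.trG_schP (finrank_model.symm ▸ hn) (leviCivitaOn g he) hy]

theorem chartAt_mem (x : M) :
    chartAt (Model n) x ∈ IsManifold.maximalAtlas (𝓡 n) ∞ M :=
  IsManifold.chart_mem_maximalAtlas x

theorem schJ_chart (he : e ∈ IsManifold.maximalAtlas (𝓡 n) ∞ M) {y : Model n}
    (hy : y ∈ e.target) : schoutenTrace g (chartAt (Model n) (e.symm y))
      (chartAt (Model n) (e.symm y) (e.symm y)) = schJ (metricForm g e) (connForm g e) y := by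
  have hx := mem_chart_source (Model n) (e.symm y)
  rw [schoutenTrace_eq g (chartAt_mem _) ((chartAt (Model n) (e.symm y)).map_source hx)]
  exact ((pullbackOn g he (chartAt_mem (e.symm y))).schJ_eq ⟨hy, hx⟩).symm

theorem laplacePlusJ_eq (hn : 3 ≤ n) (hf : ContMDiff (𝓡 n) 𝓘(ℝ) ∞ f)
    (he : e ∈ IsManifold.maximalAtlas (𝓡 n) ∞ M) {y : Model n} (hy : y ∈ e.target) :
    laplacePlusJ g f (e.symm y) = trG (metricForm g e y) (aeForm g e f y) := by
  have hx := mem_chart_source (Model n) (e.symm y)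
  set e₁ := chartAt (Model n) (e.symm y) with he₁
  have h1 : e₁ ∈ IsManifold.maximalAtlas (𝓡 n) ∞ M := chartAt_mem _
  have h2 := e₁.map_source hx
  rw [trG_aeForm g hn he hy, laplacePlusJ]
  simp only [← he₁, covForm_eq g h1 hf h2]
  rw [gTrace_eq g h1 h2, schJ_chart g he hy, mul_comm (f _)]
  congr 1
  refine ((pullbackOn g he h1).trG_hess_eq (contDiffOn_comp_symm hf h1) ?_ ⟨hy, hx⟩).symm
  intro z hz
  rw [e₁.left_inv hz.2]

theorem contDiffOn_aeForm (hf : ContMDiff (𝓡 n) 𝓘(ℝ) ∞ f)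
    (he : e ∈ IsManifold.maximalAtlas (𝓡 n) ∞ M) : ContDiffOn ℝ ∞ (aeForm g e f) e.target :=
  (contDiffOn_hessForm e.open_target (contDiffOn_connForm g he) (contDiffOn_comp_symm hf he)).add
    ((contDiffOn_comp_symm hf he).smul (leviCivitaOn g he).contDiffOn_schP)

theorem contMDiff_laplacePlusJ (hn : 3 ≤ n) (hf : ContMDiff (𝓡 n) 𝓘(ℝ) ∞ f) :
    ContMDiff (𝓡 n) 𝓘(ℝ) ∞ (laplacePlusJ g f) := by
  intro x
  have he := chartAt_mem (n := n) x
  have h1 : ContMDiffOn (𝓡 n) 𝓘(ℝ) ∞ (fun z => trG (metricForm g (chartAt (Model n) x)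
      (chartAt (Model n) x z)) (aeForm g (chartAt (Model n) x) f (chartAt (Model n) x z)))
      (chartAt (Model n) x).source :=
    (contMDiffOn_iff_contDiffOn.2 ((leviCivitaOn g he).contDiffOn_trG
      (contDiffOn_aeForm g hf he))).comp (contMDiffOn_of_mem_maximalAtlas he)
      fun z hz => (chartAt (Model n) x).map_source hz
  have h2 : ContMDiffOn (𝓡 n) 𝓘(ℝ) ∞ (laplacePlusJ g f) (chartAt (Model n) x).source := by
    refine h1.congr fun z hz => ?_
    rw [← laplacePlusJ_eq g hn hf he ((chartAt (Model n) x).map_source hz),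
      (chartAt (Model n) x).left_inv hz]
  exact h2.contMDiffAt ((chartAt (Model n) x).open_source.mem_nhds (mem_chart_source _ x))

theorem aeForm_symm (hf : ContMDiff (𝓡 n) 𝓘(ℝ) ∞ f)
    (he : e ∈ IsManifold.maximalAtlas (𝓡 n) ∞ M) {y : Model n} (hy : y ∈ e.target)
    (u v : Model n) : aeForm g e f y u v = aeForm g e f y v u := by
  have h := leviCivitaOn g he
  simp only [aeForm, add_apply, smul_apply, hessForm_apply, h.schP_symm hy u v,
    h.torsion y hy u v, (contDiffOn_comp_symm hf he).second_symm e.open_target hy u v]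

/-- The almost Einstein equation in the chart `e`. -/
theorem symTraceFree_eq_zero_iff (hn : 3 ≤ n) (hf : ContMDiff (𝓡 n) 𝓘(ℝ) ∞ f)
    (he : e ∈ IsManifold.maximalAtlas (𝓡 n) ∞ M) {y : Model n} (hy : y ∈ e.target) :
    (∀ i j, symTraceFree g e (fun k l => hess g e f k l y
      + schouten g e k l y * f (e.symm y)) y i j = 0)
      ↔ aeForm g e f y = (laplacePlusJ g f (e.symm y) / n) • metricForm g e y := by
  have hT : (fun k l => hess g e f k l y + schouten g e k l y * f (e.symm y))
      = fun k l => aeForm g e f y (unitVec k) (unitVec l) := by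
    funext k l
    rw [covForm_eq g he hf hy, schouten_eq g he hy, aeForm]
    simp [mul_comm]
  rw [hT, laplacePlusJ_eq g hn hf he hy]
  simp only [symTraceFree, gTrace_eq g he hy]
  constructor
  · intro h
    refine clm_ext_unitVec fun i => clm_ext_unitVec fun j => ?_
    have := h i j
    rw [aeForm_symm g hf he hy (unitVec j)] at this
    simp only [smul_apply, smul_eq_mul, metricForm_unitVec]
    linarith
  · intro h i j
    rw [aeForm_symm g hf he hy (unitVec j), ← metricForm_unitVec]
    have := congrArg (fun T : Model n →L[ℝ] Model n →L[ℝ] ℝ => T (unitVec i) (unitVec j)) h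
    simp only [smul_apply, smul_eq_mul] at this
    linarith

end ChartChange

section DualForm

variable {n : ℕ} {M : Type*} [TopologicalSpace M] [ChartedSpace (Model n) M]
  [IsManifold (𝓡 n) ∞ M]

/-- A form on a tangent space is an inner product in the wide sense. -/
def IsInnerForm {x : M} (h : Form n x) : Prop :=
  IsInner (E := Model n) (h : Model n →L[ℝ] Model n →L[ℝ] ℝ)

theorem PMetric.isInnerForm (g : PMetric n M) (x : M) : IsInnerForm (g.form x) :=
  ⟨g.symm x, g.nondegenerate x⟩

variable {x : M} {h : Form n x}

theorem IsInnerForm.apply_inverse (hh : IsInnerForm h) (α : Cotangent n x) :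
    h (ContinuousLinearMap.inverse h α) = α :=
  IsInner.apply_inverse (E := Model n) hh α

theorem IsInnerForm.inverse_eq (hh : IsInnerForm h) {α : Cotangent n x}
    {v : TangentSpace (𝓡 n) x} (hv : h v = α) : ContinuousLinearMap.inverse h α = v := by
  rw [← hv]
  exact IsInner.inverse_apply (E := Model n) hh v

theorem IsInnerForm.dualForm_symm (hh : IsInnerForm h) (α β : Cotangent n x) :
    dualForm h α β = dualForm h β α := by
  have h1 : h (ContinuousLinearMap.inverse h α) (ContinuousLinearMap.inverse h β)
      = h (ContinuousLinearMap.inverse h β) (ContinuousLinearMap.inverse h α) := hh.symm _ _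
  rw [hh.apply_inverse, hh.apply_inverse] at h1
  exact h1

theorem dualForm_smul_right (a : ℝ) (α β : Cotangent n x) :
    dualForm h α (a • β) = a * dualForm h α β := by
  simp [dualForm]

theorem IsInnerForm.smul (hh : IsInnerForm h) {a : ℝ} (ha : a ≠ 0) : IsInnerForm (a • h) := by
  refine ⟨fun u v => congrArg (a * ·) (hh.symm u v), fun u hu => hh.nondeg u fun v => ?_⟩
  exact (mul_eq_zero.1 (hu v)).resolve_left ha

theorem IsInnerForm.dualForm_smul (hh : IsInnerForm h) {a : ℝ} (ha : a ≠ 0)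
    (α β : Cotangent n x) : dualForm (a • h) α β = a⁻¹ * dualForm h α β := by
  have h1 : ContinuousLinearMap.inverse (a • h) β = a⁻¹ • ContinuousLinearMap.inverse h β := by
    refine (hh.smul ha).inverse_eq ?_
    rw [map_smul, smul_apply, hh.apply_inverse, smul_smul, inv_mul_cancel₀ ha, one_smul]
  rw [dualForm, h1, map_smul]
  rfl

end DualForm

section Rescaling

variable {n : ℕ} {M : Type*} [TopologicalSpace M] [ChartedSpace (Model n) M]
  [IsManifold (𝓡 n) ∞ M] {g g' : PMetric n M} {Ω f : M → ℝ}
  {e : OpenPartialHomeomorph M (Model n)}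

theorem exists_chart (x : M) : ∃ e ∈ IsManifold.maximalAtlas (𝓡 n) ∞ M,
    ∃ y ∈ e.target, e.symm y = x :=
  ⟨chartAt (Model n) x, chartAt_mem x, chartAt (Model n) x x,
    (chartAt (Model n) x).map_source (mem_chart_source _ x),
    (chartAt (Model n) x).left_inv (mem_chart_source _ x)⟩

theorem dualForm_mvfderiv (g : PMetric n M) (hf : ContMDiff (𝓡 n) 𝓘(ℝ) ∞ f)
    (he : e ∈ IsManifold.maximalAtlas (𝓡 n) ∞ M) {y : Model n} (hy : y ∈ e.target)
    (β : Cotangent n (e.symm y)) :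
    dualForm (g.form (e.symm y)) β (mvfderiv (𝓡 n) f (e.symm y))
      = β (chartDeriv e y (gradVec (metricForm g e) (fun z => f (e.symm z)) y)) := by
  rw [dualForm]
  congr 1
  refine (g.isInnerForm _).inverse_eq ?_
  ext w
  obtain ⟨v, rfl⟩ := (chartDeriv_bijective he hy).2 w
  rw [← metricForm_apply, mvfderiv_chartDeriv he hy ((hf _).mdifferentiableAt (by simp)),
    (leviCivitaOn g he).apply_gradVec hy]

theorem IsRescaling.contMDiff_log (h : IsRescaling Ω g g') :
    ContMDiff (𝓡 n) 𝓘(ℝ) ∞ (fun x => Real.log (Ω x)) := by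
  intro x
  exact (Real.contDiffAt_log.2 (h.2.1 x).ne').contMDiffAt.comp x (h.1 x)

theorem IsRescaling.mvfderiv_log (h : IsRescaling Ω g g') (x : M) :
    mvfderiv (𝓡 n) (fun x => Real.log (Ω x)) x = (Ω x)⁻¹ • mvfderiv (𝓡 n) Ω x := by
  have h1 : HasMFDerivAt (𝓡 n) 𝓘(ℝ) Ω x (mfderiv (𝓡 n) 𝓘(ℝ) Ω x) :=
    ((h.1 x).mdifferentiableAt (by simp)).hasMFDerivAt
  have h2 : HasMFDerivAt 𝓘(ℝ) 𝓘(ℝ) Real.log (Ω x)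
      (ContinuousLinearMap.toSpanSingleton ℝ (Ω x)⁻¹ : ℝ →L[ℝ] ℝ) :=
    (Real.hasDerivAt_log (h.2.1 x).ne').hasFDerivAt.hasMFDerivAt
  have h3 := (h2.comp x h1).mfderiv
  ext v
  have h4 := congrArg (fun L : TangentSpace (𝓡 n) x →L[ℝ] ℝ => L v) h3
  exact h4.trans (mul_comm (G := ℝ) (mfderiv (𝓡 n) 𝓘(ℝ) Ω x v) (Ω x)⁻¹)

theorem IsRescaling.conformalOn (h : IsRescaling Ω g g')
    (he : e ∈ IsManifold.maximalAtlas (𝓡 n) ∞ M) :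
    ConformalOn e.target (metricForm g e) (metricForm g' e) (connForm g e) (connForm g' e)
      (fun y => Real.log (Ω (e.symm y))) where
  left := leviCivitaOn g he
  right := leviCivitaOn g' he
  contDiffOn := contDiffOn_comp_symm h.contMDiff_log he
  eq := fun y _ => by
    ext u v
    rw [metricForm_apply, h.2.2, smul_apply, smul_apply, smul_apply, smul_apply,
      ← metricForm_apply, mul_comm, Real.exp_mul, Real.exp_log (h.2.1 _)]
    norm_cast

/-- The scalar by which the trace part of the almost Einstein operator changes. -/
def aeShift (g : PMetric n M) (Ω f : M → ℝ) (x : M) : ℝ :=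
  dualForm (g.form x) ((Ω x)⁻¹ • mvfderiv (𝓡 n) Ω x) (mvfderiv (𝓡 n) f x)
    + 1 / 2 * f x * dualForm (g.form x) ((Ω x)⁻¹ • mvfderiv (𝓡 n) Ω x)
      ((Ω x)⁻¹ • mvfderiv (𝓡 n) Ω x)

theorem IsRescaling.aeForm_eq (hn : 3 ≤ n) (h : IsRescaling Ω g g')
    (hf : ContMDiff (𝓡 n) 𝓘(ℝ) ∞ f) (he : e ∈ IsManifold.maximalAtlas (𝓡 n) ∞ M)
    {y : Model n} (hy : y ∈ e.target) : aeForm g' e (fun x => Ω x * f x) y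
      = Ω (e.symm y) • (aeForm g e f y + aeShift g Ω f (e.symm y) • metricForm g e y) := by
  have h1 := (h.conformalOn he).ae_operator_eq (finrank_model.symm ▸ hn)
    (contDiffOn_comp_symm hf he) hy
  simp only [Real.exp_log (h.2.1 _)] at h1
  rw [aeForm, h1, aeForm, aeShift, ← h.mvfderiv_log,
    (g.isInnerForm _).dualForm_symm _ (mvfderiv (𝓡 n) f _),
    dualForm_mvfderiv g h.contMDiff_log he hy, dualForm_mvfderiv g h.contMDiff_log he hy,
    mvfderiv_chartDeriv he hy ((hf _).mdifferentiableAt (by simp)),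
    mvfderiv_chartDeriv he hy ((h.contMDiff_log _).mdifferentiableAt (by simp))]

theorem IsRescaling.laplacePlusJ_eq (hn : 3 ≤ n) (h : IsRescaling Ω g g')
    (hf : ContMDiff (𝓡 n) 𝓘(ℝ) ∞ f) (x : M) : laplacePlusJ g' (fun x => Ω x * f x) x
      = (Ω x)⁻¹ * (laplacePlusJ g f x + n * aeShift g Ω f x) := by
  obtain ⟨e, he, y, hy, rfl⟩ := exists_chart (n := n) x
  have hpos := h.2.1 (e.symm y)
  have hexp : Real.exp (-(2 * Real.log (Ω (e.symm y)))) = (Ω (e.symm y) ^ 2)⁻¹ := by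
    rw [Real.exp_neg, mul_comm, Real.exp_mul, Real.exp_log hpos]
    norm_cast
  rw [ConformalTractor.laplacePlusJ_eq g' (f := fun x => Ω x * f x) hn (h.1.mul hf) he hy,
    ConformalTractor.laplacePlusJ_eq g hn hf he hy, (h.conformalOn he).trG_eq hy, hexp,
    h.aeForm_eq hn hf he hy, trG_smul, trG_add, trG_smul,
    (isInner_metricForm g he hy).trG_self, finrank_model]
  field_simp

theorem mvfderiv_mul' {f f' : M → ℝ} (hf : ContMDiff (𝓡 n) 𝓘(ℝ) ∞ f)
    (hf' : ContMDiff (𝓡 n) 𝓘(ℝ) ∞ f') (x : M) : mvfderiv (𝓡 n) (fun x => f x * f' x) x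
      = f x • mvfderiv (𝓡 n) f' x + f' x • mvfderiv (𝓡 n) f x := by
  exact mvfderiv_mul ((hf x).mdifferentiableAt (by simp)) ((hf' x).mdifferentiableAt (by simp))

end Rescaling

section Scales

variable {n : ℕ} {M : Type*} [TopologicalSpace M] [ChartedSpace (Model n) M]
  [IsManifold (𝓡 n) ∞ M] {c : ConformalStructure n M}

theorem exists_isRescaling (g g' : Scale c) : ∃ Ω : M → ℝ, IsRescaling Ω g.1 g'.1 :=
  Quotient.exact (g.2.trans g'.2.symm)

theorem ray_form (g : Scale c) (x : M) : (g.ray x).1 = g.1.form x := rfl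

theorem smul_form_injective [NeZero n] {x : M} (h : Ray c x) {a b : ℝ}
    (hab : a • h.1 = b • h.1) : a = b := by
  by_contra hne
  obtain ⟨h, g, rfl⟩ := h
  refine form_ne_zero g.1 x ?_
  have h1 : (a - b) • g.1.form x = 0 := by rw [sub_smul]; exact sub_eq_zero.2 hab
  exact (smul_eq_zero.1 h1).resolve_left (sub_ne_zero.2 hne)

theorem ratio_unique [NeZero n] (g : Scale c) {x : M} (h : Ray c x) {s : ℝ} (hs : 0 < s)
    (hh : h.1 = s ^ 2 • g.1.form x) : ratio g h = s := by
  have h1 : ratio g h ^ 2 = s ^ 2 := smul_form_injective (g.ray x) <| by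
    rw [ray_form, ← ratio_spec, hh]
  exact (pow_left_inj₀ (ratio_pos g h).le hs.le two_ne_zero).1 h1

theorem ratio_ray [NeZero n] {g g' : Scale c} {Ω : M → ℝ} (h : IsRescaling Ω g.1 g'.1) (x : M) :
    ratio g (g'.ray x) = Ω x :=
  ratio_unique g _ (h.2.1 x) (h.2.2 x)

theorem ratio_eq_mul [NeZero n] {g g' : Scale c} {Ω : M → ℝ} (h : IsRescaling Ω g.1 g'.1)
    {x : M} (r : Ray c x) : ratio g r = Ω x * ratio g' r := by
  refine ratio_unique g r (mul_pos (h.2.1 x) (ratio_pos g' r)) ?_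
  rw [ratio_spec g' r, h.2.2 x, smul_smul, mul_pow, mul_comm]

theorem isRescaling_self (g : PMetric n M) : IsRescaling (fun _ => 1) g g :=
  ⟨contMDiff_const, fun _ => one_pos, fun x => by simp⟩

theorem ratio_ray_self [NeZero n] (g : Scale c) (x : M) : ratio g (g.ray x) = 1 :=
  ratio_ray (isRescaling_self g.1) x

theorem val_eq [NeZero n] {V : Type*} [AddCommGroup V] [Module ℝ V] {w : ℝ} {x : M}
    (g : Scale c) (τ : Weighted c x V w) (h : Ray c x) :
    τ.val h = ratio g h ^ w • τ.val (g.ray x) :=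
  τ.homog _ _ _ (ratio_pos g h) (ratio_spec g h)

theorem ofScale_val [NeZero n] {V : Type*} [AddCommGroup V] [Module ℝ V] {w : ℝ} {x : M}
    (g : Scale c) (τ : Weighted c x V w) : ofScale g w (τ.val (g.ray x)) = τ :=
  Weighted.ext (funext fun h => (val_eq g τ h).symm)

theorem ofScale_ray [NeZero n] {V : Type*} [AddCommGroup V] [Module ℝ V] {w : ℝ} {x : M}
    (g : Scale c) (v : V) : (ofScale g w v : Weighted c x V w).val (g.ray x) = v := by
  change ratio g (g.ray x) ^ w • v = v
  rw [ratio_ray_self, Real.one_rpow, one_smul]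

theorem densAt_eq [NeZero n] {g g' : Scale c} {Ω : M → ℝ} (h : IsRescaling Ω g.1 g'.1) {w : ℝ}
    (τ : ∀ x, Density c w x) : densAt g' τ = fun x => Ω x ^ w * densAt g τ x := by
  funext x
  rw [densAt, val_eq g, ratio_ray h]
  rfl

theorem densAt_one_eq [NeZero n] {g g' : Scale c} {Ω : M → ℝ} (h : IsRescaling Ω g.1 g'.1)
    (σ : ∀ x, Density c 1 x) : densAt g' σ = fun x => Ω x * densAt g σ x := by
  rw [densAt_eq h]
  simp only [Real.rpow_one]

/-- The almost Einstein equation in one scale, in terms of `aeForm`. -/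
theorem almostEinstein_iff (hn : 3 ≤ n) (g : Scale c) {σ : ∀ x, Density c 1 x}
    (hσ : SmoothDensity σ) : AlmostEinstein g σ ↔
      ∀ e ∈ IsManifold.maximalAtlas (𝓡 n) ∞ M, ∀ y ∈ e.target,
        aeForm g.1 e (densAt g σ) y
          = (laplacePlusJ g.1 (densAt g σ) (e.symm y) / n) • metricForm g.1 e y :=
  forall₄_congr fun _ he _ hy => symTraceFree_eq_zero_iff g.1 hn (hσ g) he hy

theorem AlmostEinstein.rescale [NeZero n] (hn : 3 ≤ n) (g g' : Scale c) {σ : ∀ x, Density c 1 x}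
    (hσ : SmoothDensity σ) (h : AlmostEinstein g σ) : AlmostEinstein g' σ := by
  obtain ⟨Ω, hΩ⟩ := exists_isRescaling g g'
  rw [almostEinstein_iff hn g hσ] at h
  rw [almostEinstein_iff hn g' hσ]
  intro e he y hy
  have hpos := hΩ.2.1 (e.symm y)
  have hn0 : (n : ℝ) ≠ 0 := by exact_mod_cast NeZero.ne n
  have hG : metricForm g'.1 e y = (Ω (e.symm y)) ^ 2 • metricForm g.1 e y := by
    ext u v
    rw [metricForm_apply, hΩ.2.2, smul_apply, smul_apply, smul_apply, smul_apply,
      metricForm_apply]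
  rw [densAt_one_eq hΩ, hΩ.aeForm_eq hn (hσ g) he hy, h e he y hy,
    hΩ.laplacePlusJ_eq hn (hσ g), hG, ← add_smul, smul_smul, smul_smul]
  congr 1
  field_simp

theorem tractorD_eq [NeZero n] (hn : 3 ≤ n) (g g' : Scale c) {σ : ∀ x, Density c 1 x}
    (hσ : SmoothDensity σ) : tractorD g σ = tractorD g' σ := by
  obtain ⟨Ω, hΩ⟩ := exists_isRescaling g g'
  funext x
  refine Quot.sound ⟨Ω, hΩ, fun h => ?_⟩
  have hr := ratio_pos g' h
  have hpos := hΩ.2.1 x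
  have h1 : ratio g h = Ω x * ratio g' h := ratio_eq_mul hΩ h
  have h2 : (σ x).val h = ratio g h * densAt g σ x := by
    rw [val_eq g, Real.rpow_one]; rfl
  have h3 : ∀ α β : Cotangent n x,
      dualForm h.1 α β = (ratio g h ^ 2)⁻¹ * dualForm (g.1.form x) α β := by
    intro α β
    rw [ratio_spec g h]
    exact (g.1.isInnerForm x).dualForm_smul (pow_pos (ratio_pos g h) 2).ne' α β
  refine ⟨rfl, ?_, ?_⟩
  · change ratio g' h ^ (1 : ℝ) • ((n : ℝ) • mvfderiv (𝓡 n) (densAt g' σ) x)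
      = ratio g h ^ (1 : ℝ) • ((n : ℝ) • mvfderiv (𝓡 n) (densAt g σ) x)
        + ((n : ℝ) * (σ x).val h) • ((Ω x)⁻¹ • mvfderiv (𝓡 n) Ω x)
    rw [densAt_one_eq hΩ, mvfderiv_mul' hΩ.1 (hσ g), Real.rpow_one, Real.rpow_one, h2, h1]
    simp only [smul_add, smul_smul]
    congr 1
    · congr 1; ring
    · congr 1; field_simp
  · change ratio g' h ^ (-1 : ℝ) • (-laplacePlusJ g'.1 (densAt g' σ) x)
      = ratio g h ^ (-1 : ℝ) • (-laplacePlusJ g.1 (densAt g σ) x)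
        - dualForm h.1 ((Ω x)⁻¹ • mvfderiv (𝓡 n) Ω x)
          (ratio g h ^ (1 : ℝ) • ((n : ℝ) • mvfderiv (𝓡 n) (densAt g σ) x))
        - (1 / 2) * ((n : ℝ) * (σ x).val h) * dualForm h.1 ((Ω x)⁻¹ • mvfderiv (𝓡 n) Ω x)
          ((Ω x)⁻¹ • mvfderiv (𝓡 n) Ω x)
    rw [densAt_one_eq hΩ, hΩ.laplacePlusJ_eq hn (hσ g), Real.rpow_one, Real.rpow_neg_one,
      Real.rpow_neg_one, h3, h3, dualForm_smul_right (ratio g h), dualForm_smul_right (n : ℝ),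
      aeShift, h2, h1, smul_eq_mul, smul_eq_mul]
    field_simp
    ring

end Scales

section TractorBundle

variable {n : ℕ} {M : Type*} [TopologicalSpace M] [ChartedSpace (Model n) M]
  [IsManifold (𝓡 n) ∞ M] {c : ConformalStructure n M}

theorem projX_mk {g : Scale c} {t : ∀ x, Triple c x} {I : ∀ x, Tractor c x}
    (h : ∀ x, I x = Tractor.mk g (t x)) : projX I = fun x => (t x).top := by
  funext x
  rw [projX, h]
  rfl

end TractorBundle

section Covectors

variable {n : ℕ} {M : Type*} [TopologicalSpace M] [ChartedSpace (Model n) M]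
  [IsManifold (𝓡 n) ∞ M] {f : M → ℝ} {e : OpenPartialHomeomorph M (Model n)}

theorem contMDiff_mvfderiv (hf : ContMDiff (𝓡 n) 𝓘(ℝ) ∞ f) :
    ContMDiff (𝓡 n) ((𝓡 n).prod 𝓘(ℝ, Model n →L[ℝ] ℝ)) ∞
      (fun x => Bundle.TotalSpace.mk' (Model n →L[ℝ] ℝ)
        (E := fun x : M => TangentSpace (𝓡 n) x →L[ℝ] Bundle.Trivial M ℝ x) x
        (mvfderiv (𝓡 n) f x)) := by
  intro x₀
  refine (contMDiffAt_hom_bundle _).2 ⟨contMDiffAt_id, ?_⟩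
  refine ((hf x₀).mfderiv_const (m := ∞) (by simp)).congr_of_eventuallyEq
    (Filter.Eventually.of_forall fun x => ?_)
  ext v
  simp [inTangentCoordinates, ContinuousLinearMap.inCoordinates, mvfderiv]
  rfl

theorem contMDiff_smul_mvfderiv {Ω : M → ℝ} (hΩ : ContMDiff (𝓡 n) 𝓘(ℝ) ∞ Ω)
    (hf : ContMDiff (𝓡 n) 𝓘(ℝ) ∞ f) :
    ContMDiff (𝓡 n) ((𝓡 n).prod 𝓘(ℝ, Model n →L[ℝ] ℝ)) ∞
      (fun x => Bundle.TotalSpace.mk' (Model n →L[ℝ] ℝ)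
        (E := fun x : M => TangentSpace (𝓡 n) x →L[ℝ] Bundle.Trivial M ℝ x) x
        (Ω x • mvfderiv (𝓡 n) f x)) :=
  hΩ.smul_section (contMDiff_mvfderiv hf)

theorem schouten_raise (g : PMetric n M) (he : e ∈ IsManifold.maximalAtlas (𝓡 n) ∞ M)
    {y : Model n} (hy : y ∈ e.target) (θ : Model n →L[ℝ] ℝ) (i : Fin n) :
    ∑ j, ∑ k, schouten g e i j y * gInv g e y j k * θ (unitVec k)
      = schP (metricForm g e) (connForm g e) y (unitVec i) ((metricForm g e y).inverse θ) := by
  have hG := isInner_metricForm g he hy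
  have h1 : (metricForm g e y).inverse θ
      = ∑ j, (Matrix.mulVec (gInv g e y) (fun k => θ (unitVec k)) j) • unitVec j := by
    rw [← hG.inverse_apply (∑ j, _ • unitVec j)]
    congr 1
    refine clm_ext_unitVec fun m => ?_
    rw [hG.symm]
    simp only [map_sum, map_smul, smul_eq_mul, metricForm_unitVec]
    have h2 := congrFun (Matrix.mulVec_mulVec (fun k => θ (unitVec k)) (gCoord g e y)
      (gInv g e y)) m
    rw [gInv, Matrix.mul_nonsing_inv _ (isUnit_det_gCoord g he hy), Matrix.one_mulVec] at h2
    rw [← h2, Matrix.mulVec, dotProduct]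
    exact Finset.sum_congr rfl fun k _ => mul_comm _ _
  rw [h1]
  simp only [map_sum, map_smul, smul_eq_mul, ← schouten_eq g he hy, Matrix.mulVec, dotProduct,
    Finset.sum_mul]
  exact Finset.sum_congr rfl fun j _ => Finset.sum_congr rfl fun k _ => by ring

theorem cotangent_ext (he : e ∈ IsManifold.maximalAtlas (𝓡 n) ∞ M) {y : Model n}
    (hy : y ∈ e.target) {α β : Cotangent n (e.symm y)}
    (h : ∀ i, α (coordVec e i y) = β (coordVec e i y)) : α = β := by
  ext w
  obtain ⟨v, rfl⟩ := (chartDeriv_bijective he hy).2 w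
  have h1 : (α ∘L chartDeriv e y : Model n →L[ℝ] ℝ) = (β ∘L chartDeriv e y : Model n →L[ℝ] ℝ) :=
    clm_ext_unitVec fun i => h i
  exact congrArg (fun L : Model n →L[ℝ] ℝ => L v) h1

end Covectors

section ScaleTractor

variable {n : ℕ} [NeZero n] {M : Type*} [TopologicalSpace M] [ChartedSpace (Model n) M]
  [IsManifold (𝓡 n) ∞ M] {c : ConformalStructure n M}

/-- The triple of `(1/n) D σ` in the scale `g`. -/
def scaleTriple (g : Scale c) (σ : ∀ x, Density c 1 x) (x : M) : Triple c x where
  top := σ x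
  mid := ofScale g 1 (mvfderiv (𝓡 n) (densAt g σ) x)
  bot := ofScale g (-1) (-(laplacePlusJ g.1 (densAt g σ) x / n))

theorem laplacePlusJ_div_eq (hn : 3 ≤ n) {g : PMetric n M} {f : M → ℝ}
    (hf : ContMDiff (𝓡 n) 𝓘(ℝ) ∞ f) {e : OpenPartialHomeomorph M (Model n)}
    (he : e ∈ IsManifold.maximalAtlas (𝓡 n) ∞ M) {y : Model n} (hy : y ∈ e.target) {a : ℝ}
    (h : aeForm g e f y = a • metricForm g e y) : laplacePlusJ g f (e.symm y) / n = a := by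
  have hn0 : (n : ℝ) ≠ 0 := by exact_mod_cast NeZero.ne n
  rw [laplacePlusJ_eq g hn hf he hy, h, trG_smul, (isInner_metricForm g he hy).trG_self,
    finrank_model]
  field_simp

theorem scaleTractor_eq_mk (g : Scale c) (σ : ∀ x, Density c 1 x) (x : M) :
    scaleTractor g σ x = Tractor.mk g (scaleTriple g σ x) := by
  have hn : (n : ℝ) ≠ 0 := by exact_mod_cast NeZero.ne n
  change Tractor.mk g _ = _
  congr 1
  refine Triple.ext (Weighted.ext (funext fun h => ?_)) (Weighted.ext (funext fun h => ?_))
    (Weighted.ext (funext fun h => ?_))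
  · change 1 / (n : ℝ) * (n * (σ x).val h) = (σ x).val h
    field_simp
  · change ((1 / (n : ℝ)) • (ratio g h ^ (1 : ℝ) • ((n : ℝ) • mvfderiv (𝓡 n) (densAt g σ) x)))
      = ratio g h ^ (1 : ℝ) • mvfderiv (𝓡 n) (densAt g σ) x
    rw [smul_smul, smul_smul]
    congr 1
    field_simp
  · change 1 / (n : ℝ) * (ratio g h ^ (-1 : ℝ) * (-laplacePlusJ g.1 (densAt g σ) x))
      = ratio g h ^ (-1 : ℝ) * (-(laplacePlusJ g.1 (densAt g σ) x / n))
    ring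

theorem projX_scaleTractor (g : Scale c) (σ : ∀ x, Density c 1 x) :
    projX (scaleTractor g σ) = σ :=
  projX_mk (scaleTractor_eq_mk g σ)

theorem scaleTractor_eq (hn : 3 ≤ n) (g g' : Scale c) {σ : ∀ x, Density c 1 x}
    (hσ : SmoothDensity σ) : scaleTractor g σ = scaleTractor g' σ := by
  funext x
  rw [scaleTractor, tractorD_eq hn g g' hσ]
  rfl

theorem smoothDensity_of_densAt {w : ℝ} (g : Scale c) {τ : ∀ x, Density c w x}
    (h : ContMDiff (𝓡 n) 𝓘(ℝ) ∞ (densAt g τ)) : SmoothDensity τ := by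
  intro g'
  obtain ⟨Ω, hΩ⟩ := exists_isRescaling g g'
  rw [densAt_eq hΩ]
  refine ContMDiff.mul (fun x => ?_) h
  exact (Real.contDiffAt_rpow_const_of_ne (hΩ.2.1 x).ne').contMDiffAt.comp x (hΩ.1 x)

theorem smoothTriple_scaleTriple (hn : 3 ≤ n) (g : Scale c) {σ : ∀ x, Density c 1 x}
    (hσ : SmoothDensity σ) : SmoothTriple (scaleTriple g σ) := by
  refine ⟨hσ, fun g' => ?_, smoothDensity_of_densAt g ?_⟩
  · obtain ⟨Ω, hΩ⟩ := exists_isRescaling g g'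
    have h : covAt g' (fun x => (scaleTriple g σ x).mid)
        = fun x => Ω x • mvfderiv (𝓡 n) (densAt g σ) x := by
      funext x
      change ratio g (g'.ray x) ^ (1 : ℝ) • mvfderiv (𝓡 n) (densAt g σ) x = _
      rw [ratio_ray hΩ, Real.rpow_one]
    rw [h]
    exact contMDiff_smul_mvfderiv hΩ.1 (hσ g)
  · have h : densAt g (fun x => (scaleTriple g σ x).bot)
        = fun x => -(laplacePlusJ g.1 (densAt g σ) x / n) := funext fun x => ofScale_ray g _
    rw [h]
    exact ((contMDiff_laplacePlusJ g.1 hn (hσ g)).div_const _).neg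

theorem smoothTractor_scaleTractor (hn : 3 ≤ n) (g : Scale c) {σ : ∀ x, Density c 1 x}
    (hσ : SmoothDensity σ) : SmoothTractor (scaleTractor g σ) := by
  intro g'
  refine ⟨scaleTriple g' σ, smoothTriple_scaleTriple hn g' hσ, fun x => ?_⟩
  rw [scaleTractor_eq hn g g' hσ, scaleTractor_eq_mk]

theorem parallel_scaleTractor (hn : 3 ≤ n) (g : Scale c) {σ : ∀ x, Density c 1 x}
    (hσ : SmoothDensity σ) (h : AlmostEinstein g σ) : Parallel g (scaleTractor g σ) := by
  refine ⟨scaleTriple g σ, smoothTriple_scaleTriple hn g hσ, scaleTractor_eq_mk g σ,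
    fun e he y hy i => ?_⟩
  rw [almostEinstein_iff hn g hσ] at h
  have hmid : covAt g (fun x => (scaleTriple g σ x).mid) = mvfderiv (𝓡 n) (densAt g σ) :=
    funext fun x => ofScale_ray g _
  have hbot : densAt g (fun x => (scaleTriple g σ x).bot)
      = fun x => -(laplacePlusJ g.1 (densAt g σ) x / n) := funext fun x => ofScale_ray g _
  have hd : ∀ z, MDifferentiableAt (𝓡 n) 𝓘(ℝ) (densAt g σ) z :=
    fun z => (hσ g z).mdifferentiableAt (by simp)
  have hl : ContMDiff (𝓡 n) 𝓘(ℝ) ∞ (fun x => laplacePlusJ g.1 (densAt g σ) x / n) :=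
    (contMDiff_laplacePlusJ g.1 hn (hσ g)).div_const _
  have htop : densAt g (fun x => (scaleTriple g σ x).top) = densAt g σ := rfl
  simp only [tractorConnection, hmid, hbot, htop]
  refine Prod.ext (sub_self _) (Prod.ext (funext fun j => ?_) ?_)
  · have h1 := congrArg (fun T : Model n →L[ℝ] Model n →L[ℝ] ℝ => T (unitVec i) (unitVec j))
      (h e he y hy)
    simp only [aeForm, add_apply, smul_apply, smul_eq_mul, metricForm_unitVec,
      ← covForm_eq g.1 he (hσ g) hy, ← schouten_eq g.1 he hy] at h1
    change hess g.1 e (densAt g σ) i j y + _ + _ = 0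
    linear_combination h1
  · have h2 := (leviCivitaOn g.1 he).prolongation (finrank_model.symm ▸ hn)
      (contDiffOn_comp_symm (hσ g) he) (contDiffOn_comp_symm hl he) (h e he) hy (unitVec i)
    have h3 : ∀ k, formCoord (mvfderiv (𝓡 n) (densAt g σ)) e k y
        = fderiv ℝ (fun z => densAt g σ (e.symm z)) y (unitVec k) :=
      fun k => formCoord_mvfderiv he hy (hd _) k
    change formCoord (mvfderiv (𝓡 n) (fun x => -(laplacePlusJ g.1 (densAt g σ) x / n))) e i y
      - _ = 0
    simp only [h3]
    rw [schouten_raise g.1 he hy, formCoord_mvfderiv he hy (hl.neg.mdifferentiableAt (by simp)), pd]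
    rw [fderiv_fun_neg, neg_apply]
    change -(fderiv ℝ _ y (unitVec i)) - _ = 0
    rw [h2]
    ring

/-- A parallel tractor is the scale tractor of its projecting part. -/
theorem Parallel.eq_scaleTractor (hn : 3 ≤ n) {g : Scale c} {I : ∀ x, Tractor c x}
    (h : Parallel g I) : SmoothDensity (projX I) ∧ AlmostEinstein g (projX I) ∧
      scaleTractor g (projX I) = I := by
  obtain ⟨t, ht, hI, hpar⟩ := h
  rw [projX_mk hI]
  set σ : ∀ x, Density c 1 x := fun x => (t x).top with hσdef
  have hσ : SmoothDensity σ := ht.1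
  set ρ : M → ℝ := densAt g (fun x => (t x).bot) with hρ
  have hmid : covAt g (fun x => (t x).mid) = mvfderiv (𝓡 n) (densAt g σ) := by
    funext x
    obtain ⟨e, he, y, hy, rfl⟩ := exists_chart (n := n) x
    refine cotangent_ext he hy fun i => ?_
    exact (sub_eq_zero.1 (congrArg Prod.fst (hpar e he y hy i))).symm
  have hae : ∀ e ∈ IsManifold.maximalAtlas (𝓡 n) ∞ M, ∀ y ∈ e.target,
      aeForm g.1 e (densAt g σ) y = (-ρ (e.symm y)) • metricForm g.1 e y := by
    intro e he y hy
    refine clm_ext_unitVec fun i => clm_ext_unitVec fun j => ?_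
    have h1 := congrFun (congrArg (fun p => p.2.1) (hpar e he y hy i)) j
    simp only [tractorConnection, hmid] at h1
    change hess g.1 e (densAt g σ) i j y + gCoord g.1 e y i j * ρ (e.symm y)
      + schouten g.1 e i j y * densAt g σ (e.symm y) = 0 at h1
    simp only [aeForm, add_apply, smul_apply, smul_eq_mul, metricForm_unitVec,
      ← covForm_eq g.1 he (hσ g) hy, ← schouten_eq g.1 he hy]
    linear_combination h1
  have hlap : ∀ x, laplacePlusJ g.1 (densAt g σ) x / n = -ρ x := by
    intro x
    obtain ⟨e, he, y, hy, rfl⟩ := exists_chart (n := n) x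
    exact laplacePlusJ_div_eq hn (hσ g) he hy (hae e he y hy)
  refine ⟨hσ, (almostEinstein_iff hn g hσ).2 fun e he y hy => ?_, ?_⟩
  · rw [hae e he y hy, hlap]
  · funext x
    rw [scaleTractor_eq_mk, hI x]
    congr 1
    refine Triple.ext rfl ?_ ?_
    · change ofScale g 1 (mvfderiv (𝓡 n) (densAt g σ) x) = _
      rw [← hmid]
      exact ofScale_val g (t x).mid
    · change ofScale g (-1) (-(laplacePlusJ g.1 (densAt g σ) x / n)) = _
      rw [hlap, neg_neg]
      exact ofScale_val g (t x).bot

theorem parallel_iff (hn : 3 ≤ n) (g : Scale c) (I : ∀ x, Tractor c x) :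
    Parallel g I ↔ SmoothDensity (projX I) ∧ AlmostEinstein g (projX I) ∧
      scaleTractor g (projX I) = I :=
  ⟨fun h => h.eq_scaleTractor hn, fun h => h.2.2 ▸ parallel_scaleTractor hn g h.1 h.2.1⟩

theorem Parallel.rescale (hn : 3 ≤ n) (g g' : Scale c) {I : ∀ x, Tractor c x}
    (h : Parallel g I) : Parallel g' I := by
  rw [parallel_iff hn] at h ⊢
  exact ⟨h.1, h.2.1.rescale hn g g' h.1, (scaleTractor_eq hn g' g h.1).trans h.2.2⟩

theorem bijOn_scaleTractor (hn : 3 ≤ n) (g : Scale c) :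
    Set.InvOn projX (scaleTractor g) {σ | SmoothDensity σ ∧ AlmostEinstein g σ}
        {I | SmoothTractor I ∧ Parallel g I} ∧
      Set.MapsTo (scaleTractor g) {σ | SmoothDensity σ ∧ AlmostEinstein g σ}
        {I | SmoothTractor I ∧ Parallel g I} ∧
      Set.MapsTo projX {I | SmoothTractor I ∧ Parallel g I}
        {σ | SmoothDensity σ ∧ AlmostEinstein g σ} :=
  ⟨⟨fun σ _ => projX_scaleTractor g σ, fun _ h => (h.2.eq_scaleTractor hn).2.2⟩,
    fun _ h => ⟨smoothTractor_scaleTractor hn g h.1, parallel_scaleTractor hn g h.1 h.2⟩,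
    fun _ h => ⟨(h.2.eq_scaleTractor hn).1, (h.2.eq_scaleTractor hn).2.1⟩⟩

end ScaleTractor

section EinsteinScales

variable {n : ℕ} [NeZero n] {M : Type*} [TopologicalSpace M] [ChartedSpace (Model n) M]
  [IsManifold (𝓡 n) ∞ M] {c : ConformalStructure n M} {g : PMetric n M} {f : M → ℝ}
  {e : OpenPartialHomeomorph M (Model n)}

/-- The metric `Ω² g`. -/
def PMetric.rescale (g : PMetric n M) {Ω : M → ℝ} (hΩ : ContMDiff (𝓡 n) 𝓘(ℝ) ∞ Ω)
    (hpos : ∀ x, 0 < Ω x) : PMetric n M where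
  form x := (Ω x) ^ 2 • g.form x
  symm x := ((g.isInnerForm x).smul (pow_pos (hpos x) 2).ne').symm
  nondegenerate x := ((g.isInnerForm x).smul (pow_pos (hpos x) 2).ne').nondeg
  smooth := (hΩ.pow 2).smul_section g.smooth

theorem aeForm_of_sq_eq_one (hf : ContMDiff (𝓡 n) 𝓘(ℝ) ∞ f) (h1 : ∀ x, f x ^ 2 = 1)
    (he : e ∈ IsManifold.maximalAtlas (𝓡 n) ∞ M) {y : Model n} (hy : y ∈ e.target) :
    aeForm g e f y = f (e.symm y) • schP (metricForm g e) (connForm g e) y := by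
  have hc := contDiffOn_comp_symm hf he
  have h2 : ∀ z ∈ e.target, fderiv ℝ (fun z => f (e.symm z)) z = 0 := by
    intro z hz
    have hd := hc.differentiableAt_of_isOpen e.open_target hz
    have h3 : (fun z => f (e.symm z) * f (e.symm z)) = fun _ => (1 : ℝ) :=
      funext fun z => by rw [← sq, h1]
    have h4 := fderiv_fun_mul hd hd
    rw [h3, fderiv_fun_const, Pi.zero_apply, ← two_smul ℝ, smul_smul] at h4
    have h5 : f (e.symm z) ≠ 0 := fun h0 => by simpa [h0] using h1 (e.symm z)
    exact (smul_eq_zero.1 h4.symm).resolve_left (mul_ne_zero two_ne_zero h5)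
  have h6 : hessForm (connForm g e) (fun z => f (e.symm z)) y = 0 := by
    have h7 : fderiv ℝ (fun z => f (e.symm z)) =ᶠ[𝓝 y] fun _ => 0 :=
      Filter.eventually_of_mem (e.open_target.mem_nhds hy) h2
    ext u v
    rw [hessForm_apply, h7.fderiv_eq, h2 y hy]
    simp
  rw [aeForm, h6, zero_add]

/-- A constant `f = ±1` satisfies the almost Einstein equation only for an Einstein metric. -/
theorem isEinstein_of_aeForm (hn : 3 ≤ n) (hf : ContMDiff (𝓡 n) 𝓘(ℝ) ∞ f)
    (h1 : ∀ x, f x ^ 2 = 1) (l : M → ℝ)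
    (h : ∀ e ∈ IsManifold.maximalAtlas (𝓡 n) ∞ M, ∀ y ∈ e.target,
      aeForm g e f y = l (e.symm y) • metricForm g e y) : IsEinstein g := by
  refine ⟨fun x => ((n : ℝ) - 2) * (f x * l x)
    + schoutenTrace g (chartAt (Model n) x) (chartAt (Model n) x x), fun e he y hy i j => ?_⟩
  have h2 := h e he y hy
  rw [aeForm_of_sq_eq_one hf h1 he hy] at h2
  have h3 := congrArg (fun T : Model n →L[ℝ] Model n →L[ℝ] ℝ =>
    f (e.symm y) * T (unitVec i) (unitVec j)) h2
  simp only [smul_apply, smul_eq_mul, metricForm_unitVec, ← mul_assoc, ← sq, h1, one_mul] at h3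
  beta_reduce
  rw [ricci_eq g he hy, LeviCivitaOn.ric_eq (G := metricForm g e) (finrank_model.symm ▸ hn),
    schJ_chart g he hy, finrank_model, metricForm_unitVec, h3]
  ring

theorem IsEinstein.aeForm_one (hg : IsEinstein g) : ∃ l : M → ℝ,
    ∀ e ∈ IsManifold.maximalAtlas (𝓡 n) ∞ M, ∀ y ∈ e.target,
      aeForm g e (fun _ => 1) y = l (e.symm y) • metricForm g e y := by
  obtain ⟨μ, hμ⟩ := hg
  refine ⟨fun x => ((n : ℝ) - 2)⁻¹ * (μ x
    - schoutenTrace g (chartAt (Model n) x) (chartAt (Model n) x x)), fun e he y hy => ?_⟩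
  rw [aeForm_of_sq_eq_one contMDiff_const (fun _ => one_pow 2) he hy, one_smul]
  refine clm_ext_unitVec fun i => clm_ext_unitVec fun j => ?_
  beta_reduce
  rw [← schouten_eq g he hy, schouten, hμ e he y hy, smul_apply, smul_apply, metricForm_unitVec,
    schJ_chart g he hy, schoutenTrace_eq g he hy, smul_eq_mul]
  ring

theorem isMetricOf_iff (σ : ∀ x, Density c 1 x) (g : Scale c) :
    IsMetricOf σ g ↔ ∀ x, densAt g σ x ^ 2 = 1 := by
  refine forall_congr' fun x => ⟨fun h => ?_, fun h r => ?_⟩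
  · have h1 : (1 : ℝ) • (g.ray x).1 = ((densAt g σ x ^ 2)⁻¹) • (g.ray x).1 := by
      rw [one_smul]; exact h (g.ray x)
    exact inv_eq_one.1 (smul_form_injective _ h1).symm
  · have h2 : (σ x).val r = ratio g r * densAt g σ x := by
      rw [val_eq g, Real.rpow_one]; rfl
    have h3 := (ratio_pos g r).ne'
    rw [h2, mul_pow, h, mul_one, ratio_spec g r, smul_smul,
      inv_mul_cancel₀ (pow_ne_zero 2 h3), one_smul]

theorem IsMetricOf.unique {σ : ∀ x, Density c 1 x} {g g' : Scale c} (h : IsMetricOf σ g)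
    (h' : IsMetricOf σ g') : g = g' :=
  Subtype.ext (PMetric.ext (funext fun x => (h x (g.ray x)).trans (h' x (g.ray x)).symm))

theorem exists_isMetricOf (g : Scale c) {σ : ∀ x, Density c 1 x} (hσ : SmoothDensity σ)
    (h0 : ∀ x h, (σ x).val h ≠ 0) : ∃ g₀ : Scale c, IsMetricOf σ g₀ := by
  have h1 : ∀ x, densAt g σ x ≠ 0 := fun x => h0 x _
  have h2 : ContMDiff (𝓡 n) 𝓘(ℝ) ∞ (fun x => |densAt g σ x|⁻¹) := by
    refine ContMDiff.inv₀ (fun x => ?_) fun x => abs_ne_zero.2 (h1 x)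
    exact (contDiffAt_abs (h1 x)).contMDiffAt.comp x (hσ g x)
  have h3 : ∀ x, 0 < |densAt g σ x|⁻¹ := fun x => inv_pos.2 (abs_pos.2 (h1 x))
  have h4 : IsRescaling (fun x => |densAt g σ x|⁻¹) g.1 (g.1.rescale h2 h3) :=
    ⟨h2, h3, fun _ => rfl⟩
  refine ⟨⟨g.1.rescale h2 h3, (Quotient.sound (s := conformalSetoid n M) ⟨_, h4⟩).symm.trans g.2⟩, ?_⟩
  rw [isMetricOf_iff]
  intro x
  rw [densAt_one_eq (g := g) h4, mul_pow, inv_pow, sq_abs,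
    inv_mul_cancel₀ (pow_ne_zero 2 (h1 x))]

theorem AlmostEinstein.isEinstein (hn : 3 ≤ n) {g : Scale c} {σ : ∀ x, Density c 1 x}
    (hσ : SmoothDensity σ) (h : AlmostEinstein g σ) (hg : IsMetricOf σ g) : IsEinstein g.1 :=
  isEinstein_of_aeForm hn (hσ g) ((isMetricOf_iff σ g).1 hg)
    (fun x => laplacePlusJ g.1 (densAt g σ) x / n) ((almostEinstein_iff hn g hσ).1 h)

/-- The positive density `σ` with `g = σ⁻² 𝐠`. -/
def scaleDensity (g : Scale c) (x : M) : Density c 1 x := ofScale g 1 (1 : ℝ)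

theorem densAt_scaleDensity (g : Scale c) : densAt g (scaleDensity g) = fun _ => 1 :=
  funext fun _ => ofScale_ray g _

theorem smoothDensity_scaleDensity (g : Scale c) : SmoothDensity (scaleDensity g) := by
  refine smoothDensity_of_densAt g ?_
  rw [densAt_scaleDensity]
  exact contMDiff_const

theorem isMetricOf_scaleDensity (g : Scale c) : IsMetricOf (scaleDensity g) g := by
  rw [isMetricOf_iff, densAt_scaleDensity]
  exact fun _ => one_pow 2

theorem scaleDensity_pos (g : Scale c) (x : M) (h : Ray c x) : 0 < (scaleDensity g x).val h := by
  change 0 < ratio g h ^ (1 : ℝ) * 1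
  rw [mul_one, Real.rpow_one]
  exact ratio_pos g h

theorem IsMetricOf.eq_scaleDensity {g : Scale c} {σ : ∀ x, Density c 1 x} (h : IsMetricOf σ g)
    (hpos : ∀ x h, 0 < (σ x).val h) : σ = scaleDensity g := by
  funext x
  have h1 : (σ x).val (g.ray x) = 1 :=
    (pow_eq_one_iff_of_nonneg (hpos x _).le two_ne_zero).1 ((isMetricOf_iff σ g).1 h x)
  rw [← ofScale_val g (σ x), h1]
  rfl

theorem almostEinstein_scaleDensity (hn : 3 ≤ n) {g : Scale c} (hg : IsEinstein g.1) :
    AlmostEinstein g (scaleDensity g) := by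
  rw [almostEinstein_iff hn g (smoothDensity_scaleDensity g), densAt_scaleDensity]
  intro e he y hy
  obtain ⟨l, hl⟩ := hg.aeForm_one
  rw [laplacePlusJ_div_eq hn contMDiff_const he hy (hl e he y hy), hl e he y hy]

end EinsteinScales

end ConformalTractor

end

theorem mainTheorem2 {n : ℕ} [NeZero n] (hn : 3 ≤ n) {M : Type*} [TopologicalSpace M]
    [ChartedSpace (Model n) M] [IsManifold (𝓡 n) ∞ M] (c : ConformalStructure n M) :
    -- the almost Einstein equation, `D` and parallelism do not depend on the metric in `c`
    (∀ (g g' : Scale c) (σ : ∀ x, Density c 1 x), SmoothDensity σ →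
      (AlmostEinstein g σ ↔ AlmostEinstein g' σ)) ∧
    (∀ (g g' : Scale c) (σ : ∀ x, Density c 1 x), SmoothDensity σ →
      tractorD g σ = tractorD g' σ) ∧
    (∀ (g g' : Scale c) (I : ∀ x, Tractor c x), SmoothTractor I →
      (Parallel g I ↔ Parallel g' I)) ∧
    ∀ g : Scale c,
      -- `σ ↦ (1/n) D σ` is a bijection onto the parallel tractors, with inverse `I ↦ X^A I_A`
      Set.BijOn (scaleTractor g) {σ | SmoothDensity σ ∧ AlmostEinstein g σ}
        {I | SmoothTractor I ∧ Parallel g I} ∧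
      Set.InvOn projX (scaleTractor g) {σ | SmoothDensity σ ∧ AlmostEinstein g σ}
        {I | SmoothTractor I ∧ Parallel g I} ∧
      -- a parallel tractor with nowhere vanishing `σ = X^A I_A` gives the Einstein metric `σ⁻² 𝐠`
      (∀ I, SmoothTractor I → Parallel g I → (∀ x h, (projX I x).val h ≠ 0) →
        ∃! g₀ : Scale c, IsMetricOf (projX I) g₀ ∧ IsEinstein g₀.1) ∧
      -- each Einstein metric in `c` arises from exactly one parallel tractor with positive `σ`
      (∀ g₀ : Scale c, IsEinstein g₀.1 →
        ∃! I : ∀ x, Tractor c x, SmoothTractor I ∧ Parallel g I ∧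
          (∀ x h, 0 < (projX I x).val h) ∧ IsMetricOf (projX I) g₀) := by
  refine ⟨fun g g' σ hσ => ⟨.rescale hn g g' hσ, .rescale hn g' g hσ⟩,
    fun g g' σ hσ => tractorD_eq hn g g' hσ,
    fun g g' I _ => ⟨.rescale hn g g', .rescale hn g' g⟩, fun g => ?_⟩
  obtain ⟨hinv, hmap, hmap'⟩ := bijOn_scaleTractor hn g
  refine ⟨hinv.bijOn hmap hmap', hinv, fun I _ hI h0 => ?_, fun g₀ hg₀ => ?_⟩
  · obtain ⟨hσ, hae, -⟩ := hI.eq_scaleTractor hn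
    obtain ⟨g₀, hg₀⟩ := exists_isMetricOf g hσ h0
    exact ⟨g₀, ⟨hg₀, (hae.rescale hn g g₀ hσ).isEinstein hn hσ hg₀⟩,
      fun g₁ hg₁ => hg₁.1.unique hg₀⟩
  · have hσ := smoothDensity_scaleDensity g₀
    have hae := (almostEinstein_scaleDensity hn hg₀).rescale hn g₀ g hσ
    refine ⟨scaleTractor g (scaleDensity g₀), ⟨smoothTractor_scaleTractor hn g hσ,
      parallel_scaleTractor hn g hσ hae, ?_, ?_⟩, fun I hI => ?_⟩
    · rw [projX_scaleTractor]
      exact scaleDensity_pos g₀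
    · rw [projX_scaleTractor]
      exact isMetricOf_scaleDensity g₀
    · rw [← (hI.2.1.eq_scaleTractor hn).2.2, hI.2.2.2.eq_scaleDensity hI.2.2.1]
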